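/- Let $\nu,\eta>0$ and let $f_1,f_2\in L^\infty_{loc}([0,\infty);L^2(\mathbb R^3;\mathbb R^3))$ be divergence free. Consider the MHD system on $(0,\infty)\times\mathbb R^3$ $$\partial_t u+(u\cdot\nabla)u+\nabla\pi-(b\cdot\nabla)b-\nu\Delta u=f_1,\qquad \partial_t b+(u\cdot\nabla)b-(b\cdot\nabla)u-\eta\Delta b=f_2,$$ $\operatorname{div}u=\operatorname{div}b=0$, $u|_{t=0}=u_0$, $b|_{t=0}=b_0$, where $u_0,b_0\in L^2_\sigma$. Here $L^2_\sigma$ and $H^1_\sigma$ are the closures in $L^2$ and $H^1$ of the smooth, compactly supported, divergence free vector fields. Let $(u,b)$ be a Leray weak solution, that is: (1) $u,b\in L^\infty([0,T);L^2_\sigma)\cap L^2([0,T);H^1_\sigma)$ for every $T>0$; (2) for all smooth compactly supported fields $\Phi,\Psi$ on $\mathbb R\times\mathbb R^3$ that are divergence free in $x$, $$\int_0^\infty\{-(u,\partial_t\Phi)+\nu(\nabla u,\nabla\Phi)+(u\cdot\nabla u-b\cdot\nabla b,\Phi)\}\,dt=(u_0,\Phi(0))+\int_0^\infty(f_1,\Phi)\,dt,$$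 $$\int_0^\infty\{-(b,\partial_t\Psi)+\eta(\nabla b,\nabla\Psi)+(u\cdot\nabla b-b\cdot\nabla u,\Psi)\}\,dt=(b_0,\Psi(0))+\int_0^\infty(f_2,\Psi)\,dt,$$ and $u(t)\to u_0$, $b(t)\to b_0$ strongly in $L^2$ as $t\to0^+$; (3) for all $t>0$, $$\tfrac12\big(\|u(t)\|_{L^2}^2+\|b(t)\|_{L^2}^2\big)+\min(\nu,\eta)\int_0^t\big(\|\nabla u\|_{L^2}^2+\|\nabla b\|_{L^2}^2\big)ds-\int_0^t\big((u,f_1)+(b,f_2)\big)ds\le\tfrac12\big(\|u_0\|_{L^2}^2+\|b_0\|_{L^2}^2\big).$$ Let $R(t)$ satisfy $\|u(t)\|_{L^2}^2+\|b(t)\|_{L^2}^2\le R^2(t)$ for all $t>0$. Let $k\in\mathbb R^3\setminus\{0\}$ and $0<\delta<|k|/(2\sqrt3)$. Let $\widehat\chi_k\in C^\infty(\mathbb R^3;[0,1])$ be supported in the cube $\{\xi:|\xi_i-k_i|\le\delta,\ i=1,2,3\}$ and equal to $1$ on the concentric cube of side $\delta$. With $\widehat v(\xi)=\int e^{-i\xi\cdot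 x}v(x)\,dx$ (extended to $L^2$) and $2\le p<\infty$ put $$e_p(k,t)=\Big(\int_{\mathbb R^3}|\widehat\chi_k\widehat u(\xi,t)|^p+|\widehat\chi_k\widehat b(\xi,t)|^p\,d\xi\Big)^{1/p},$$ $$h_p(k,t)=\operatorname*{ess\,sup}_{0\le s\le t}\Big(\int_{\mathbb R^3}\frac{|\widehat\chi_k\widehat f_1(\xi,s)|^p+|\widehat\chi_k\widehat f_2(\xi,s)|^p}{|\xi|^p}\,d\xi\Big)^{1/p},$$ where $e_p(k,0)$ is formed with $(u_0,b_0)$. Suppose that a nondecreasing function $R_1:[0,\infty)\to\mathbb R$ satisfies $$2^{1/p}(2\delta)^{3/p}R^2(t)+2h_p(k,t)<\frac{\min(\nu,\eta)}6R_1(t)\qquad\text{for all }t\ge0\text{ and all }2\le p<\infty.$$ If $\sup_{2\le p<\infty}e_p(k,0)<R_1(0)/|k|$, then $$\sup_{2\le p<\infty}e_p(k,t)<\frac{R_1(t)}{|k|}$$ for almost every $t>0$; and if $u,b$ are represented, as usual, by functions that are weakly continuous from $(0,\infty)$ to $L^2$, then this holds for every $t>0$. -/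

import Mathlib

open MeasureTheory Set Filter Topology
open scoped ENNReal ContDiff FourierTransform

noncomputable section

namespace MHD

/-- The spatial domain `ℝ³`. -/
abbrev E3 := EuclideanSpace ℝ (Fin 3)

/-- `ℂ³` with its Hermitian norm. -/
abbrev C3 := EuclideanSpace ℂ (Fin 3)

/-- Square integrable vector fields on `ℝ³`. -/
abbrev L2 := Lp E3 2 (volume : Measure E3)

/-- The standard basis of `ℝ³`. -/
def e (i : Fin 3) : E3 := EuclideanSpace.single i (1 : ℝ)

/-- The divergence of a differentiable vector field. -/
def divergence (φ : E3 → E3) (x : E3) : ℝ := ∑ i, (fderiv ℝ φ x (e i)) i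

/-- The class `C₀,σ^∞` of divergence free smooth vector fields with compact support. -/
def IsTestField (φ : E3 → E3) : Prop :=
  ContDiff ℝ ∞ φ ∧ HasCompactSupport φ ∧ ∀ x, divergence φ x = 0

/-- `L²_σ`: the closure of `C₀,σ^∞` in `L²`. -/
def L2sigma : Set L2 := closure {v | ∃ φ, IsTestField φ ∧ v =ᵐ[volume] φ}

/-- `v` belongs to `H¹_σ` (the closure of `C₀,σ^∞` with respect to the `H¹` norm) and
`G i` is its weak partial derivative in the direction `i`: the pair is an `L²` limit of pairs
consisting of a test field and its partial derivatives. -/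
def IsH1sigmaWithGradient (v : L2) (G : Fin 3 → L2) : Prop :=
  (v, G) ∈ closure {q : L2 × (Fin 3 → L2) | ∃ φ, IsTestField φ ∧ q.1 =ᵐ[volume] φ ∧
    ∀ i, q.2 i =ᵐ[volume] fun x => fderiv ℝ φ x (e i)}

/-- The distributional divergence of `v` vanishes. -/
def IsDivFree (v : L2) : Prop :=
  ∀ ψ : E3 → ℝ, ContDiff ℝ ∞ ψ → HasCompactSupport ψ → ∫ x, fderiv ℝ ψ x (v x) = 0

/-- The transport term `((a · ∇) w)(x)`, where `G` is the gradient of `w`. -/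
def advect (a : L2) (G : Fin 3 → L2) (x : E3) : E3 := ∑ j, (a x) j • G j x

/-- Space-time test fields: smooth, compactly supported in `ℝ × ℝ³` (tested on `[0, ∞) × ℝ³`, so
they need not vanish at time `0`), and divergence free at each time. -/
def IsSpaceTimeTestField (Φ : ℝ → E3 → E3) : Prop :=
  ContDiff ℝ ∞ (fun z : ℝ × E3 => Φ z.1 z.2) ∧
  HasCompactSupport (fun z : ℝ × E3 => Φ z.1 z.2) ∧
  ∀ t x, divergence (Φ t) x = 0

/-- `w` (with spatial gradient `G`) solves `∂ₜ w + N + ∇π - κ Δ w = f`, `w(0) = w₀`, tested against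
divergence free fields. -/
def WeakEquation (κ : ℝ) (w₀ : L2) (w : ℝ → L2) (G : ℝ → Fin 3 → L2)
    (N : ℝ → E3 → E3) (f : ℝ → L2) : Prop :=
  ∀ Φ : ℝ → E3 → E3, IsSpaceTimeTestField Φ →
    ∫ t in Ioi (0 : ℝ),
        (-(∫ x, inner ℝ (w t x) (deriv (fun s => Φ s x) t))
          + κ * (∑ i, (∫ x, inner ℝ (G t i x) (fderiv ℝ (Φ t) x (e i))))
          + (∫ x, inner ℝ (N t x) (Φ t x)))
      = (∫ x, inner ℝ (w₀ x) (Φ 0 x)) + (∫ t in Ioi (0 : ℝ), (∫ x, inner ℝ (f t x) (Φ t x)))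

/-- Admissible forces: divergence free and in `L^∞_loc([0, ∞); L²)`. -/
structure IsForce (f : ℝ → L2) : Prop where
  memLp : ∀ T > 0, MemLp f ∞ (volume.restrict (Ioo 0 T))
  divFree : ∀ᵐ t ∂volume.restrict (Ioi (0 : ℝ)), IsDivFree (f t)

/-- `w ∈ L^∞([0, T); L²_σ) ∩ L²([0, T); H¹_σ)` for every `T > 0`, with spatial gradient `G`. -/
structure InEnergyClass (w : ℝ → L2) (G : ℝ → Fin 3 → L2) : Prop where
  memLp : ∀ T > 0, MemLp w ∞ (volume.restrict (Ioo 0 T))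
  mem_L2sigma : ∀ᵐ t ∂volume.restrict (Ioi (0 : ℝ)), w t ∈ L2sigma
  grad_memLp : ∀ T > 0, ∀ i, MemLp (fun t => G t i) 2 (volume.restrict (Ioo 0 T))
  grad : ∀ᵐ t ∂volume.restrict (Ioi (0 : ℝ)), IsH1sigmaWithGradient (w t) (G t)

/-- Leray weak solutions `(u, b)` on `[0, ∞) × ℝ³` of
`∂ₜ u + (u·∇)u + ∇π - (b·∇)b - ν Δ u = f₁`, `∂ₜ b + (u·∇)b - (b·∇)u - η Δ b = f₂`,
`div u = div b = 0`, with initial data `(u₀, b₀)`. -/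
def IsWeakSolution (ν η : ℝ) (f₁ f₂ : ℝ → L2) (u₀ b₀ : L2) (u b : ℝ → L2) : Prop :=
  u₀ ∈ L2sigma ∧ b₀ ∈ L2sigma ∧
  ∃ Gu Gb : ℝ → Fin 3 → L2,
    InEnergyClass u Gu ∧ InEnergyClass b Gb ∧
    WeakEquation ν u₀ u Gu
      (fun t x => advect (u t) (Gu t) x - advect (b t) (Gb t) x) f₁ ∧
    WeakEquation η b₀ b Gb
      (fun t x => advect (u t) (Gb t) x - advect (b t) (Gu t) x) f₂ ∧
    Tendsto u (𝓝[>] 0) (𝓝 u₀) ∧ Tendsto b (𝓝[>] 0) (𝓝 b₀) ∧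
    ∀ t > 0,
      (1 / 2) * (‖u t‖ ^ 2 + ‖b t‖ ^ 2)
          + min ν η * (∫ s in (0 : ℝ)..t, ∑ i, (‖Gu s i‖ ^ 2 + ‖Gb s i‖ ^ 2))
          - (∫ s in (0 : ℝ)..t, (inner ℝ (u s) (f₁ s) + inner ℝ (b s) (f₂ s)))
        ≤ (1 / 2) * (‖u₀‖ ^ 2 + ‖b₀‖ ^ 2)

/-- Weak continuity in `L²` on `(0, ∞)`. -/
def WeaklyContinuous (w : ℝ → L2) : Prop :=
  ∀ g : L2, ContinuousOn (fun t => (inner ℝ g (w t) : ℝ)) (Ioi 0)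

/-- The inclusion `ℝ³ → ℂ³`. -/
def toC3 : E3 →L[ℝ] C3 :=
  LinearMap.toContinuousLinearMap
    { toFun := fun v => WithLp.toLp 2 fun i => (v i : ℂ)
      map_add' := fun v w => by ext i; simp
      map_smul' := fun c v => by ext i; simp }

/-- The Fourier transform `v̂(ξ) = ∫ exp(-i ξ·x) v(x) dx` on `L²` (extended by density). Mathlib's
transform has the kernel `exp(-2πi ξ·x)`, whence the rescaling of the frequency. -/
def fhat (v : L2) (ξ : E3) : C3 :=
  (𝓕 (toC3.compLp v) : Lp C3 2 (volume : Measure E3)) ((2 * Real.pi)⁻¹ • ξ)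

/-- `χ` (playing the role of `χ̂_k`) is a smooth cutoff function of the cube with centre `k` and side
`2δ`, equal to `1` on the concentric cube of side `δ`. -/
structure IsCubeCutoff (k : E3) (δ : ℝ) (χ : E3 → ℝ) : Prop where
  smooth : ContDiff ℝ ∞ χ
  mem_Icc : ∀ ξ, χ ξ ∈ Icc (0 : ℝ) 1
  eq_one : ∀ ξ : E3, (∀ i, |ξ i - k i| ≤ δ / 2) → χ ξ = 1
  support_subset : tsupport χ ⊆ {ξ : E3 | ∀ i, |ξ i - k i| ≤ δ}

/-- `(∫ |χ v̂|^p + |χ ŵ|^p dξ)^(1/p)`. -/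
def ep (χ : E3 → ℝ) (p : ℝ) (v w : L2) : ℝ≥0∞ :=
  (∫⁻ ξ, (‖χ ξ • fhat v ξ‖ₑ ^ p + ‖χ ξ • fhat w ξ‖ₑ ^ p)) ^ (1 / p)

/-- The (essential) supremum over `0 ≤ s ≤ t` of
`(∫ (|χ f̂₁(s)|^p + |χ f̂₂(s)|^p) / |ξ|^p dξ)^(1/p)`. -/
def hp (χ : E3 → ℝ) (p : ℝ) (f₁ f₂ : ℝ → L2) (t : ℝ) : ℝ≥0∞ :=
  essSup (fun s => (∫⁻ ξ, (‖χ ξ • fhat (f₁ s) ξ‖ₑ ^ p + ‖χ ξ • fhat (f₂ s) ξ‖ₑ ^ p)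
    / ‖ξ‖ₑ ^ p) ^ (1 / p)) (volume.restrict (Icc 0 t))

end MHD

end

/-!
The barrier `R₁(t)/|k|` is propagated by Duhamel's formula on the frequency side, written for the
pairing of `χ û` and `χ b̂` with symbols in the dual exponent.

The pressure is absent from the weak formulation, so only symbols orthogonal to the frequency are
available for testing. The solenoidal symbols `∑ γᵢⱼ(ξ) (ξⱼ eᵢ - ξᵢ eⱼ)` with Schwartz coefficients
(`IsSolenoidal`) synthesize fields with a Schwartz potential. Such fields are limits of compactly
supported solenoidal test fields, because a continuous functional on Schwartz space is determined by
its values on compactly supported functions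
(`SchwartzMap.eq_zero_of_forall_hasCompactSupport`). The transport terms are the divergences of
integrable stresses, so all spatial derivatives can be moved to the test field, and Parseval's
identity turns the weak formulation into an equation `∂ₜ ŵ = -κ|ξ|² ŵ + f̂ + N̂` in the sense of
distributions in time (`FrequencyEquation`).

Testing that equation with the symbol `e^{sκ|ξ|²} e^{-tκ|ξ|²} χ g` at time `s ≤ t` gives Duhamel's
formula at every left Lebesgue point `t`. To avoid symbols that depend on time in a nonpolynomial
way, `e^{sκ|ξ|²}` is replaced by its Taylor polynomials: the equations for the monomials telescope,
and the remainder tends to zero because the cutoff bounds the frequency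
(`FrequencyEquation.expPoly_eq`, `FrequencyEquation.tendsto_integral_source`).

On the cube `|k|/2 ≤ |ξ| ≤ 3|k|/2`, so the heat propagators decay at the rate
`c = min(ν, η)|k|²/4`, the nonlinear terms contribute at most `(‖u‖² + ‖b‖²) ∫ |ξ| |χ g|`, and the
force at most `(3|k|/2) h_p ‖g‖_q`. By Hölder's inequality and the hypothesis on `R₁` the source is
bounded by `c (R₁(t)/|k|) ‖g‖_q`, and `∫₀ᵗ c e^{-c(t-s)} ds = 1 - e^{-ct}`. Hence the pairing at
time `t` is bounded by `(e^{-ct} e_p(0) + (1 - e^{-ct}) R₁(t)/|k|) ‖g‖_q` (`pairing_le`).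

Bounded transverse fields on the cube are `L²` limits of solenoidal symbols, and `χ û(t)`,
`χ b̂(t)` are themselves transverse since `u(t), b(t) ∈ L²_σ`; testing with truncations of
`|F|^{p-2} F` therefore recovers `e_p(t)` from the pairings (`ep_le_of_pairing_le`). The weight
`e^{-ct}` does not depend on `p`, so the strict gap at time zero gives a strict gap at time `t` that
is uniform in `p`. Almost every time is a left Lebesgue point, and for weakly continuous
representatives every positive time is one.
-/

/-! ### Density of compactly supported functions in Schwartz space -/

namespace SchwartzMap

variable {E F : Type*} [NormedAddCommGroup E] [InnerProductSpace ℝ E] [FiniteDimensional ℝ E]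
  [NormedAddCommGroup F] [NormedSpace ℝ F]

/-- A function that vanishes near the origin and is constant near infinity has all its derivatives
dominated by a multiple of the norm. This makes the error of a rescaled cutoff small against
the decay of a Schwartz function. -/
theorem exists_cutoff_norm_iteratedFDeriv_sub_one_le :
    ∃ ρ : E → ℝ, ContDiff ℝ ∞ ρ ∧ HasCompactSupport ρ ∧
    ∀ i : ℕ, ∃ B : ℝ, 0 ≤ B ∧ ∀ y, ‖iteratedFDeriv ℝ i (fun z => ρ z - 1) y‖ ≤ B * ‖y‖ := by
  let f : ContDiffBump (0 : E) := ⟨1, 2, by norm_num, by norm_num⟩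
  have hf : ContDiff ℝ ∞ (f : E → ℝ) := f.contDiff
  refine ⟨f, hf, f.hasCompactSupport, fun i => ?_⟩
  have hcont : Continuous fun y => ‖iteratedFDeriv ℝ i f y‖ :=
    (hf.continuous_iteratedFDeriv (mod_cast le_top)).norm
  obtain ⟨x₀, hx₀⟩ := hcont.exists_forall_ge_of_hasCompactSupport
    ((f.hasCompactSupport.iteratedFDeriv i).norm)
  refine ⟨‖iteratedFDeriv ℝ i f x₀‖ + 1, by positivity, fun y => ?_⟩
  by_cases hy : ‖y‖ < 1
  · have hev : (fun z => f z - 1) =ᶠ[𝓝 y] fun _ => (0 : ℝ) := by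
      have : Metric.ball (0 : E) 1 ∈ 𝓝 y := Metric.isOpen_ball.mem_nhds (by simpa using hy)
      filter_upwards [this] with z hz
      have : f z = 1 := f.one_of_mem_closedBall (Metric.ball_subset_closedBall hz)
      simp [this]
    have := hev.iteratedFDeriv (𝕜 := ℝ) i
    rw [this.self_of_nhds]
    have h0 : iteratedFDeriv ℝ i (fun _ : E => (0 : ℝ)) y = 0 := by
      simp
    rw [h0, norm_zero]
    positivity
  · push Not at hy
    have hsub : iteratedFDeriv ℝ i (fun z => f z - 1) y
        = iteratedFDeriv ℝ i f y - iteratedFDeriv ℝ i (fun _ => (1 : ℝ)) y := by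
      have := iteratedFDeriv_sub_apply (𝕜 := ℝ) (i := i) (x := y) (f := (f : E → ℝ))
        (g := fun _ => (1 : ℝ)) (hf.contDiffAt.of_le (mod_cast le_top)) contDiffAt_const
      simpa [Pi.sub_def] using this
    have h1 : ‖iteratedFDeriv ℝ i (fun _ : E => (1 : ℝ)) y‖ ≤ 1 := by
      rcases Nat.eq_zero_or_pos i with rfl | hi
      · simp
      · rw [iteratedFDeriv_const_of_ne hi.ne']; simp
    rw [hsub]
    calc _ ≤ ‖iteratedFDeriv ℝ i f y‖ + ‖iteratedFDeriv ℝ i (fun _ : E => (1 : ℝ)) y‖ :=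
          norm_sub_le _ _
      _ ≤ ‖iteratedFDeriv ℝ i f x₀‖ + 1 := add_le_add (hx₀ y) h1
      _ ≤ _ := le_mul_of_one_le_right (by positivity) hy

/-- A continuous linear functional on Schwartz space that vanishes on compactly supported functions
vanishes identically. -/
theorem eq_zero_of_forall_hasCompactSupport (L : 𝓢(E, F) →L[ℝ] ℝ)
    (hL : ∀ f : 𝓢(E, F), HasCompactSupport f → L f = 0) (f : 𝓢(E, F)) : L f = 0 := by
  obtain ⟨ρ, hρ, hρc, hρB⟩ := exists_cutoff_norm_iteratedFDeriv_sub_one_le (E := E)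
  choose B hB0 hB using hρB
  let A : ℕ → E →L[ℝ] E := fun N => ((N : ℝ) + 1)⁻¹ • ContinuousLinearMap.id ℝ E
  have hAapp : ∀ N x, A N x = ((N : ℝ) + 1)⁻¹ • x := fun N x => by simp [A]
  have hpos : ∀ N : ℕ, (0 : ℝ) < (N : ℝ) + 1 := fun N => by positivity
  have hAnorm : ∀ N, ‖A N‖ ≤ 1 := fun N => by
    refine ContinuousLinearMap.opNorm_le_bound _ zero_le_one fun x => ?_
    rw [hAapp, norm_smul, norm_inv, Real.norm_of_nonneg (hpos N).le]
    gcongr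
    exact inv_le_one_of_one_le₀ (by linarith [N.cast_nonneg (α := ℝ)])
  let r : ℕ → E → ℝ := fun N => ρ ∘ A N
  have hr : ∀ N, ContDiff ℝ ∞ (r N) := fun N => hρ.comp (A N).contDiff
  have hrc : ∀ N, HasCompactSupport (r N) := fun N => by
    have hemb : IsClosedEmbedding (A N) := by
      have : (A N : E → E) = (Homeomorph.smulOfNeZero (((N : ℝ) + 1)⁻¹)
          (inv_ne_zero (hpos N).ne')) := by
        ext x; simp [hAapp]
      rw [this]
      exact (Homeomorph.smulOfNeZero _ _).isClosedEmbedding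
    exact hρc.comp_isClosedEmbedding hemb
  have hrt : ∀ N, (r N).HasTemperateGrowth := fun N => (hrc N).hasTemperateGrowth (hr N)
  have hlim : Tendsto (fun N => smulLeftCLM F (r N) f) atTop (𝓝 f) := by
    rw [(schwartz_withSeminorms ℝ E F).tendsto_nhds]
    rintro ⟨k, n⟩ ε hε
    let C : ℝ := ∑ i ∈ Finset.range (n + 1),
      (n.choose i : ℝ) * B i * SchwartzMap.seminorm ℝ (k + 1) (n - i) f
    have hC0 : 0 ≤ C := Finset.sum_nonneg fun i _ => by
      have := hB0 i
      positivity
    have hbd : ∀ N : ℕ, SchwartzMap.seminorm ℝ k n (smulLeftCLM F (r N) f - f)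
        ≤ ((N : ℝ) + 1)⁻¹ * C := by
      intro N
      refine seminorm_le_bound ℝ k n _ (by have := hpos N; positivity) fun x => ?_
      have hfun : ((smulLeftCLM F (r N) f - f : 𝓢(E, F)) : E → F)
          = fun y => ((fun z => ρ z - 1) ∘ A N) y • f y := by
        ext y
        simp [smulLeftCLM_apply_apply (hrt N), r, sub_smul]
      have hs : ContDiff ℝ ∞ ((fun z => ρ z - 1) ∘ A N) :=
        (hρ.sub contDiff_const).comp (A N).contDiff
      rw [hfun]
      have h1 := norm_iteratedFDeriv_smul_le (𝕜 := ℝ) (N := ∞) hs (f.smooth ⊤) x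
        (n := n) (mod_cast le_top)
      have h2 : ∀ i, ‖iteratedFDeriv ℝ i ((fun z => ρ z - 1) ∘ A N) x‖
          ≤ B i * (((N : ℝ) + 1)⁻¹ * ‖x‖) := by
        intro i
        rw [(A N).iteratedFDeriv_comp_right (hρ.sub contDiff_const) x
          (i := i) (mod_cast le_top)]
        refine (ContinuousMultilinearMap.norm_compContinuousLinearMap_le _ _).trans ?_
        calc _ ≤ ‖iteratedFDeriv ℝ i (fun z => ρ z - 1) (A N x)‖ * 1 := by
              gcongr
              exact Finset.prod_le_one (fun _ _ => norm_nonneg _) (fun _ _ => hAnorm N)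
          _ ≤ B i * ‖A N x‖ := by rw [mul_one]; exact hB i _
          _ = _ := by rw [hAapp, norm_smul, norm_inv, Real.norm_of_nonneg (hpos N).le]
      calc _ ≤ ‖x‖ ^ k * ∑ i ∈ Finset.range (n + 1), (n.choose i : ℝ)
              * ‖iteratedFDeriv ℝ i ((fun z => ρ z - 1) ∘ A N) x‖
              * ‖iteratedFDeriv ℝ (n - i) f x‖ := by gcongr
        _ ≤ ‖x‖ ^ k * ∑ i ∈ Finset.range (n + 1), (n.choose i : ℝ)
              * (B i * (((N : ℝ) + 1)⁻¹ * ‖x‖)) * ‖iteratedFDeriv ℝ (n - i) f x‖ := by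
            gcongr with i _
            exact h2 i
        _ = ((N : ℝ) + 1)⁻¹ * ∑ i ∈ Finset.range (n + 1), (n.choose i : ℝ) * B i
              * (‖x‖ ^ (k + 1) * ‖iteratedFDeriv ℝ (n - i) f x‖) := by
            rw [Finset.mul_sum, Finset.mul_sum]
            refine Finset.sum_congr rfl fun i _ => ?_
            ring
        _ ≤ _ := by
            refine mul_le_mul_of_nonneg_left (Finset.sum_le_sum fun i _ => ?_)
              (inv_nonneg.2 (hpos N).le)
            exact mul_le_mul_of_nonneg_left (le_seminorm ℝ (k + 1) (n - i) f x)
              (mul_nonneg (Nat.cast_nonneg _) (hB0 i))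
    have hto : Tendsto (fun N : ℕ => ((N : ℝ) + 1)⁻¹ * C) atTop (𝓝 0) := by
      have := (tendsto_one_div_add_atTop_nhds_zero_nat (𝕜 := ℝ)).mul_const C
      simpa using this
    filter_upwards [hto.eventually_lt_const hε] with N hN
    exact (hbd N).trans_lt hN
  have h0 : ∀ N, L (smulLeftCLM F (r N) f) = 0 := fun N => hL _ <| by
    have : ((smulLeftCLM F (r N) f : 𝓢(E, F)) : E → F) = fun y => r N y • f y := by
      ext y; simp [smulLeftCLM_apply_apply (hrt N)]
    rw [this]
    exact (hrc N).smul_right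
  have := (L.continuous.tendsto f).comp hlim
  refine tendsto_nhds_unique this ?_
  simp only [Function.comp_def, h0]
  exact tendsto_const_nhds

end SchwartzMap

/-! ### Functions of time that are locally bounded up to the initial time -/

namespace MHD

open scoped SchwartzMap LineDeriv Laplacian

noncomputable section

set_option maxSynthPendingDepth 3

/-- `F ∈ L^∞_loc([0, ∞); X)`. -/
def LocBdd {X : Type*} [NormedAddCommGroup X] (F : ℝ → X) : Prop :=
  ∀ T > 0, MemLp F ∞ (volume.restrict (Ioo 0 T))

namespace LocBdd

variable {X Y Z : Type*} [NormedAddCommGroup X] [NormedAddCommGroup Y]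
  [NormedAddCommGroup Z] {F : ℝ → X} {G : ℝ → Y}

theorem add {F F' : ℝ → X} (hF : LocBdd F) (hF' : LocBdd F') : LocBdd fun s => F s + F' s :=
  fun T hT => (hF T hT).add (hF' T hT)

theorem sub {F F' : ℝ → X} (hF : LocBdd F) (hF' : LocBdd F') : LocBdd fun s => F s - F' s :=
  fun T hT => (hF T hT).sub (hF' T hT)

theorem integrableOn (hF : LocBdd F) (T : ℝ) : IntegrableOn F (Ioo 0 T) := by
  rcases le_or_gt T 0 with h | h
  · rw [Ioo_eq_empty (by simpa using h)]
    exact integrableOn_empty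
  · exact (hF T h).integrable le_top

variable [NormedSpace ℝ X] [NormedSpace ℝ Y] [NormedSpace ℝ Z]

theorem bilin (B : X →L[ℝ] Y →L[ℝ] Z) (hF : LocBdd F) (hG : LocBdd G) :
    LocBdd fun s => B (F s) (G s) :=
  fun T hT => B.memLp_of_bilin ∞ (hF T hT) (hG T hT)

theorem clm (A : X →L[ℝ] Y) (hF : LocBdd F) : LocBdd fun s => A (F s) :=
  fun T hT => A.comp_memLp' (hF T hT)

theorem continuous_smul {c : ℝ → ℝ} (hc : Continuous c) (hF : LocBdd F) :
    LocBdd fun s => c s • F s := by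
  refine fun T hT => (hF T hT).smul (p := ∞) (q := ∞) (r := ∞) ?_
  obtain ⟨C, hC⟩ := (isCompact_Icc (a := (0 : ℝ)) (b := T)).exists_bound_of_continuousOn
    hc.continuousOn
  exact memLp_top_of_bound hc.aestronglyMeasurable C
    ((ae_restrict_iff' measurableSet_Ioo).2 (.of_forall fun s hs => hC s ⟨hs.1.le, hs.2.le⟩))

/-- Multiplying by a compactly supported function of time gives a function integrable on all
of `(0, ∞)`. -/
theorem integrableOn_smul {c : ℝ → ℝ} (hc : Continuous c) (hcc : HasCompactSupport c)
    (hF : LocBdd F) : IntegrableOn (fun s => c s • F s) (Ioi 0) := by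
  obtain ⟨M, hM⟩ := hcc.isCompact.bddAbove
  have h1 := (hF.continuous_smul hc).integrableOn (M + 1)
  refine h1.of_forall_sdiff_eq_zero measurableSet_Ioi fun s hs => ?_
  have : s ∉ tsupport c := fun h => hs.2 ⟨hs.1, by linarith [hM h]⟩
  simp [image_eq_zero_of_notMem_tsupport this]

end LocBdd

/-! ### The pairings in the weak formulation -/

/-- The dual of the space of `3 × 3` matrices. -/
abbrev Dual33 := StrongDual ℝ (E3 →L[ℝ] E3)

/-- The bilinear map `(a, w) ↦ (M ↦ ⟪w, M a⟫)`, that is, `a ⊗ w` acting on matrices. -/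
def tensorB : E3 →L[ℝ] E3 →L[ℝ] Dual33 :=
  (ContinuousLinearMap.compL ℝ (E3 →L[ℝ] E3) E3 ℝ).flip.bilinearComp
    (ContinuousLinearMap.apply ℝ E3) (innerSL ℝ)

theorem tensorB_apply (a w : E3) (M : E3 →L[ℝ] E3) : tensorB a w M = inner ℝ w (M a) := rfl

/-- Integrable matrix fields, acting on bounded matrix fields. The definition is not reducible,
which keeps instance search from unfolding the space of values. -/
def Stress : Type := Lp Dual33 1 (volume : Measure E3)

instance : NormedAddCommGroup Stress :=
  inferInstanceAs (NormedAddCommGroup (Lp Dual33 1 (volume : Measure E3)))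

instance : NormedSpace ℝ Stress :=
  inferInstanceAs (NormedSpace ℝ (Lp Dual33 1 (volume : Measure E3)))

instance : CompleteSpace Stress :=
  inferInstanceAs (CompleteSpace (Lp Dual33 1 (volume : Measure E3)))

/-- The tensor product `a ⊗ w` of two square integrable fields, an integrable field with values in
the dual of the space of matrices. -/
def tensor : L2 →L[ℝ] L2 →L[ℝ] Stress :=
  tensorB.holderL volume 2 2 1

/-- The pairing `∫ Y : Dφ` of an integrable field with the gradient of a Schwartz field. -/
def gradPair (Y : Stress) : 𝓢(E3, E3) →L[ℝ] ℝ :=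
  ((ContinuousLinearMap.id ℝ Dual33).lpPairing volume 1 ∞ Y).comp
    ((SchwartzMap.toLpCLM ℝ (E3 →L[ℝ] E3) ∞ volume).comp (SchwartzMap.fderivCLM ℝ E3 E3))

theorem gradPair_eq (Y : Lp Dual33 1 (volume : Measure E3)) (φ : 𝓢(E3, E3)) :
    gradPair (Y : Stress) φ = ∫ x, Y x (fderiv ℝ φ x) := by
  refine (ContinuousLinearMap.lpPairing_eq_integral (p := 1) (q := ∞)
    (ContinuousLinearMap.id ℝ Dual33) Y ((SchwartzMap.fderivCLM ℝ E3 E3 φ).toLp ∞)).trans ?_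
  refine integral_congr_ae ?_
  filter_upwards [SchwartzMap.coeFn_toLp (SchwartzMap.fderivCLM ℝ E3 E3 φ) ∞ volume] with x hx
  simp [hx]

/-- For a fixed field `φ`, the map `Y ↦ ∫ Y : Dφ`. -/
def gradPairFlip (φ : 𝓢(E3, E3)) : Stress →L[ℝ] ℝ :=
  ((ContinuousLinearMap.id ℝ Dual33).lpPairing volume 1 ∞).flip
    ((SchwartzMap.toLpCLM ℝ (E3 →L[ℝ] E3) ∞ volume) (SchwartzMap.fderivCLM ℝ E3 E3 φ))

theorem gradPairFlip_apply (φ : 𝓢(E3, E3)) (Y : Stress) :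
    gradPairFlip φ Y = gradPair Y φ := rfl

theorem gradPair_tensor (a w : L2) (φ : 𝓢(E3, E3)) :
    gradPair (tensor a w) φ = ∫ x, inner ℝ (w x) (fderiv ℝ φ x (a x)) := by
  refine (gradPair_eq (tensorB.holder 1 a w) φ).trans (integral_congr_ae ?_)
  filter_upwards [tensorB.coeFn_holder (r := 1) a w] with x hx
  rw [hx, tensorB_apply]

/-- The bilinear map `(a, g) ↦ (z ↦ a_j ⟪g, z⟫)`. -/
def advectB (j : Fin 3) : E3 →L[ℝ] E3 →L[ℝ] (E3 →L[ℝ] ℝ) :=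
  (ContinuousLinearMap.lsmul ℝ ℝ).flip.comp (innerSL ℝ) |>.flip.comp
    (EuclideanSpace.proj j : E3 →L[ℝ] ℝ)

theorem advectB_apply (j : Fin 3) (a g z : E3) : advectB j a g z = a j * inner ℝ g z := rfl

/-- The pairing of the transport term `(a · ∇) w`, where `G` is the gradient of `w`, with a Schwartz
field. -/
def advectPair (φ : 𝓢(E3, E3)) (a : L2) (G : Fin 3 → L2) : ℝ :=
  ∑ j, (ContinuousLinearMap.id ℝ (E3 →L[ℝ] ℝ)).lpPairing volume 1 ∞
    ((advectB j).holderL volume 2 2 1 a (G j)) (φ.toLp ∞)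

theorem integrable_advectB (j : Fin 3) (φ : 𝓢(E3, E3)) (a g : L2) :
    Integrable fun x => advectB j (a x) (g x) (φ x) :=
  ContinuousLinearMap.integrable_of_bilin_of_bdd_right
    (ContinuousLinearMap.id ℝ (E3 →L[ℝ] ℝ)) (SchwartzMap.seminorm ℝ 0 0 φ)
    (memLp_one_iff_integrable.1 ((advectB j).memLp_of_bilin 1 (Lp.memLp a) (Lp.memLp g)))
    φ.continuous.aestronglyMeasurable (.of_forall fun x => φ.norm_le_seminorm ℝ x)

theorem advect_inner (a : L2) (G : Fin 3 → L2) (x z : E3) :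
    inner ℝ (advect a G x) z = ∑ j, advectB j (a x) (G j x) z := by
  simp [advect, advectB_apply, sum_inner, real_inner_smul_left]

theorem integrable_advect (φ : 𝓢(E3, E3)) (a : L2) (G : Fin 3 → L2) :
    Integrable fun x => inner ℝ (advect a G x) (φ x) := by
  simp_rw [advect_inner]
  exact integrable_finsetSum _ fun j _ => integrable_advectB j φ a (G j)

theorem advectPair_eq (φ : 𝓢(E3, E3)) (a : L2) (G : Fin 3 → L2) :
    advectPair φ a G = ∫ x, inner ℝ (advect a G x) (φ x) := by
  simp_rw [advect_inner]
  rw [integral_finsetSum _ fun j _ => integrable_advectB j φ a (G j), advectPair]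
  refine Finset.sum_congr rfl fun j _ => ?_
  rw [ContinuousLinearMap.lpPairing_eq_integral]
  refine integral_congr_ae ?_
  have h : ((advectB j).holderL volume 2 2 1 a (G j) : E3 → _)
      =ᵐ[volume] fun x => advectB j (a x) (G j x) := (advectB j).coeFn_holder a (G j)
  filter_upwards [h, φ.coeFn_toLp ∞ volume] with x hx hx'
  rw [hx, hx']
  rfl

theorem continuous_advectPair {X : Type*} [TopologicalSpace X] (φ : 𝓢(E3, E3)) {f : X → L2}
    {g : X → Fin 3 → L2} (hf : Continuous f) (hg : Continuous g) :
    Continuous fun x => advectPair φ (f x) (g x) := by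
  unfold advectPair
  fun_prop

/-- The pairing `v ↦ ∫ v · φ` of square integrable fields with a fixed Schwartz field. -/
def fieldPair (φ : 𝓢(E3, E3)) : L2 →L[ℝ] ℝ := innerSL ℝ (φ.toLp 2)

/-- The pairing `φ ↦ ∫ v · φ` of Schwartz fields with a fixed square integrable field. -/
def fieldPairFlip (v : L2) : 𝓢(E3, E3) →L[ℝ] ℝ :=
  (innerSL ℝ v).comp (SchwartzMap.toLpCLM ℝ E3 2 volume)

theorem fieldPair_def (φ : 𝓢(E3, E3)) (v : L2) :
    fieldPair φ v = inner ℝ (φ.toLp 2) v := rfl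

theorem fieldPairFlip_apply (φ : 𝓢(E3, E3)) (v : L2) : fieldPairFlip v φ = fieldPair φ v :=
  show (inner ℝ v (φ.toLp 2) : ℝ) = inner ℝ (φ.toLp 2) v from real_inner_comm _ _

theorem fieldPair_eq (φ : 𝓢(E3, E3)) (v : L2) :
    fieldPair φ v = ∫ x, inner ℝ (v x) (φ x) := by
  rw [fieldPair_def, L2.inner_def]
  refine integral_congr_ae ?_
  filter_upwards [φ.coeFn_toLp 2 volume] with x hx
  rw [hx, real_inner_comm]

-- Unification must not unfold the pairings; from here on only the lemmas above describe them.
attribute [irreducible] tensor gradPair gradPairFlip advectPair fieldPair fieldPairFlip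

/-! ### Integration by parts in the energy class -/

/-- A test field as a Schwartz function. -/
def IsTestField.toSchwartz {φ : E3 → E3} (h : IsTestField φ) : 𝓢(E3, E3) :=
  h.2.1.toSchwartzMap h.1

@[simp]
theorem IsTestField.toSchwartz_coe {φ : E3 → E3} (h : IsTestField φ) :
    (h.toSchwartz : E3 → E3) = φ := rfl

theorem toLp_eq_of_ae {v : L2} {φ : 𝓢(E3, E3)} (h : v =ᵐ[volume] φ) : v = φ.toLp 2 :=
  Lp.ext (h.trans (φ.coeFn_toLp 2 volume).symm)

theorem integral_advect_test (a w φ : 𝓢(E3, E3)) (ha : ∀ x, divergence a x = 0) :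
    ∫ x, inner ℝ (∑ j, a x j • fderiv ℝ w x (e j)) (φ x)
      = -∫ x, inner ℝ (w x) (fderiv ℝ φ x (a x)) := by
  let aw : Fin 3 → 𝓢(E3, E3) := fun j =>
    SchwartzMap.pairing ((ContinuousLinearMap.lsmul ℝ ℝ).comp
      (EuclideanSpace.proj j : E3 →L[ℝ] ℝ)) a w
  have haw : ∀ j x, aw j x = a x j • w x := fun j x => rfl
  have hd : ∀ j x, ∂_{e j} (aw j) x
      = (fderiv ℝ a x (e j)) j • w x + a x j • fderiv ℝ w x (e j) := by
    intro j x
    rw [SchwartzMap.lineDerivOp_apply_eq_fderiv]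
    have h1 : HasFDerivAt (fun y => a y j)
        ((EuclideanSpace.proj j : E3 →L[ℝ] ℝ).comp (fderiv ℝ a x)) x :=
      (EuclideanSpace.proj j : E3 →L[ℝ] ℝ).hasFDerivAt.comp x a.differentiableAt.hasFDerivAt
    have h2 := h1.smul (w.differentiableAt (x := x)).hasFDerivAt
    have h3 : fderiv ℝ (aw j) x = _ := h2.fderiv
    rw [h3]
    simp [add_comm]
  have hsum : ∀ x, inner ℝ (∑ j, a x j • fderiv ℝ w x (e j)) (φ x)
      = ∑ j, inner ℝ (∂_{e j} (aw j) x) (φ x) := by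
    intro x
    rw [← sum_inner]
    simp_rw [hd, Finset.sum_add_distrib, ← Finset.sum_smul]
    have : ∑ j, (fderiv ℝ a x (e j)) j = 0 := ha x
    rw [this, zero_smul, zero_add]
  have hsum' : ∀ x, inner ℝ (w x) (fderiv ℝ φ x (a x))
      = ∑ j, inner ℝ (aw j x) (∂_{e j} φ x) := by
    intro x
    have hax : a x = ∑ j, a x j • e j := by
      ext i
      simp [e, Pi.single_apply]
    conv_lhs => rw [hax]
    simp [haw, inner_sum, real_inner_smul_left, real_inner_smul_right,
      SchwartzMap.lineDerivOp_apply_eq_fderiv]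
  have hint : ∀ f g : 𝓢(E3, E3), Integrable fun x => inner ℝ (f x) (g x) := fun f g =>
    (SchwartzMap.pairing (innerSL ℝ : E3 →L[ℝ] E3 →L[ℝ] ℝ) f g).integrable
  simp_rw [hsum, hsum']
  rw [integral_finsetSum _ fun j _ => hint _ _, integral_finsetSum _ fun j _ => hint _ _,
    ← Finset.sum_neg_distrib]
  refine Finset.sum_congr rfl fun j _ => ?_
  have : ∫ x, inner ℝ (aw j x) (∂_{e j} φ x) = -∫ x, inner ℝ (∂_{e j} (aw j) x) (φ x) :=
    SchwartzMap.integral_bilinear_lineDerivOp_right_eq_neg_left (aw j) φ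
      (innerSL ℝ : E3 →L[ℝ] E3 →L[ℝ] ℝ) (e j) (μ := volume)
  rw [this, neg_neg]

/-- For a solenoidal `a`, the transport term `(a · ∇) w` is the divergence of `a ⊗ w`. -/
theorem advectPair_eq_neg_gradPair (φ : 𝓢(E3, E3)) {a w : L2} {G : Fin 3 → L2}
    (ha : a ∈ L2sigma) (hw : IsH1sigmaWithGradient w G) :
    advectPair φ a G = -gradPair (tensor a w) φ := by
  -- Both sides are continuous in `a` and in `(w, G)`, so it suffices to treat test fields.
  have hcontL : ∀ (α : L2), Continuous fun q : L2 × (Fin 3 → L2) => advectPair φ α q.2 :=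
    fun α => continuous_advectPair φ continuous_const continuous_snd
  have hcontR : ∀ (α : L2), Continuous fun q : L2 × (Fin 3 → L2) =>
      -gradPairFlip φ (tensor α q.1) := fun α =>
    ((gradPairFlip φ).continuous.comp ((tensor α).continuous.comp continuous_fst)).neg
  have hcontL' : Continuous fun α : L2 => advectPair φ α G :=
    continuous_advectPair φ continuous_id continuous_const
  have hcontR' : Continuous fun α : L2 => -gradPairFlip φ (tensor α w) :=
    ((gradPairFlip φ).continuous.comp (tensor.flip w).continuous).neg
  have hstep : ∀ (α : L2) (α' : E3 → E3), IsTestField α' → α =ᵐ[volume] α' →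
      ∀ q ∈ closure {q : L2 × (Fin 3 → L2) | ∃ φ, IsTestField φ ∧ q.1 =ᵐ[volume] φ ∧
        ∀ i, q.2 i =ᵐ[volume] fun x => fderiv ℝ φ x (e i)},
      advectPair φ α q.2 = -gradPairFlip φ (tensor α q.1) := by
    intro α α' hα hαα'
    refine closure_minimal ?_ (isClosed_eq (hcontL α) (hcontR α))
    rintro ⟨w', G'⟩ ⟨β, hβ, hwβ, hGβ⟩
    simp only at hwβ hGβ
    show advectPair φ α G' = -gradPairFlip φ (tensor α w')
    rw [gradPairFlip_apply, advectPair_eq, gradPair_tensor]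
    have h := integral_advect_test hα.toSchwartz hβ.toSchwartz φ hα.2.2
    have hG : ∀ᵐ x, ∀ i, G' i x = fderiv ℝ β x (e i) := ae_all_iff.2 hGβ
    convert h using 1
    · refine integral_congr_ae ?_
      filter_upwards [hαα', hG] with x h1 h2
      simp [advect, h1, h2]
    · congr 1
      refine integral_congr_ae ?_
      filter_upwards [hαα', hwβ] with x h1 h2
      simp [h1, h2]
  have hall : ∀ α ∈ closure {v : L2 | ∃ φ, IsTestField φ ∧ v =ᵐ[volume] φ},
      advectPair φ α G = -gradPairFlip φ (tensor α w) := by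
    refine closure_minimal ?_ (isClosed_eq hcontL' hcontR')
    rintro α ⟨α', hα, hαα'⟩
    exact hstep α α' hα hαα' (w, G) hw
  rw [← gradPairFlip_apply]
  exact hall a ha

theorem fieldPair_toLp (f g : 𝓢(E3, E3)) :
    fieldPair g (f.toLp 2 volume) = ∫ x, inner ℝ (f x) (g x) := by
  rw [fieldPair_eq]
  refine integral_congr_ae ?_
  filter_upwards [f.coeFn_toLp 2 volume] with x hx
  rw [hx]

theorem sum_fieldPair_grad (φ : 𝓢(E3, E3)) {w : L2} {G : Fin 3 → L2}
    (hw : IsH1sigmaWithGradient w G) :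
    ∑ i, fieldPair (∂_{e i} φ) (G i) = -fieldPair (Δ φ) w := by
  have hcontL : Continuous fun q : L2 × (Fin 3 → L2) =>
      ∑ i, fieldPair (∂_{e i} φ) (q.2 i) :=
    continuous_finsetSum _ fun i _ =>
      (fieldPair (∂_{e i} φ)).continuous.comp ((continuous_apply i).comp continuous_snd)
  have hcontR : Continuous fun q : L2 × (Fin 3 → L2) => -fieldPair (Δ φ) q.1 :=
    ((fieldPair (Δ φ)).continuous.comp continuous_fst).neg
  obtain ⟨q, hq, hlim⟩ := mem_closure_iff_seq_limit.1 hw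
  have heq : ∀ n, ∑ i, fieldPair (∂_{e i} φ) ((q n).2 i) = -fieldPair (Δ φ) (q n).1 := by
    intro n
    obtain ⟨β, hβ, hwβ, hGβ⟩ := hq n
    have h1 : (q n).1 = hβ.toSchwartz.toLp 2 := toLp_eq_of_ae hwβ
    have h2 : ∀ i, (q n).2 i = (∂_{e i} hβ.toSchwartz).toLp 2 := fun i => by
      refine toLp_eq_of_ae ((hGβ i).trans (.of_forall fun x => ?_))
      rw [SchwartzMap.lineDerivOp_apply_eq_fderiv]
      rfl
    have hΔ : Δ φ = ∑ i, ∂_{e i} (∂_{e i} φ) := by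
      rw [SchwartzMap.laplacian_eq_sum (EuclideanSpace.basisFun (Fin 3) ℝ)]
      simp [e, EuclideanSpace.basisFun_apply]
    rw [← fieldPairFlip_apply, hΔ, map_sum, ← Finset.sum_neg_distrib]
    refine Finset.sum_congr rfl fun i _ => ?_
    rw [fieldPairFlip_apply, h1, h2, fieldPair_toLp, fieldPair_toLp]
    have : ∫ x, inner ℝ (hβ.toSchwartz x) (∂_{e i} (∂_{e i} φ) x)
        = -∫ x, inner ℝ (∂_{e i} hβ.toSchwartz x) (∂_{e i} φ x) :=
      SchwartzMap.integral_bilinear_lineDerivOp_right_eq_neg_left hβ.toSchwartz (∂_{e i} φ)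
        (innerSL ℝ : E3 →L[ℝ] E3 →L[ℝ] ℝ) (e i) (μ := volume)
    rw [this, neg_neg]
  have hL := (hcontL.tendsto (w, G)).comp hlim
  have hR := (hcontR.tendsto (w, G)).comp hlim
  have hLR := hR.congr fun n => (heq n).symm
  exact tendsto_nhds_unique hL hLR

/-! ### The weak formulation tested with fields that have a potential -/

theorem fderiv_postcompCLM {F G : Type*} [NormedAddCommGroup F] [NormedSpace ℝ F]
    [NormedAddCommGroup G] [NormedSpace ℝ G] (A : F →L[ℝ] G) (ψ : 𝓢(E3, F)) (x m : E3) :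
    fderiv ℝ (ψ.postcompCLM A) x m = A (fderiv ℝ ψ x m) := by
  have h : HasFDerivAt (ψ.postcompCLM A) (A.comp (fderiv ℝ ψ x)) x :=
    A.hasFDerivAt.comp x ψ.differentiableAt.hasFDerivAt
  rw [h.fderiv]
  rfl

theorem lineDerivOp_comm_apply {F : Type*} [NormedAddCommGroup F] [NormedSpace ℝ F]
    (ψ : 𝓢(E3, F)) (a b x : E3) : ∂_{a} (∂_{b} ψ) x = ∂_{b} (∂_{a} ψ) x := by
  have hd : ∀ a b : E3, ∂_{a} (∂_{b} ψ) x
      = fderiv ℝ (SchwartzMap.fderivCLM ℝ E3 F ψ) x a b := by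
    intro a b
    rw [SchwartzMap.lineDerivOp_apply_eq_fderiv]
    have : HasFDerivAt (fun y => ∂_{b} ψ y)
        ((ContinuousLinearMap.apply ℝ F b).comp
          (fderiv ℝ (SchwartzMap.fderivCLM ℝ E3 F ψ) x)) x := by
      have := (ContinuousLinearMap.apply ℝ F b).hasFDerivAt.comp x
        (SchwartzMap.fderivCLM ℝ E3 F ψ).differentiableAt.hasFDerivAt
      refine this.congr_of_eventuallyEq (.of_forall fun y => ?_)
      simp [SchwartzMap.lineDerivOp_apply_eq_fderiv]
    rw [this.fderiv]
    rfl
  rw [hd, hd]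
  exact second_derivative_symmetric (f := ψ) (f' := SchwartzMap.fderivCLM ℝ E3 F ψ)
    (fun y => ψ.hasFDerivAt y)
    (SchwartzMap.fderivCLM ℝ E3 F ψ).differentiableAt.hasFDerivAt a b

/-- The solenoidal field `(∂ⱼψ) eᵢ - (∂ᵢψ) eⱼ` with potential `ψ`. -/
def potField (i j : Fin 3) : 𝓢(E3, ℝ) →L[ℝ] 𝓢(E3, E3) :=
  (SchwartzMap.postcompCLM (ContinuousLinearMap.toSpanSingleton ℝ (e i))).comp
      (LineDeriv.lineDerivOpCLM ℝ 𝓢(E3, ℝ) (e j))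
    - (SchwartzMap.postcompCLM (ContinuousLinearMap.toSpanSingleton ℝ (e j))).comp
      (LineDeriv.lineDerivOpCLM ℝ 𝓢(E3, ℝ) (e i))

theorem potField_apply (i j : Fin 3) (ψ : 𝓢(E3, ℝ)) (x : E3) :
    potField i j ψ x = ∂_{e j} ψ x • e i - ∂_{e i} ψ x • e j := rfl

theorem isTestField_potField (i j : Fin 3) {ψ : 𝓢(E3, ℝ)} (hψ : HasCompactSupport ψ) :
    IsTestField (potField i j ψ) := by
  refine ⟨(potField i j ψ).smooth ⊤, ?_, fun x => ?_⟩
  · have h : ∀ m : E3, HasCompactSupport (∂_{m} ψ : 𝓢(E3, ℝ)) := fun m =>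
      hψ.of_isClosed_subset (isClosed_tsupport _) (SchwartzMap.tsupport_lineDerivOp_subset m ψ)
    have : (potField i j ψ : E3 → E3)
        = (fun x => ∂_{e j} ψ x • e i) - fun x => ∂_{e i} ψ x • e j := rfl
    rw [this]
    exact ((h (e j)).smul_right (f' := fun _ => e i)).sub
      ((h (e i)).smul_right (f' := fun _ => e j))
  · have hf : ∀ m, fderiv ℝ (potField i j ψ) x m
        = ∂_{m} (∂_{e j} ψ) x • e i - ∂_{m} (∂_{e i} ψ) x • e j := by
      intro m
      have : fderiv ℝ (potField i j ψ) x
          = fderiv ℝ ((∂_{e j} ψ).postcompCLM (ContinuousLinearMap.toSpanSingleton ℝ (e i))) x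
          - fderiv ℝ ((∂_{e i} ψ).postcompCLM (ContinuousLinearMap.toSpanSingleton ℝ (e j))) x :=
        fderiv_sub (SchwartzMap.differentiableAt _) (SchwartzMap.differentiableAt _)
      rw [this, sub_apply, fderiv_postcompCLM, fderiv_postcompCLM]
      simp [SchwartzMap.lineDerivOp_apply_eq_fderiv]
    simp only [divergence, hf]
    have : ∀ l, (∂_{e l} (∂_{e j} ψ) x • e i - ∂_{e l} (∂_{e i} ψ) x • e j) l
        = (if l = i then ∂_{e l} (∂_{e j} ψ) x else 0)
          - (if l = j then ∂_{e l} (∂_{e i} ψ) x else 0) := by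
      intro l
      simp [e]
    simp only [this, Finset.sum_sub_distrib, Finset.sum_ite_eq', Finset.mem_univ, if_true]
    rw [lineDerivOp_comm_apply, sub_self]

set_option maxHeartbeats 800000 in
/-- Testing the weak formulation with `η(t) φ(x)`: all spatial derivatives are moved to `φ`. -/
theorem weakEquation_test {κ : ℝ} {w₀ : L2} {w f a₁ w₁ a₂ w₂ : ℝ → L2}
    {G G₁ G₂ : ℝ → Fin 3 → L2}
    (hweak : WeakEquation κ w₀ w G
      (fun t x => advect (a₁ t) (G₁ t) x - advect (a₂ t) (G₂ t) x) f)
    (hw : ∀ᵐ t ∂volume.restrict (Ioi (0 : ℝ)), IsH1sigmaWithGradient (w t) (G t))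
    (ha₁ : ∀ᵐ t ∂volume.restrict (Ioi (0 : ℝ)), a₁ t ∈ L2sigma)
    (hw₁ : ∀ᵐ t ∂volume.restrict (Ioi (0 : ℝ)), IsH1sigmaWithGradient (w₁ t) (G₁ t))
    (ha₂ : ∀ᵐ t ∂volume.restrict (Ioi (0 : ℝ)), a₂ t ∈ L2sigma)
    (hw₂ : ∀ᵐ t ∂volume.restrict (Ioi (0 : ℝ)), IsH1sigmaWithGradient (w₂ t) (G₂ t))
    {η : ℝ → ℝ} (hη : ContDiff ℝ ∞ η) (hηc : HasCompactSupport η)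
    {φ : 𝓢(E3, E3)} (hφ : IsTestField φ) :
    ∫ t in Ioi (0 : ℝ), (-(deriv η t * fieldPair φ (w t))
        - κ * (η t * fieldPair (Δ φ) (w t))
        - η t * gradPairFlip φ (tensor (a₁ t) (w₁ t) - tensor (a₂ t) (w₂ t)))
      = η 0 * fieldPair φ w₀ + ∫ t in Ioi (0 : ℝ), η t * fieldPair φ (f t) := by
  have hΦ : IsSpaceTimeTestField fun t x => η t • φ x := by
    refine ⟨(hη.comp contDiff_fst).smul (hφ.1.comp contDiff_snd), ?_, fun t x => ?_⟩
    · refine HasCompactSupport.intro (hηc.isCompact.prod hφ.2.1.isCompact) fun z hz => ?_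
      rw [mem_prod, not_and_or] at hz
      rcases hz with h | h
      · simp [image_eq_zero_of_notMem_tsupport h]
      · simp [image_eq_zero_of_notMem_tsupport h]
    · have : fderiv ℝ (fun x => η t • φ x) x = η t • fderiv ℝ φ x :=
        fderiv_fun_const_smul φ.differentiableAt _
      have h0 := hφ.2.2 x
      simp only [divergence] at h0 ⊢
      simp [this, ← Finset.mul_sum, h0]
  have key := hweak _ hΦ
  have hmul : ∀ (v : L2) (c : ℝ) (ψ : 𝓢(E3, E3)),
      ∫ x, inner ℝ (v x) (c • ψ x) = c * fieldPair ψ v := by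
    intro v c ψ
    simp_rw [real_inner_smul_right]
    rw [integral_const_mul, fieldPair_eq]
  have hderiv : ∀ t x, deriv (fun s => η s • φ x) t = deriv η t • φ x := fun t x =>
    deriv_smul_const (hη.differentiable (by simp) t) _
  have hfderiv : ∀ t x i, fderiv ℝ (fun x => η t • φ x) x (e i) = η t • (∂_{e i} φ) x := by
    intro t x i
    have : fderiv ℝ (fun x => η t • φ x) x = η t • fderiv ℝ φ x :=
      fderiv_fun_const_smul φ.differentiableAt _
    rw [this, SchwartzMap.lineDerivOp_apply_eq_fderiv]
    rfl
  simp only [hderiv, hfderiv, hmul] at key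
  rw [← key]
  refine integral_congr_ae ?_
  filter_upwards [hw, ha₁, hw₁, ha₂, hw₂] with t h0 h1 h2 h3 h4
  have e1 : ∑ i, η t * fieldPair (∂_{e i} φ) (G t i) = -(η t * fieldPair (Δ φ) (w t)) := by
    rw [← Finset.mul_sum, sum_fieldPair_grad φ h0]
    ring
  have e2 : ∫ x, inner ℝ (advect (a₁ t) (G₁ t) x - advect (a₂ t) (G₂ t) x) (η t • φ x)
      = -(η t * gradPairFlip φ (tensor (a₁ t) (w₁ t) - tensor (a₂ t) (w₂ t))) := by
    simp_rw [real_inner_smul_right, inner_sub_left]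
    rw [integral_const_mul, integral_sub (integrable_advect φ _ _) (integrable_advect φ _ _),
      ← advectPair_eq, ← advectPair_eq, advectPair_eq_neg_gradPair φ h1 h2,
      advectPair_eq_neg_gradPair φ h3 h4, (gradPairFlip φ).map_sub, gradPairFlip_apply,
      gradPairFlip_apply]
    ring
  rw [e1, e2]
  ring

/-- A continuous functional commutes with the integral in time against a test function. -/
theorem LocBdd.integral_mul_clm {X : Type*} [NormedAddCommGroup X] [NormedSpace ℝ X]
    [CompleteSpace X] {F : ℝ → X} (hF : LocBdd F) {η : ℝ → ℝ} (hη : Continuous η)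
    (hηc : HasCompactSupport η) (A : X →L[ℝ] ℝ) :
    ∫ t in Ioi (0 : ℝ), η t * A (F t) = A (∫ t in Ioi (0 : ℝ), η t • F t) := by
  rw [← ContinuousLinearMap.integral_comp_comm _ (hF.integrableOn_smul hη hηc)]
  exact integral_congr_ae (.of_forall fun t => (A.map_smul (η t) (F t)).symm)

/-- The weak formulation, in distributional form in time, for a field that is a sum of fields
with a Schwartz potential. -/
theorem weakEquation_potField {κ : ℝ} {w₀ : L2} {w f a₁ w₁ a₂ w₂ : ℝ → L2}
    {G G₁ G₂ : ℝ → Fin 3 → L2}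
    (hweak : WeakEquation κ w₀ w G
      (fun t x => advect (a₁ t) (G₁ t) x - advect (a₂ t) (G₂ t) x) f)
    (hw : ∀ᵐ t ∂volume.restrict (Ioi (0 : ℝ)), IsH1sigmaWithGradient (w t) (G t))
    (ha₁ : ∀ᵐ t ∂volume.restrict (Ioi (0 : ℝ)), a₁ t ∈ L2sigma)
    (hw₁ : ∀ᵐ t ∂volume.restrict (Ioi (0 : ℝ)), IsH1sigmaWithGradient (w₁ t) (G₁ t))
    (ha₂ : ∀ᵐ t ∂volume.restrict (Ioi (0 : ℝ)), a₂ t ∈ L2sigma)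
    (hw₂ : ∀ᵐ t ∂volume.restrict (Ioi (0 : ℝ)), IsH1sigmaWithGradient (w₂ t) (G₂ t))
    (bw : LocBdd w) (bf : LocBdd f)
    (bN : LocBdd fun t => tensor (a₁ t) (w₁ t) - tensor (a₂ t) (w₂ t))
    {η : ℝ → ℝ} (hη : ContDiff ℝ ∞ η) (hηc : HasCompactSupport η)
    (ψ : Fin 3 → Fin 3 → 𝓢(E3, ℝ)) {φ : 𝓢(E3, E3)}
    (hφ : φ = ∑ i, ∑ j, potField i j (ψ i j)) :
    -∫ t in Ioi (0 : ℝ), deriv η t * fieldPair φ (w t)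
      = η 0 * fieldPair φ w₀ + ∫ t in Ioi (0 : ℝ), η t *
        (κ * fieldPair (Δ φ) (w t) + fieldPair φ (f t)
          + gradPairFlip φ (tensor (a₁ t) (w₁ t) - tensor (a₂ t) (w₂ t))) := by
  have hη' : Continuous (deriv η) := hη.continuous_deriv (by simp)
  have hηc' : HasCompactSupport (deriv η) := hηc.deriv
  set N := fun t => tensor (a₁ t) (w₁ t) - tensor (a₂ t) (w₂ t) with hN
  -- The defect in the weak formulation, as a distribution.
  let L : 𝓢(E3, E3) →L[ℝ] ℝ := fieldPairFlip (∫ t in Ioi (0 : ℝ), deriv η t • w t)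
    + η 0 • fieldPairFlip w₀ + fieldPairFlip (∫ t in Ioi (0 : ℝ), η t • f t)
    + κ • (fieldPairFlip (∫ t in Ioi (0 : ℝ), η t • w t)).comp
      (LineDeriv.laplacianCLM ℝ E3 𝓢(E3, E3))
    + gradPair (∫ t in Ioi (0 : ℝ), η t • N t)
  have hLeq : ∀ χ : 𝓢(E3, E3), L χ
      = (∫ t in Ioi (0 : ℝ), deriv η t * fieldPair χ (w t))
        + η 0 * fieldPair χ w₀ + (∫ t in Ioi (0 : ℝ), η t * fieldPair χ (f t))
        + κ * (∫ t in Ioi (0 : ℝ), η t * fieldPair (Δ χ) (w t))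
        + ∫ t in Ioi (0 : ℝ), η t * gradPairFlip χ (N t) := by
    intro χ
    rw [bw.integral_mul_clm hη' hηc' (fieldPair χ), bf.integral_mul_clm hη.continuous hηc
      (fieldPair χ), bw.integral_mul_clm hη.continuous hηc (fieldPair (Δ χ)),
      bN.integral_mul_clm hη.continuous hηc (gradPairFlip χ), gradPairFlip_apply]
    simp only [← fieldPairFlip_apply]
    rfl
  have j1 : ∀ χ : 𝓢(E3, E3), Integrable (fun t => deriv η t * fieldPair χ (w t))
      (volume.restrict (Ioi 0)) := fun χ => (bw.clm (fieldPair χ)).integrableOn_smul hη' hηc'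
  have j2 : ∀ χ : 𝓢(E3, E3), Integrable (fun t => κ * (η t * fieldPair χ (w t)))
      (volume.restrict (Ioi 0)) := fun χ =>
    ((bw.clm (fieldPair χ)).integrableOn_smul hη.continuous hηc).const_mul κ
  have j3 : ∀ χ : 𝓢(E3, E3), Integrable (fun t => η t * fieldPair χ (f t))
      (volume.restrict (Ioi 0)) := fun χ =>
    (bf.clm (fieldPair χ)).integrableOn_smul hη.continuous hηc
  have j4 : ∀ χ : 𝓢(E3, E3), Integrable (fun t => η t * gradPairFlip χ (N t))
      (volume.restrict (Ioi 0)) := fun χ =>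
    (bN.clm (gradPairFlip χ)).integrableOn_smul hη.continuous hηc
  have hL0 : ∀ i j, ∀ χ : 𝓢(E3, ℝ), (L.comp (potField i j)) χ = 0 := by
    intro i j
    refine SchwartzMap.eq_zero_of_forall_hasCompactSupport _ fun χ hχ => ?_
    have h := weakEquation_test hweak hw ha₁ hw₁ ha₂ hw₂ hη hηc (isTestField_potField i j hχ)
    have h1 := integral_sub ((j1 (potField i j χ)).fun_neg.sub (j2 (Δ (potField i j χ))))
      (j4 (potField i j χ))
    have h2 := integral_sub (j1 (potField i j χ)).fun_neg (j2 (Δ (potField i j χ)))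
    simp only [integral_neg, integral_const_mul, Pi.sub_apply] at h1 h2
    rw [ContinuousLinearMap.comp_apply, hLeq]
    linarith
  have hLφ : L φ = 0 := by
    rw [hφ, map_sum]
    refine Finset.sum_eq_zero fun i _ => ?_
    rw [map_sum]
    exact Finset.sum_eq_zero fun j _ => hL0 i j (ψ i j)
  rw [hLeq] at hLφ
  have h1 := integral_add (j2 (Δ φ)) (j3 φ)
  have h2 := integral_add ((j2 (Δ φ)).add (j3 φ)) (j4 φ)
  have h3 : ∀ t, η t * (κ * fieldPair (Δ φ) (w t) + fieldPair φ (f t) + gradPairFlip φ (N t))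
      = κ * (η t * fieldPair (Δ φ) (w t)) + η t * fieldPair φ (f t)
        + η t * gradPairFlip φ (N t) := fun t => by ring
  simp only [integral_const_mul, Pi.add_apply] at h1 h2
  refine Eq.trans ?_ (congrArg (η 0 * fieldPair φ w₀ + ·)
    (integral_congr_ae (.of_forall h3)).symm)
  linarith

/-! ### Linear differential equations in the sense of distributions in time -/

/-- `t` is a left Lebesgue point of `m`. -/
def IsLeftLebesguePt (t : ℝ) (m : ℝ → ℝ) : Prop :=
  Tendsto (fun h => h⁻¹ * ∫ s in Icc (t - h) t, |m s - m t|) (𝓝[>] 0) (𝓝 0)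

theorem deriv_smoothTransition_eq_zero {y : ℝ} (hy : y ∉ Icc (0 : ℝ) 1) :
    deriv Real.smoothTransition y = 0 := by
  rw [mem_Icc, not_and_or, not_le, not_le] at hy
  rcases hy with h | h
  · have : Real.smoothTransition =ᶠ[𝓝 y] fun _ => 0 := by
      filter_upwards [Iio_mem_nhds h] with z hz
      exact Real.smoothTransition.zero_of_nonpos (le_of_lt hz)
    rw [this.deriv_eq, deriv_const]
  · have : Real.smoothTransition =ᶠ[𝓝 y] fun _ => 1 := by
      filter_upwards [Ioi_mem_nhds h] with z hz
      exact Real.smoothTransition.one_of_one_le (le_of_lt hz)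
    rw [this.deriv_eq, deriv_const]

/-- If `m' = F` on `(0, ∞)` and `m(0) = m₀` hold in the sense of distributions, then
`(P m)' = P' m + P F` holds in integrated form at the Lebesgue points of `m`. -/
theorem mul_eq_of_weak_deriv {m F : ℝ → ℝ} {m₀ : ℝ} (hm : LocBdd m) (hF : LocBdd F)
    (hweak : ∀ η : ℝ → ℝ, ContDiff ℝ ∞ η → HasCompactSupport η →
      -∫ s in Ioi (0 : ℝ), deriv η s * m s = η 0 * m₀ + ∫ s in Ioi (0 : ℝ), η s * F s)
    {t : ℝ} (ht : 0 < t) (hgood : IsLeftLebesguePt t m) {P : ℝ → ℝ} (hP : ContDiff ℝ ∞ P) :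
    P t * m t = P 0 * m₀ + ∫ s in Ioo 0 t, (deriv P s * m s + P s * F s) := by
  have hσ : ContDiff ℝ ∞ Real.smoothTransition := Real.smoothTransition.contDiff
  have hσd : Continuous (deriv Real.smoothTransition) := hσ.continuous_deriv (by simp)
  have hPd : Continuous (deriv P) := hP.continuous_deriv (by simp)
  set σ := Real.smoothTransition with hσdef
  -- `K h` is an approximate identity concentrated on `[t - h, t]`.
  set K : ℝ → ℝ → ℝ := fun h s => h⁻¹ * deriv σ ((t - s) / h) with hK
  set Q : ℝ → ℝ := fun s => deriv P s * m s + P s * F s with hQ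
  have hQb : LocBdd Q := by
    have h1 := hm.continuous_smul hPd
    have h2 := hF.continuous_smul hP.continuous
    exact h1.add h2
  have hKc : ∀ h, Continuous (K h) := fun h =>
    continuous_const.mul (hσd.comp ((continuous_const.sub continuous_id).div_const h))
  have hK0 : ∀ h > 0, ∀ s ∉ Icc (t - h) t, K h s = 0 := by
    intro h hh s hs
    have : (t - s) / h ∉ Icc (0 : ℝ) 1 := by
      intro hmem
      apply hs
      have h1 := (le_div_iff₀ hh).1 hmem.1
      have h2 := (div_le_one hh).1 hmem.2
      exact ⟨by linarith, by linarith⟩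
    simp only [hK]
    rw [deriv_smoothTransition_eq_zero this, mul_zero]
  obtain ⟨C, hC⟩ : ∃ C, ∀ y, |deriv σ y| ≤ C := by
    obtain ⟨C, hC⟩ := (isCompact_Icc (a := (0 : ℝ)) (b := 1)).exists_bound_of_continuousOn
      hσd.continuousOn
    refine ⟨max C 0, fun y => ?_⟩
    by_cases hy : y ∈ Icc (0 : ℝ) 1
    · exact (hC y hy).trans (le_max_left _ _)
    · rw [deriv_smoothTransition_eq_zero hy, abs_zero]
      exact le_max_right _ _
  have hC0 : 0 ≤ C := (abs_nonneg _).trans (hC 0)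
  have hKint : ∀ h > 0, ∫ s in Icc (t - h) t, K h s = 1 := by
    intro h hh
    rw [integral_Icc_eq_integral_Ioc, ← intervalIntegral.integral_of_le (by linarith)]
    have hd : ∀ s, HasDerivAt (fun s => -σ ((t - s) / h)) (K h s) s := by
      intro s
      have h1 : HasDerivAt (fun s => (t - s) / h) (-1 / h) s :=
        ((hasDerivAt_id s).const_sub t).div_const h
      have h2 := ((hσ.differentiable (by simp) ((t - s) / h)).hasDerivAt.comp s h1).neg
      refine h2.congr_deriv ?_
      simp only [hK]
      field_simp
    rw [intervalIntegral.integral_eq_sub_of_hasDerivAt (fun s _ => hd s)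
      ((hKc h).intervalIntegrable _ _)]
    have e1 : (t - (t - h)) / h = 1 := by field_simp; ring
    rw [e1, sub_self, zero_div, hσdef, Real.smoothTransition.zero, Real.smoothTransition.one]
    norm_num
  -- The weak equation tested with `σ((t - s) / h) P(s)`. The factor `σ(s + 2)`, which is `1` for
  -- `s ≥ 0`, makes the support compact.
  have key : ∀ h, 0 < h → h < t → ∫ s in Icc (t - h) t, K h s * (P s * m s)
      = P 0 * m₀ + ∫ s in Ioo 0 t, σ ((t - s) / h) * Q s := by
    intro h hh hht
    let η : ℝ → ℝ := fun s => σ ((t - s) / h) * σ (s + 2) * P s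
    have hη : ContDiff ℝ ∞ η :=
      ((hσ.comp ((contDiff_const.sub contDiff_id).div_const h)).mul
        (hσ.comp (contDiff_id.add contDiff_const))).mul hP
    have hηc : HasCompactSupport η := by
      refine HasCompactSupport.intro (isCompact_Icc (a := (-2 : ℝ)) (b := t)) fun s hs => ?_
      rw [mem_Icc, not_and_or, not_le, not_le] at hs
      rcases hs with h1 | h1
      · simp [η, hσdef, Real.smoothTransition.zero_of_nonpos (by linarith : s + 2 ≤ 0)]
      · have : (t - s) / h ≤ 0 := div_nonpos_of_nonpos_of_nonneg (by linarith) hh.le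
        simp [η, hσdef, Real.smoothTransition.zero_of_nonpos this]
    have hη0 : η 0 = P 0 := by
      have h1 : 1 ≤ (t - 0) / h := by rw [le_div_iff₀ hh]; linarith
      simp only [η, hσdef, Real.smoothTransition.one_of_one_le h1,
        Real.smoothTransition.one_of_one_le (by norm_num : (1 : ℝ) ≤ 0 + 2)]
      ring
    have hηs : ∀ s ∈ Ioi (0 : ℝ), η =ᶠ[𝓝 s] fun s => σ ((t - s) / h) * P s := by
      intro s hs
      filter_upwards [Ioi_mem_nhds hs] with z hz
      have : (1 : ℝ) ≤ z + 2 := by linarith [mem_Ioi.1 hz]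
      simp [η, hσdef, Real.smoothTransition.one_of_one_le this]
    have hηd : ∀ s ∈ Ioi (0 : ℝ), deriv η s = -(K h s * P s) + σ ((t - s) / h) * deriv P s := by
      intro s hs
      rw [(hηs s hs).deriv_eq]
      have h1 : HasDerivAt (fun s => (t - s) / h) (-1 / h) s :=
        ((hasDerivAt_id s).const_sub t).div_const h
      have h2 := ((hσ.differentiable (by simp) ((t - s) / h)).hasDerivAt.comp s h1).mul
        (hP.differentiable (by simp) s).hasDerivAt
      have h3 : HasDerivAt (fun s => σ ((t - s) / h) * P s) _ s := h2
      rw [h3.deriv]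
      simp only [hK, Function.comp]
      ring
    have hw := hweak η hη hηc
    have hσ0 : ∀ s ∈ Ioi (0 : ℝ) \ Ioo 0 t, σ ((t - s) / h) = 0 := by
      intro s hs
      have : t ≤ s := by
        by_contra hlt
        exact hs.2 ⟨hs.1, not_le.1 hlt⟩
      exact Real.smoothTransition.zero_of_nonpos
        (div_nonpos_of_nonpos_of_nonneg (by linarith) hh.le)
    have hIcc : Icc (t - h) t ⊆ Ioi 0 := fun s hs => by
      have := hs.1
      simp only [mem_Ioi]
      linarith
    have hmIcc : IntegrableOn m (Icc (t - h) t) := by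
      refine (hm.integrableOn (t + 1)).mono_set fun s hs => ?_
      exact ⟨hIcc hs, by linarith [hs.2]⟩
    have i1 : IntegrableOn (fun s => K h s * (P s * m s)) (Ioi 0) := by
      refine IntegrableOn.of_forall_sdiff_eq_zero (s := Icc (t - h) t) ?_ measurableSet_Ioi
        fun s hs => by simp [hK0 h hh s hs.2]
      have := hmIcc.continuousOn_mul ((hKc h).mul hP.continuous).continuousOn isCompact_Icc
      refine this.congr_fun (fun s _ => ?_) measurableSet_Icc
      simp only [Pi.mul_apply]
      ring
    have i2' : ∀ {g : ℝ → ℝ}, LocBdd g →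
        IntegrableOn (fun s => σ ((t - s) / h) * g s) (Ioi 0) := by
      intro g hg
      refine IntegrableOn.of_forall_sdiff_eq_zero (s := Ioo 0 t) ?_ measurableSet_Ioi
        fun s hs => by simp [hσ0 s hs]
      exact (hg.continuous_smul (c := fun s => σ ((t - s) / h))
        (hσ.continuous.comp ((continuous_const.sub continuous_id).div_const h))).integrableOn t
    have hPm : LocBdd fun s => deriv P s * m s := hm.continuous_smul hPd
    have hPF : LocBdd fun s => P s * F s := hF.continuous_smul hP.continuous
    have e1 : ∫ s in Ioi (0 : ℝ), deriv η s * m s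
        = -(∫ s in Ioi (0 : ℝ), K h s * (P s * m s))
          + ∫ s in Ioi (0 : ℝ), σ ((t - s) / h) * (deriv P s * m s) := by
      rw [← integral_neg, ← integral_add i1.fun_neg (i2' hPm)]
      refine setIntegral_congr_fun measurableSet_Ioi fun s hs => ?_
      simp only [hηd s hs]
      ring
    have e2 : ∫ s in Ioi (0 : ℝ), η s * F s
        = ∫ s in Ioi (0 : ℝ), σ ((t - s) / h) * (P s * F s) := by
      refine setIntegral_congr_fun measurableSet_Ioi fun s hs => ?_
      simp only [(hηs s hs).eq_of_nhds]
      ring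
    have e3 : ∫ s in Ioi (0 : ℝ), σ ((t - s) / h) * Q s
        = (∫ s in Ioi (0 : ℝ), σ ((t - s) / h) * (deriv P s * m s))
          + ∫ s in Ioi (0 : ℝ), σ ((t - s) / h) * (P s * F s) := by
      rw [← integral_add (i2' hPm) (i2' hPF)]
      refine setIntegral_congr_fun measurableSet_Ioi fun s _ => ?_
      simp only [hQ]
      ring
    have e4 : ∫ s in Ioo 0 t, σ ((t - s) / h) * Q s
        = ∫ s in Ioi (0 : ℝ), σ ((t - s) / h) * Q s :=
      (setIntegral_eq_of_subset_of_forall_sdiff_eq_zero measurableSet_Ioi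
        Ioo_subset_Ioi_self fun s hs => by simp [hσ0 s hs]).symm
    have e5 : ∫ s in Icc (t - h) t, K h s * (P s * m s)
        = ∫ s in Ioi (0 : ℝ), K h s * (P s * m s) :=
      (setIntegral_eq_of_subset_of_forall_sdiff_eq_zero measurableSet_Ioi
        hIcc fun s hs => by simp [hK0 h hh s hs.2]).symm
    rw [e1, e2, hη0] at hw
    rw [e4, e5, e3]
    linarith
  have hmem : ∀ᶠ h in 𝓝[>] (0 : ℝ), 0 < h ∧ h < t := Ioo_mem_nhdsGT ht
  have limR : Tendsto (fun h => P 0 * m₀ + ∫ s in Ioo 0 t, σ ((t - s) / h) * Q s) (𝓝[>] 0)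
      (𝓝 (P 0 * m₀ + ∫ s in Ioo 0 t, Q s)) := by
    refine tendsto_const_nhds.add ?_
    refine tendsto_integral_filter_of_dominated_convergence (fun s => ‖Q s‖) ?_ ?_ ?_ ?_
    · refine .of_forall fun h => ?_
      exact (hσ.continuous.comp ((continuous_const.sub continuous_id).div_const
        h)).aestronglyMeasurable.mul (hQb t ht).1
    · refine .of_forall fun h => .of_forall fun s => ?_
      rw [norm_mul, Real.norm_of_nonneg (Real.smoothTransition.nonneg _)]
      exact mul_le_of_le_one_left (norm_nonneg _) (Real.smoothTransition.le_one _)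
    · exact (hQb.integrableOn t).norm
    · refine (ae_restrict_iff' measurableSet_Ioo).2 (.of_forall fun s hs => ?_)
      refine tendsto_const_nhds.congr' ?_
      have hpos : 0 < t - s := by linarith [hs.2]
      filter_upwards [Ioo_mem_nhdsGT hpos] with h hh
      have : 1 ≤ (t - s) / h := by rw [le_div_iff₀ hh.1]; linarith [hh.2]
      simp [hσdef, Real.smoothTransition.one_of_one_le this]
  have limL : Tendsto (fun h => ∫ s in Icc (t - h) t, K h s * (P s * m s)) (𝓝[>] 0)
      (𝓝 (P t * m t)) := by
    obtain ⟨B, hB⟩ := (isCompact_Icc (a := (0 : ℝ)) (b := t)).exists_bound_of_continuousOn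
      hP.continuous.continuousOn
    have hPt : Tendsto P (𝓝 t) (𝓝 (P t)) := hP.continuous.tendsto t
    rw [Metric.tendsto_nhdsWithin_nhds]
    intro ε hε
    obtain ⟨ε', hε', hε'2⟩ : ∃ ε' > 0, ε' * (C * |B| + C * |m t|) < ε := by
      refine ⟨ε / (C * |B| + C * |m t| + 1), by positivity, ?_⟩
      rw [div_mul_eq_mul_div, div_lt_iff₀ (by positivity)]
      nlinarith
    obtain ⟨d1, hd1, hd1'⟩ := Metric.tendsto_nhds_nhds.1 hPt ε' hε'
    obtain ⟨d2, hd2, hd2'⟩ := Metric.tendsto_nhdsWithin_nhds.1 hgood ε' hε'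
    refine ⟨min (min d1 d2) t, by positivity, fun h hh hdist => ?_⟩
    have hh : 0 < h := hh
    rw [Real.dist_eq, sub_zero, abs_of_pos hh] at hdist
    have hhd1 : h < d1 := hdist.trans_le ((min_le_left _ _).trans (min_le_left _ _))
    have hhd2 : h < d2 := hdist.trans_le ((min_le_left _ _).trans (min_le_right _ _))
    have hht : h < t := hdist.trans_le (min_le_right _ _)
    have hg := hd2' hh (by rwa [Real.dist_eq, sub_zero, abs_of_pos hh])
    rw [Real.dist_eq, sub_zero] at hg
    have hg := (le_abs_self _).trans_lt hg
    have hmIcc : IntegrableOn m (Icc (t - h) t) := by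
      refine (hm.integrableOn (t + 1)).mono_set fun s hs => ?_
      exact ⟨by linarith [hs.1], by linarith [hs.2]⟩
    have hmd : IntegrableOn (fun s => |m s - m t|) (Icc (t - h) t) :=
      (hmIcc.sub (integrableOn_const (by simp))).abs
    have i1 : IntegrableOn (fun s => K h s * (P s * m s)) (Icc (t - h) t) := by
      have := hmIcc.continuousOn_mul ((hKc h).mul hP.continuous).continuousOn isCompact_Icc
      refine this.congr_fun (fun s _ => ?_) measurableSet_Icc
      simp only [Pi.mul_apply]
      ring
    have i2 : IntegrableOn (fun s => K h s * (P t * m t)) (Icc (t - h) t) :=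
      ((hKc h).mul continuous_const).continuousOn.integrableOn_Icc
    have e1 : (∫ s in Icc (t - h) t, K h s * (P s * m s)) - P t * m t
        = ∫ s in Icc (t - h) t, (K h s * (P s * m s) - K h s * (P t * m t)) := by
      rw [integral_sub i1 i2, integral_mul_const, hKint h hh, one_mul]
    rw [Real.dist_eq, e1]
    have hbd : ∀ s ∈ Icc (t - h) t, ‖K h s * (P s * m s) - K h s * (P t * m t)‖
        ≤ C * |B| * (h⁻¹ * |m s - m t|) + h⁻¹ * C * ε' * |m t| := by
      intro s hs
      have hKs : |K h s| ≤ h⁻¹ * C := by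
        simp only [hK]
        rw [abs_mul, abs_of_pos (inv_pos.2 hh)]
        exact mul_le_mul_of_nonneg_left (hC _) (inv_pos.2 hh).le
      have hPs : |P s| ≤ |B| :=
        (hB s ⟨by linarith [hs.1], hs.2⟩).trans (le_abs_self B)
      have hPst : |P s - P t| ≤ ε' := by
        have : dist s t < d1 := by
          rw [Real.dist_eq, abs_sub_lt_iff]
          exact ⟨by linarith [hs.2], by linarith [hs.1]⟩
        exact (hd1' this).le
      have : K h s * (P s * m s) - K h s * (P t * m t)
          = K h s * (P s * (m s - m t) + (P s - P t) * m t) := by ring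
      rw [this, Real.norm_eq_abs, abs_mul]
      calc |K h s| * |P s * (m s - m t) + (P s - P t) * m t|
          ≤ (h⁻¹ * C) * (|B| * |m s - m t| + ε' * |m t|) := by
            refine mul_le_mul hKs ?_ (abs_nonneg _) (by positivity)
            refine (abs_add_le _ _).trans ?_
            rw [abs_mul, abs_mul]
            gcongr
        _ = _ := by ring
    calc |∫ s in Icc (t - h) t, (K h s * (P s * m s) - K h s * (P t * m t))|
        ≤ ∫ s in Icc (t - h) t, (C * |B| * (h⁻¹ * |m s - m t|) + h⁻¹ * C * ε' * |m t|) := by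
          refine norm_integral_le_of_norm_le ?_
            ((ae_restrict_iff' measurableSet_Icc).2 (.of_forall hbd))
          exact ((hmd.const_mul _).const_mul _).add (integrableOn_const (by simp))
      _ = C * |B| * (h⁻¹ * ∫ s in Icc (t - h) t, |m s - m t|) + C * ε' * |m t| := by
          rw [integral_add ((hmd.const_mul _).const_mul _) (integrableOn_const (by simp)),
            integral_const_mul, integral_const_mul, setIntegral_const]
          have : (volume.real (Icc (t - h) t)) = h := by
            rw [Real.volume_real_Icc_of_le (by linarith)]; ring
          rw [this, smul_eq_mul]
          field_simp
      _ ≤ C * |B| * ε' + C * ε' * |m t| := by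
          gcongr
      _ < ε := by linarith
  refine tendsto_nhds_unique limL (limR.congr' ?_)
  filter_upwards [hmem] with h hh
  exact (key h hh.1 hh.2).symm

/-! ### Fields prescribed on the frequency side -/

/-- The real part `ℂ³ → ℝ³`. -/
def reC3 : C3 →L[ℝ] E3 :=
  LinearMap.toContinuousLinearMap
    { toFun := fun z => WithLp.toLp 2 fun i => (z i).re
      map_add' := fun v w => by ext i; simp
      map_smul' := fun c v => by ext i; simp }

theorem reC3_apply (z : C3) (i : Fin 3) : reC3 z i = (z i).re := rfl

theorem toC3_apply (v : E3) (i : Fin 3) : toC3 v i = (v i : ℂ) := rfl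

theorem inner_reC3 (v : E3) (z : C3) : inner ℝ v (reC3 z) = (inner ℂ (toC3 v) z : ℂ).re := by
  simp [PiLp.inner_apply, reC3_apply, toC3_apply, mul_comm]

theorem norm_reC3_le (z : C3) : ‖reC3 z‖ ≤ ‖z‖ := by
  rw [EuclideanSpace.norm_eq, EuclideanSpace.norm_eq]
  refine Real.sqrt_le_sqrt (Finset.sum_le_sum fun i _ => ?_)
  rw [reC3_apply]
  exact pow_le_pow_left₀ (norm_nonneg _) (by simpa using Complex.abs_re_le_norm (z i)) 2

/-- The dilation `ζ ↦ 2πζ`. -/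
def dilation : E3 ≃L[ℝ] E3 :=
  ContinuousLinearEquiv.smulLeft (Units.mk0 (2 * Real.pi) (by positivity))

section synth

variable {F F' : Type*} [NormedAddCommGroup F] [NormedSpace ℂ F] [NormedAddCommGroup F']
  [NormedSpace ℝ F']

/-- The function `ζ ↦ (2π)³ g(2πζ)`. Its inverse Fourier transform in Mathlib's normalization is
`x ↦ ∫ e^{i x·ξ} g(ξ) dξ`. -/
def rescale : 𝓢(E3, F) →ₗ[ℝ] 𝓢(E3, F) :=
  ((2 * Real.pi) ^ 3) • (SchwartzMap.compCLMOfContinuousLinearEquiv ℝ dilation).toLinearMap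

theorem rescale_apply (g : 𝓢(E3, F)) (ζ : E3) :
    rescale g ζ = (2 * Real.pi) ^ 3 • g ((2 * Real.pi) • ζ) := rfl

/-- The field `x ↦ P (∫ e^{i x·ξ} g(ξ) dξ)`, where `P` is a real linear map, usually a real
part. -/
def synth (P : F →L[ℝ] F') : 𝓢(E3, F) →ₗ[ℝ] 𝓢(E3, F') where
  toFun g := (𝓕⁻ (rescale g)).postcompCLM P
  map_add' g h := by
    rw [LinearMap.map_add, FourierTransform.fourierInv_add, map_add]
  map_smul' c g := by
    rw [LinearMap.map_smul]
    have : (c • rescale g : 𝓢(E3, F)) = (c : ℂ) • rescale g := by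
      ext x
      simp
    rw [this, FourierTransform.fourierInv_smul]
    ext x
    simp

theorem synth_apply (P : F →L[ℝ] F') (g : 𝓢(E3, F)) (x : E3) :
    synth P g x = P (𝓕⁻ (rescale g) x) := rfl

theorem hasTemperateGrowth_inner (m : E3) :
    (fun ξ : E3 => (inner ℝ ξ m : ℝ)).HasTemperateGrowth :=
  ((innerSL ℝ).flip m).hasTemperateGrowth

/-- Multiplication by `i m·ξ`, the symbol of the derivative in the direction `m`. -/
def derivSymbol (m : E3) (g : 𝓢(E3, F)) : 𝓢(E3, F) :=
  Complex.I • SchwartzMap.smulLeftCLM F (fun ξ : E3 => (inner ℝ ξ m : ℝ)) g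

theorem derivSymbol_apply (m : E3) (g : 𝓢(E3, F)) (ξ : E3) :
    derivSymbol m g ξ = Complex.I • (inner ℝ ξ m : ℝ) • g ξ := by
  simp [derivSymbol, hasTemperateGrowth_inner]

theorem lineDerivOp_synth (P : F →L[ℝ] F') (m : E3) (g : 𝓢(E3, F)) :
    ∂_{m} (synth P g) = synth P (derivSymbol m g) := by
  have h1 : ∂_{m} (synth P g) = (∂_{m} (𝓕⁻ (rescale g))).postcompCLM P := by
    ext x
    rw [SchwartzMap.lineDerivOp_apply_eq_fderiv, SchwartzMap.postcompCLM_apply,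
      SchwartzMap.lineDerivOp_apply_eq_fderiv]
    exact fderiv_postcompCLM P (𝓕⁻ (rescale g)) x m
  have h2 : ((2 * Real.pi * Complex.I : ℂ)) •
      SchwartzMap.smulLeftCLM F (fun ξ : E3 => (inner ℝ ξ m : ℝ)) (rescale g)
        = rescale (derivSymbol m g) := by
    ext ζ
    rw [smul_apply, SchwartzMap.smulLeftCLM_apply_apply (hasTemperateGrowth_inner m),
      rescale_apply, rescale_apply, derivSymbol_apply, real_inner_smul_left]
    simp only [← Complex.coe_smul, smul_smul]
    congr 1
    push_cast
    ring
  rw [h1, SchwartzMap.lineDerivOp_fourierInv_eq, h2]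
  rfl

theorem hasTemperateGrowth_norm_sq : (fun ξ : E3 => ‖ξ‖ ^ 2).HasTemperateGrowth := by
  fun_prop

theorem laplacian_synth (P : F →L[ℝ] F') (g : 𝓢(E3, F)) :
    Δ (synth P g) = -synth P (SchwartzMap.smulLeftCLM F (fun ξ : E3 => ‖ξ‖ ^ 2) g) := by
  rw [SchwartzMap.laplacian_eq_sum (EuclideanSpace.basisFun (Fin 3) ℝ)]
  simp only [lineDerivOp_synth]
  rw [← map_sum, ← (synth P).map_neg]
  congr 1
  ext ξ
  rw [neg_apply, SchwartzMap.smulLeftCLM_apply_apply hasTemperateGrowth_norm_sq,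
    sum_apply, EuclideanSpace.norm_sq_eq, Finset.sum_smul, ← Finset.sum_neg_distrib]
  refine Finset.sum_congr rfl fun i _ => ?_
  rw [derivSymbol_apply, derivSymbol_apply]
  simp only [← Complex.coe_smul, smul_smul, ← neg_smul]
  congr 1
  have : (inner ℝ ξ (EuclideanSpace.basisFun (Fin 3) ℝ i) : ℝ) = ξ i := by
    rw [EuclideanSpace.basisFun_apply, EuclideanSpace.inner_single_right]
    simp
  rw [this]
  have hI := Complex.I_mul_I
  push_cast [Real.norm_eq_abs, sq_abs]
  linear_combination (ξ i : ℂ) ^ 2 * hI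

theorem integral_dilation {X : Type*} [NormedAddCommGroup X] [NormedSpace ℝ X] (f : E3 → X) :
    ∫ ζ, (2 * Real.pi) ^ 3 • f ((2 * Real.pi) • ζ) = ∫ ξ, f ξ := by
  have h0 : (0 : ℝ) < (2 * Real.pi) ^ 3 := by positivity
  rw [integral_smul, Measure.integral_comp_smul, finrank_euclideanSpace_fin,
    abs_of_pos (by positivity), smul_smul, mul_inv_cancel₀ h0.ne', one_smul]

theorem norm_fourierInv_rescale_le (g : 𝓢(E3, F)) (x : E3) :
    ‖𝓕⁻ (rescale g) x‖ ≤ ∫ ξ, ‖g ξ‖ := by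
  rw [← integral_dilation]
  have h : 𝓕⁻ (rescale g) x = 𝓕 (rescale g) (-x) := rfl
  rw [h]
  refine (SchwartzMap.norm_fourier_apply_le_toLp_one _ _).trans ?_
  rw [SchwartzMap.norm_toLp_one]
  refine (integral_congr_ae (.of_forall fun ζ => ?_)).le
  simp only [rescale_apply, norm_smul, norm_pow, norm_mul, smul_eq_mul]
  rw [Real.norm_of_nonneg Real.pi_pos.le, Real.norm_ofNat]

end synth

theorem fhat_dilation (v : L2) (ζ : E3) :
    fhat v ((2 * Real.pi) • ζ) = (𝓕 (toC3.compLp v) : Lp C3 2 (volume : Measure E3)) ζ := by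
  have : (2 * Real.pi) ≠ 0 := by positivity
  rw [fhat, smul_smul, inv_mul_cancel₀ this, one_smul]

/-- Parseval's identity. There is no factor `(2π)⁻³` on the right, since `synth` omits it too. -/
theorem fieldPair_synth (g : 𝓢(E3, C3)) (v : L2) :
    fieldPair (synth reC3 g) v = ∫ ξ, (inner ℂ (fhat v ξ) (g ξ) : ℂ).re := by
  set w : Lp C3 2 (volume : Measure E3) := toC3.compLp v with hw
  set H := rescale g with hH
  have h1 : fieldPair (synth reC3 g) v = ∫ x, (inner ℂ (w x) ((𝓕⁻ H).toLp 2 volume x) : ℂ).re := by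
    rw [fieldPair_eq]
    refine integral_congr_ae ?_
    filter_upwards [toC3.coeFn_compLp v, (𝓕⁻ H).coeFn_toLp 2 volume] with x hx hx'
    rw [hx', hw, hx, synth_apply, inner_reC3]
  have h2 : ∀ a b : Lp C3 2 (volume : Measure E3),
      ∫ x, (inner ℂ (a x) (b x) : ℂ).re = (inner ℂ a b : ℂ).re := by
    intro a b
    rw [L2.inner_def]
    exact integral_re (L2.integrable_inner (𝕜 := ℂ) a b)
  have h3 : (inner ℂ w ((𝓕⁻ H).toLp 2 volume) : ℂ) = inner ℂ (𝓕 w) (H.toLp 2 volume) := by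
    rw [← SchwartzMap.toLp_fourierInv_eq, ← Lp.inner_fourier_eq,
      FourierTransform.fourier_fourierInv_eq]
  rw [h1, h2, h3, ← h2, ← integral_dilation fun ξ => (inner ℂ (fhat v ξ) (g ξ) : ℂ).re]
  refine integral_congr_ae ?_
  filter_upwards [H.coeFn_toLp 2 volume] with ζ hζ
  rw [hζ, fhat_dilation, hH, rescale_apply, inner_smul_right_eq_smul, Complex.smul_re]

theorem norm_fderiv_synth_le (g : 𝓢(E3, C3)) (x m : E3) :
    ‖fderiv ℝ (synth reC3 g) x m‖ ≤ ‖m‖ * ∫ ξ, ‖ξ‖ * ‖g ξ‖ := by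
  rw [← SchwartzMap.lineDerivOp_apply_eq_fderiv, lineDerivOp_synth, synth_apply]
  refine (norm_reC3_le _).trans ((norm_fourierInv_rescale_le _ x).trans ?_)
  rw [← integral_const_mul]
  have hint : Integrable fun ξ : E3 => ‖ξ‖ * ‖g ξ‖ := by
    simpa using g.integrable_pow_mul volume 1
  refine integral_mono (derivSymbol m g).integrable.norm (hint.const_mul _) fun ξ => ?_
  simp only [derivSymbol_apply, norm_smul, Complex.norm_I, one_mul]
  calc ‖(inner ℝ ξ m : ℝ)‖ * ‖g ξ‖ ≤ (‖ξ‖ * ‖m‖) * ‖g ξ‖ := by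
        gcongr
        exact norm_inner_le_norm ξ m
    _ = ‖m‖ * (‖ξ‖ * ‖g ξ‖) := by ring

theorem abs_gradPairFlip_synth_tensor_le (g : 𝓢(E3, C3)) (a w : L2) :
    |gradPairFlip (synth reC3 g) (tensor a w)| ≤ ‖a‖ * ‖w‖ * ∫ ξ, ‖ξ‖ * ‖g ξ‖ := by
  rw [gradPairFlip_apply, gradPair_tensor]
  set D := ∫ ξ, ‖ξ‖ * ‖g ξ‖ with hD
  have hD0 : 0 ≤ D := integral_nonneg fun ξ => by positivity
  have hcs : ∫ x, ‖w x‖ * ‖a x‖ ≤ ‖w‖ * ‖a‖ := by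
    have h := integral_mul_norm_le_Lp_mul_Lq (μ := (volume : Measure E3)) (f := w) (g := a)
      (p := 2) (q := 2) (by constructor <;> norm_num) (by simpa using Lp.memLp w)
      (by simpa using Lp.memLp a)
    have hn : ∀ v : L2, (∫ x, ‖v x‖ ^ (2 : ℝ)) ^ (1 / (2 : ℝ)) = ‖v‖ := by
      intro v
      have := real_inner_self_eq_norm_sq v
      rw [L2.inner_def] at this
      simp only [real_inner_self_eq_norm_sq] at this
      simp only [Real.rpow_two]
      rw [this, ← Real.sqrt_eq_rpow, Real.sqrt_sq (norm_nonneg v)]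
    rwa [hn, hn] at h
  have hint : Integrable fun x => ‖w x‖ * ‖a x‖ := by
    have := MemLp.integrable_mul (p := 2) (q := 2) (Lp.memLp w).norm (Lp.memLp a).norm
    exact this
  rw [← Real.norm_eq_abs]
  calc ‖∫ x, inner ℝ (w x) (fderiv ℝ (synth reC3 g) x (a x))‖
      ≤ ∫ x, ‖w x‖ * ‖a x‖ * D := by
        refine norm_integral_le_of_norm_le (hint.mul_const D) (.of_forall fun x => ?_)
        refine (norm_inner_le_norm (𝕜 := ℝ) _ _).trans ?_
        rw [mul_assoc]
        exact mul_le_mul_of_nonneg_left (norm_fderiv_synth_le g x (a x)) (norm_nonneg _)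
    _ = (∫ x, ‖w x‖ * ‖a x‖) * D := integral_mul_const D _
    _ ≤ ‖a‖ * ‖w‖ * D := by
        rw [mul_comm ‖a‖]
        exact mul_le_mul_of_nonneg_right hcs hD0

/-! ### Solenoidal symbols -/

theorem fourierInv_postcomp {F F' : Type*} [NormedAddCommGroup F] [NormedSpace ℂ F]
    [CompleteSpace F] [NormedAddCommGroup F'] [NormedSpace ℂ F'] [CompleteSpace F']
    (A : F →L[ℂ] F') (h : 𝓢(E3, F)) (x : E3) :
    𝓕⁻ (h.postcompCLM A) x = A (𝓕⁻ h x) := by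
  rw [SchwartzMap.fourierInv_coe, SchwartzMap.fourierInv_coe, Real.fourierInv_eq,
    Real.fourierInv_eq, ← ContinuousLinearMap.integral_comp_comm]
  · refine integral_congr_ae (.of_forall fun v => ?_)
    simp [Circle.smul_def]
  · simpa using (Real.fourierIntegral_convergent_iff (μ := volume) (-x)).2 h.integrable

theorem rescale_postcomp {F F' : Type*} [NormedAddCommGroup F] [NormedSpace ℂ F]
    [NormedAddCommGroup F'] [NormedSpace ℂ F'] (A : F →L[ℂ] F') (h : 𝓢(E3, F)) :
    rescale (h.postcompCLM A) = (rescale h).postcompCLM A := by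
  ext ζ
  simp only [rescale_apply, SchwartzMap.postcompCLM_apply]
  exact (A.map_smul_of_tower _ _).symm

/-- The symbol `γ(ξ) (ξⱼ eᵢ - ξᵢ eⱼ)`. -/
def curlSymbol (i j : Fin 3) (γ : 𝓢(E3, ℂ)) : 𝓢(E3, C3) :=
  (SchwartzMap.smulLeftCLM ℂ (fun ξ : E3 => (inner ℝ ξ (e j) : ℝ)) γ).postcompCLM
      (ContinuousLinearMap.toSpanSingleton ℂ (toC3 (e i)))
    - (SchwartzMap.smulLeftCLM ℂ (fun ξ : E3 => (inner ℝ ξ (e i) : ℝ)) γ).postcompCLM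
      (ContinuousLinearMap.toSpanSingleton ℂ (toC3 (e j)))

theorem inner_e (ξ : E3) (i : Fin 3) : (inner ℝ ξ (e i) : ℝ) = ξ i := by
  rw [e, EuclideanSpace.inner_single_right]
  simp

theorem curlSymbol_apply (i j : Fin 3) (γ : 𝓢(E3, ℂ)) (ξ : E3) :
    curlSymbol i j γ ξ = γ ξ • (ξ j • toC3 (e i) - ξ i • toC3 (e j)) := by
  have h : curlSymbol i j γ ξ
      = (SchwartzMap.smulLeftCLM ℂ (fun ξ : E3 => (inner ℝ ξ (e j) : ℝ)) γ ξ) • toC3 (e i)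
      - (SchwartzMap.smulLeftCLM ℂ (fun ξ : E3 => (inner ℝ ξ (e i) : ℝ)) γ ξ) • toC3 (e j) := rfl
  rw [h, SchwartzMap.smulLeftCLM_apply_apply (hasTemperateGrowth_inner _),
    SchwartzMap.smulLeftCLM_apply_apply (hasTemperateGrowth_inner _), inner_e, inner_e, smul_sub]
  simp only [← Complex.coe_smul, smul_smul, smul_eq_mul, mul_comm]

/-- A symbol that synthesizes a sum of fields with a Schwartz potential. Its values are orthogonal
to the frequency. -/
def IsSolenoidal (g : 𝓢(E3, C3)) : Prop :=
  ∃ γ : Fin 3 → Fin 3 → 𝓢(E3, ℂ), g = ∑ i, ∑ j, curlSymbol i j (γ i j)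

theorem IsSolenoidal.smulLeft {g : 𝓢(E3, C3)} (hg : IsSolenoidal g) {h : E3 → ℝ}
    (hh : h.HasTemperateGrowth) : IsSolenoidal (SchwartzMap.smulLeftCLM C3 h g) := by
  obtain ⟨γ, rfl⟩ := hg
  refine ⟨fun i j => SchwartzMap.smulLeftCLM ℂ h (γ i j), ?_⟩
  ext1 ξ
  rw [SchwartzMap.smulLeftCLM_apply_apply hh]
  simp only [sum_apply, curlSymbol_apply, Finset.smul_sum, SchwartzMap.smulLeftCLM_apply_apply hh,
    smul_assoc]

theorem synth_curlSymbol (i j : Fin 3) (γ : 𝓢(E3, ℂ)) :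
    synth reC3 (curlSymbol i j γ) = potField i j (synth Complex.reCLM (-(Complex.I • γ))) := by
  have hγ : ∀ m : E3, derivSymbol m (-(Complex.I • γ))
      = SchwartzMap.smulLeftCLM ℂ (fun ξ : E3 => (inner ℝ ξ m : ℝ)) γ := by
    intro m
    ext ξ
    rw [derivSymbol_apply, SchwartzMap.smulLeftCLM_apply_apply (hasTemperateGrowth_inner m),
      neg_apply, smul_apply]
    simp only [← Complex.coe_smul, smul_eq_mul]
    linear_combination (-(inner ℝ ξ m : ℝ) * γ ξ : ℂ) * Complex.I_mul_I
  have key : ∀ (m : E3) (h : 𝓢(E3, ℂ)) (x : E3),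
      synth reC3 (h.postcompCLM (ContinuousLinearMap.toSpanSingleton ℂ (toC3 m))) x
        = synth Complex.reCLM h x • m := by
    intro m h x
    rw [synth_apply, synth_apply, rescale_postcomp, fourierInv_postcomp]
    ext l
    simp [reC3_apply, toC3_apply]
  ext1 x
  rw [potField_apply, lineDerivOp_synth, lineDerivOp_synth, hγ, hγ, ← key, ← key, curlSymbol,
    (synth reC3).map_sub]
  rfl

theorem IsSolenoidal.exists_potential {g : 𝓢(E3, C3)} (hg : IsSolenoidal g) :
    ∃ ψ : Fin 3 → Fin 3 → 𝓢(E3, ℝ), synth reC3 g = ∑ i, ∑ j, potField i j (ψ i j) := by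
  obtain ⟨γ, rfl⟩ := hg
  refine ⟨fun i j => synth Complex.reCLM (-(Complex.I • γ i j)), ?_⟩
  simp only [map_sum, synth_curlSymbol]

/-! ### The equation on the frequency side -/

theorem memLp_fhat (v : L2) : MemLp (fhat v) 2 volume := by
  have h0 : (2 * Real.pi)⁻¹ ≠ 0 := by positivity
  set w : Lp C3 2 (volume : Measure E3) := 𝓕 (toC3.compLp v)
  have hm : AEStronglyMeasurable (fhat v) volume :=
    (Lp.aestronglyMeasurable w).comp_quasiMeasurePreserving
      (Measure.quasiMeasurePreserving_smul volume h0)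
  rw [memLp_two_iff_integrable_sq_norm hm]
  exact (integrable_comp_smul_iff volume (fun ζ => ‖w ζ‖ ^ 2) h0).2
    ((memLp_two_iff_integrable_sq_norm (Lp.aestronglyMeasurable w)).1 (Lp.memLp w))

theorem integral_norm_fhat_sq (v : L2) : ∫ ξ, ‖fhat v ξ‖ ^ 2 = (2 * Real.pi) ^ 3 * ‖v‖ ^ 2 := by
  set w : Lp C3 2 (volume : Measure E3) := 𝓕 (toC3.compLp v) with hw
  rw [← integral_dilation]
  simp only [fhat_dilation, smul_eq_mul]
  rw [integral_const_mul]
  congr 1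
  have h1 : ∫ ζ, ‖w ζ‖ ^ 2 = ‖w‖ ^ 2 := by
    have := inner_self_eq_norm_sq (𝕜 := ℂ) w
    rw [← this, L2.inner_def, ← integral_re (L2.integrable_inner (𝕜 := ℂ) w w)]
    simp only [inner_self_eq_norm_sq]
  have h2 : ‖w‖ = ‖v‖ := by
    rw [hw, Lp.norm_fourier_eq, Lp.norm_def, Lp.norm_def]
    congr 1
    refine eLpNorm_congr_norm_ae ?_
    filter_upwards [toC3.coeFn_compLp v] with x hx
    rw [hx, EuclideanSpace.norm_eq, EuclideanSpace.norm_eq]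
    simp [toC3_apply]
  rw [h1, h2]

theorem integrable_norm_fhat_mul (v : L2) (g : 𝓢(E3, C3)) :
    Integrable fun ξ => ‖fhat v ξ‖ * ‖g ξ‖ :=
  MemLp.integrable_mul (p := 2) (q := 2) (memLp_fhat v).norm (g.memLp 2 volume).norm

theorem integral_norm_fhat_mul_le (v : L2) (g : 𝓢(E3, C3)) :
    ∫ ξ, ‖fhat v ξ‖ * ‖g ξ‖ ≤ (2 * Real.pi) ^ 3 * ‖v‖ ^ 2 + ∫ ξ, ‖g ξ‖ ^ 2 := by
  have h1 : Integrable fun ξ => ‖fhat v ξ‖ ^ 2 :=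
    (memLp_two_iff_integrable_sq_norm (memLp_fhat v).1).1 (memLp_fhat v)
  have h2 : Integrable fun ξ => ‖g ξ‖ ^ 2 :=
    (memLp_two_iff_integrable_sq_norm (g.memLp 2 volume).1).1 (g.memLp 2 volume)
  rw [← integral_norm_fhat_sq, ← integral_add h1 h2]
  refine integral_mono (integrable_norm_fhat_mul v g) (h1.add h2) fun ξ => ?_
  nlinarith [sq_nonneg (‖fhat v ξ‖ - ‖g ξ‖), sq_nonneg ‖fhat v ξ‖, sq_nonneg ‖g ξ‖]

/-- The equation `∂ₜ ŵ = -κ|ξ|² ŵ + f̂ + N̂`, tested in frequency against solenoidal symbols, where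
`N` is a stress whose divergence (with the sign changed) drives the equation. -/
structure FrequencyEquation (κ : ℝ) (w₀ : L2) (w f : ℝ → L2) (N : ℝ → Stress) : Prop where
  locBdd : LocBdd w
  locBdd_force : LocBdd f
  locBdd_stress : LocBdd N
  eq : ∀ η : ℝ → ℝ, ContDiff ℝ ∞ η → HasCompactSupport η → ∀ g, IsSolenoidal g →
    -∫ s in Ioi (0 : ℝ), deriv η s * fieldPair (synth reC3 g) (w s)
      = η 0 * fieldPair (synth reC3 g) w₀ + ∫ s in Ioi (0 : ℝ), η s *
        (-fieldPair (synth reC3 (SchwartzMap.smulLeftCLM C3 (fun ξ : E3 => κ * ‖ξ‖ ^ 2) g)) (w s)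
          + (fieldPair (synth reC3 g) (f s) + gradPairFlip (synth reC3 g) (N s)))

theorem fieldPair_neg (φ : 𝓢(E3, E3)) (v : L2) : fieldPair (-φ) v = -fieldPair φ v := by
  rw [← fieldPairFlip_apply, ← fieldPairFlip_apply, (fieldPairFlip v).map_neg]

theorem fieldPair_smul (c : ℝ) (φ : 𝓢(E3, E3)) (v : L2) :
    fieldPair (c • φ) v = c * fieldPair φ v := by
  rw [← fieldPairFlip_apply, ← fieldPairFlip_apply, (fieldPairFlip v).map_smul, smul_eq_mul]

theorem fieldPair_add (φ ψ : 𝓢(E3, E3)) (v : L2) :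
    fieldPair (φ + ψ) v = fieldPair φ v + fieldPair ψ v := by
  simp only [← fieldPairFlip_apply, (fieldPairFlip v).map_add]

theorem WeakEquation.frequencyEquation {κ : ℝ} {w₀ : L2} {w f a₁ w₁ a₂ w₂ : ℝ → L2}
    {G G₁ G₂ G₁' G₂' : ℝ → Fin 3 → L2}
    (hweak : WeakEquation κ w₀ w G
      (fun t x => advect (a₁ t) (G₁ t) x - advect (a₂ t) (G₂ t) x) f)
    (hf : IsForce f) (hw : InEnergyClass w G) (ha₁ : InEnergyClass a₁ G₁')
    (hw₁ : InEnergyClass w₁ G₁) (ha₂ : InEnergyClass a₂ G₂') (hw₂ : InEnergyClass w₂ G₂) :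
    FrequencyEquation κ w₀ w f (fun t => tensor (a₁ t) (w₁ t) - tensor (a₂ t) (w₂ t)) := by
  have bN : LocBdd fun t => tensor (a₁ t) (w₁ t) - tensor (a₂ t) (w₂ t) :=
    (LocBdd.bilin tensor ha₁.memLp hw₁.memLp).sub (LocBdd.bilin tensor ha₂.memLp hw₂.memLp)
  refine ⟨hw.memLp, hf.memLp, bN, fun η hη hηc g hg => ?_⟩
  obtain ⟨ψ, hψ⟩ := hg.exists_potential
  rw [weakEquation_potField hweak hw.grad ha₁.mem_L2sigma hw₁.grad ha₂.mem_L2sigma hw₂.grad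
    hw.memLp hf.memLp bN hη hηc ψ hψ]
  have hΔ : SchwartzMap.smulLeftCLM C3 (fun ξ : E3 => κ * ‖ξ‖ ^ 2) g
      = κ • SchwartzMap.smulLeftCLM C3 (fun ξ : E3 => ‖ξ‖ ^ 2) g := by
    ext1 ξ
    rw [smul_apply, SchwartzMap.smulLeftCLM_apply_apply (by fun_prop),
      SchwartzMap.smulLeftCLM_apply_apply (by fun_prop), mul_smul]
  simp only [laplacian_synth, hΔ, (synth reC3).map_smul, fieldPair_neg, fieldPair_smul, mul_neg,
    add_assoc]

/-! ### Duhamel's formula on the frequency side -/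

/-- The Taylor polynomial `∑_{n ≤ N} yⁿ / n!` of the exponential function. -/
def expPoly (N : ℕ) (y : ℝ) : ℝ := ∑ n ∈ Finset.range (N + 1), y ^ n / n.factorial

theorem expPoly_nonneg (N : ℕ) {y : ℝ} (hy : 0 ≤ y) : 0 ≤ expPoly N y :=
  Finset.sum_nonneg fun n _ => by positivity

theorem expPoly_le_exp (N : ℕ) {y : ℝ} (hy : 0 ≤ y) : expPoly N y ≤ Real.exp y :=
  Real.sum_le_exp_of_nonneg hy _

theorem tendsto_expPoly (y : ℝ) : Tendsto (fun N => expPoly N y) atTop (𝓝 (Real.exp y)) := by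
  have h := (NormedSpace.expSeries_div_hasSum_exp y).tendsto_sum_nat
  rw [← Real.exp_eq_exp_ℝ] at h
  exact h.comp (tendsto_add_atTop_nat 1)

theorem expPoly_succ (N : ℕ) (y : ℝ) :
    expPoly (N + 1) y = expPoly N y + y ^ (N + 1) / (N + 1).factorial :=
  Finset.sum_range_succ _ _

/-- The symbol `h(ξ) g(ξ)`. -/
abbrev mulSymbol (h : E3 → ℝ) (g : 𝓢(E3, C3)) : 𝓢(E3, C3) := SchwartzMap.smulLeftCLM C3 h g

theorem hasTemperateGrowth_pow (κ : ℝ) (n : ℕ) :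
    (fun ξ : E3 => (κ * ‖ξ‖ ^ 2) ^ n).HasTemperateGrowth := by
  induction n with
  | zero => simp
  | succ n ih =>
    simp only [pow_succ _ n]
    exact ih.mul (by fun_prop)

theorem hasTemperateGrowth_expPoly (κ s : ℝ) (N : ℕ) :
    (fun ξ : E3 => expPoly N (s * (κ * ‖ξ‖ ^ 2))).HasTemperateGrowth := by
  unfold expPoly
  refine Function.HasTemperateGrowth.sum fun n _ => ?_
  have h := (Function.HasTemperateGrowth.const (E := E3) (s ^ n / n.factorial)).mul
    (hasTemperateGrowth_pow κ n)
  refine (congrArg Function.HasTemperateGrowth (funext fun ξ => ?_)).mp h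
  simp only [Pi.mul_apply]
  rw [mul_pow]
  ring

theorem mulSymbol_expPoly_zero (κ s : ℝ) (g : 𝓢(E3, C3)) :
    mulSymbol (fun ξ => expPoly 0 (s * (κ * ‖ξ‖ ^ 2))) g = g := by
  ext1 ξ
  rw [SchwartzMap.smulLeftCLM_apply_apply (hasTemperateGrowth_expPoly κ s 0)]
  simp [expPoly]

theorem mulSymbol_expPoly_succ (κ s : ℝ) (n : ℕ) (g : 𝓢(E3, C3)) :
    mulSymbol (fun ξ => expPoly (n + 1) (s * (κ * ‖ξ‖ ^ 2))) g
      = mulSymbol (fun ξ => expPoly n (s * (κ * ‖ξ‖ ^ 2))) g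
        + (s ^ (n + 1) / (n + 1).factorial) • mulSymbol (fun ξ => (κ * ‖ξ‖ ^ 2) ^ (n + 1)) g := by
  ext1 ξ
  rw [add_apply, smul_apply, SchwartzMap.smulLeftCLM_apply_apply (hasTemperateGrowth_pow κ _),
    SchwartzMap.smulLeftCLM_apply_apply (hasTemperateGrowth_expPoly κ s _),
    SchwartzMap.smulLeftCLM_apply_apply (hasTemperateGrowth_expPoly κ s _), expPoly_succ,
    smul_smul, ← add_smul, mul_pow]
  congr 1
  ring

namespace FrequencyEquation

variable {κ : ℝ} {w₀ : L2} {w f : ℝ → L2} {N : ℝ → Stress}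

/-- The action of the force and of the stress at time `s` on a symbol. -/
def source (f : ℝ → L2) (N : ℝ → Stress) (g : 𝓢(E3, C3)) (s : ℝ) : ℝ :=
  fieldPair (synth reC3 g) (f s) + gradPairFlip (synth reC3 g) (N s)

theorem source_add (g g' : 𝓢(E3, C3)) (s : ℝ) :
    source f N (g + g') s = source f N g s + source f N g' s := by
  simp only [source, (synth reC3).map_add, fieldPair_add, gradPairFlip_apply, map_add]
  ring

theorem source_smul (c : ℝ) (g : 𝓢(E3, C3)) (s : ℝ) :
    source f N (c • g) s = c * source f N g s := by
  simp only [source, (synth reC3).map_smul, fieldPair_smul, gradPairFlip_apply, map_smul,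
    smul_eq_mul]
  ring

theorem locBdd_source (h : FrequencyEquation κ w₀ w f N) (g : 𝓢(E3, C3)) :
    LocBdd (source f N g) :=
  (h.locBdd_force.clm _).add (h.locBdd_stress.clm _)

theorem locBdd_source_expPoly (h : FrequencyEquation κ w₀ w f N) (g : 𝓢(E3, C3)) (n : ℕ) :
    LocBdd fun s => source f N (mulSymbol (fun ξ => expPoly n (s * (κ * ‖ξ‖ ^ 2))) g) s := by
  induction n with
  | zero => simpa only [mulSymbol_expPoly_zero] using h.locBdd_source g
  | succ n ih =>
    simp only [mulSymbol_expPoly_succ, source_add, source_smul]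
    exact ih.add ((h.locBdd_source _).continuous_smul
      (c := fun s => s ^ (n + 1) / (n + 1).factorial) (by fun_prop))

/-- The equation multiplied by a function `P` of time and integrated over `(0, t)`. -/
theorem mul_fieldPair_eq (h : FrequencyEquation κ w₀ w f N) {t : ℝ} (ht : 0 < t)
    (hgood : ∀ φ, IsLeftLebesguePt t fun s => fieldPair φ (w s)) {g : 𝓢(E3, C3)}
    (hg : IsSolenoidal g) {P : ℝ → ℝ} (hP : ContDiff ℝ ∞ P) :
    P t * fieldPair (synth reC3 g) (w t) = P 0 * fieldPair (synth reC3 g) w₀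
      + ∫ s in Ioo 0 t, (deriv P s * fieldPair (synth reC3 g) (w s)
        + P s * (-fieldPair (synth reC3 (mulSymbol (fun ξ => κ * ‖ξ‖ ^ 2) g)) (w s)
          + source f N g s)) :=
  mul_eq_of_weak_deriv (h.locBdd.clm _)
    ((h.locBdd.clm (-fieldPair _)).add (h.locBdd_source g))
    (fun η hη hηc => h.eq η hη hηc g hg) ht (hgood _) hP

/-- Duhamel's formula with the propagator `e^{(s-t)κ|ξ|²}` replaced by a Taylor polynomial. It
comes from the product formula for `sⁿ/n!` and the symbols `(κ|ξ|²)ⁿ g`, in which the sum over `n`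
telescopes. -/
theorem expPoly_eq (h : FrequencyEquation κ w₀ w f N) {t : ℝ} (ht : 0 < t)
    (hgood : ∀ φ, IsLeftLebesguePt t fun s => fieldPair φ (w s)) {g : 𝓢(E3, C3)}
    (hg : IsSolenoidal g) (n : ℕ) :
    fieldPair (synth reC3 (mulSymbol (fun ξ => expPoly n (t * (κ * ‖ξ‖ ^ 2))) g)) (w t)
      = fieldPair (synth reC3 g) w₀
        + ∫ s in Ioo 0 t, (-(s ^ n / n.factorial) *
            fieldPair (synth reC3 (mulSymbol (fun ξ => (κ * ‖ξ‖ ^ 2) ^ (n + 1)) g)) (w s)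
          + source f N (mulSymbol (fun ξ => expPoly n (s * (κ * ‖ξ‖ ^ 2))) g) s) := by
  induction n with
  | zero =>
    have h0 := h.mul_fieldPair_eq ht hgood hg (P := fun _ => 1) contDiff_const
    simp only [mulSymbol_expPoly_zero, zero_add, pow_one, pow_zero, Nat.factorial_zero,
      Nat.cast_one, div_one]
    simpa using h0
  | succ n ih =>
    set P : ℝ → ℝ := fun s => s ^ (n + 1) / (n + 1).factorial with hP
    have hPc : ContDiff ℝ ∞ P := by fun_prop
    have hPd : ∀ s, deriv P s = s ^ n / n.factorial := by
      intro s
      simp only [hP, deriv_div_const, deriv_pow_field, Nat.factorial_succ]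
      have : (n.factorial : ℝ) ≠ 0 := by positivity
      push_cast
      field_simp
    have hT := hasTemperateGrowth_pow κ (n + 1)
    set gn := mulSymbol (fun ξ => (κ * ‖ξ‖ ^ 2) ^ (n + 1)) g with hgn
    have h0 := h.mul_fieldPair_eq ht hgood (g := gn) (hg.smulLeft hT) hPc
    have hsucc : mulSymbol (fun ξ => κ * ‖ξ‖ ^ 2) gn
        = mulSymbol (fun ξ => (κ * ‖ξ‖ ^ 2) ^ (n + 1 + 1)) g := by
      ext1 ξ
      rw [SchwartzMap.smulLeftCLM_apply_apply (by fun_prop), hgn,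
        SchwartzMap.smulLeftCLM_apply_apply hT,
        SchwartzMap.smulLeftCLM_apply_apply (hasTemperateGrowth_pow κ _), smul_smul,
        pow_succ' _ (n + 1)]
    have hadd : ∀ s : ℝ, mulSymbol (fun ξ => expPoly (n + 1) (s * (κ * ‖ξ‖ ^ 2))) g
        = mulSymbol (fun ξ => expPoly n (s * (κ * ‖ξ‖ ^ 2))) g + P s • gn := fun s =>
      mulSymbol_expPoly_succ κ s n g
    have hP0 : P 0 = 0 := by simp [hP]
    rw [hsucc, hP0, zero_mul, zero_add] at h0
    set gs := mulSymbol (fun ξ => (κ * ‖ξ‖ ^ 2) ^ (n + 1 + 1)) g with hgs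
    have hPcont : Continuous P := hPc.continuous
    have b1 : LocBdd fun s => -(s ^ n / n.factorial) * fieldPair (synth reC3 gn) (w s) :=
      (h.locBdd.clm (fieldPair (synth reC3 gn))).continuous_smul
        (c := fun s => -(s ^ n / n.factorial)) (by fun_prop)
    have b2 := h.locBdd_source_expPoly g n
    have b3 : LocBdd fun s => deriv P s * fieldPair (synth reC3 gn) (w s)
        + P s * (-fieldPair (synth reC3 gs) (w s) + source f N gn s) := by
      simp only [hPd]
      exact ((h.locBdd.clm (fieldPair (synth reC3 gn))).continuous_smul
        (c := fun s => (s ^ n / n.factorial)) (by fun_prop)).add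
        (((h.locBdd.clm (-fieldPair (synth reC3 gs))).add
          (h.locBdd_source gn)).continuous_smul hPcont)
    rw [hadd, (synth reC3).map_add, (synth reC3).map_smul, fieldPair_add, fieldPair_smul, ih, h0,
      add_assoc, ← integral_add ((b1.add b2).integrableOn t) (b3.integrableOn t)]
    congr 1
    refine integral_congr_ae (.of_forall fun s => ?_)
    simp only [hadd, source_add, source_smul, hPd]
    simp only [hP]
    ring

theorem abs_fieldPair_synth_pow_le {g : 𝓢(E3, C3)} (hκ : 0 ≤ κ) {a : ℝ}
    (hga : ∀ ξ, g ξ ≠ 0 → κ * ‖ξ‖ ^ 2 ≤ a) (n : ℕ) (v : L2) :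
    |fieldPair (synth reC3 (mulSymbol (fun ξ => (κ * ‖ξ‖ ^ 2) ^ n) g)) v|
      ≤ a ^ n * ∫ ξ, ‖fhat v ξ‖ * ‖g ξ‖ := by
  rw [fieldPair_synth, ← Real.norm_eq_abs, ← integral_const_mul]
  refine norm_integral_le_of_norm_le ((integrable_norm_fhat_mul v g).const_mul _)
    (.of_forall fun ξ => ?_)
  rw [SchwartzMap.smulLeftCLM_apply_apply (hasTemperateGrowth_pow κ n)]
  rcases eq_or_ne (g ξ) 0 with h0 | h0
  · simp [h0]
  · calc ‖(inner ℂ (fhat v ξ) ((κ * ‖ξ‖ ^ 2) ^ n • g ξ) : ℂ).re‖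
        ≤ ‖fhat v ξ‖ * ‖(κ * ‖ξ‖ ^ 2) ^ n • g ξ‖ :=
          (Complex.abs_re_le_norm _).trans (norm_inner_le_norm (𝕜 := ℂ) _ _)
      _ = (κ * ‖ξ‖ ^ 2) ^ n * (‖fhat v ξ‖ * ‖g ξ‖) := by
          rw [norm_smul, Real.norm_of_nonneg (by positivity)]
          ring
      _ ≤ a ^ n * (‖fhat v ξ‖ * ‖g ξ‖) := by
          gcongr
          exact hga ξ h0

/-- The remainder in Duhamel's formula vanishes in the limit, for symbols supported in a bounded
set. -/
theorem tendsto_integral_source (h : FrequencyEquation κ w₀ w f N) {t : ℝ} (ht : 0 < t)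
    (hgood : ∀ φ, IsLeftLebesguePt t fun s => fieldPair φ (w s)) {g : 𝓢(E3, C3)}
    (hg : IsSolenoidal g) (hκ : 0 ≤ κ) {a : ℝ} (ha : 0 ≤ a)
    (hga : ∀ ξ, g ξ ≠ 0 → κ * ‖ξ‖ ^ 2 ≤ a) :
    Tendsto (fun n => ∫ s in Ioo 0 t,
        source f N (mulSymbol (fun ξ => expPoly n (s * (κ * ‖ξ‖ ^ 2))) g) s) atTop
      (𝓝 ((∫ ξ, (inner ℂ (fhat (w t) ξ) (Real.exp (t * (κ * ‖ξ‖ ^ 2)) • g ξ) : ℂ).re)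
        - ∫ ξ, (inner ℂ (fhat w₀ ξ) (g ξ) : ℂ).re)) := by
  set r : ℕ → ℝ → ℝ := fun n s => s ^ n / n.factorial *
    fieldPair (synth reC3 (mulSymbol (fun ξ => (κ * ‖ξ‖ ^ 2) ^ (n + 1)) g)) (w s) with hr
  have br : ∀ n, LocBdd (r n) := fun n =>
    (h.locBdd.clm (fieldPair _)).continuous_smul (c := fun s => s ^ n / n.factorial) (by fun_prop)
  have heq : ∀ n, ∫ s in Ioo 0 t,
        source f N (mulSymbol (fun ξ => expPoly n (s * (κ * ‖ξ‖ ^ 2))) g) s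
      = (∫ ξ, (inner ℂ (fhat (w t) ξ) (expPoly n (t * (κ * ‖ξ‖ ^ 2)) • g ξ) : ℂ).re)
        - (∫ ξ, (inner ℂ (fhat w₀ ξ) (g ξ) : ℂ).re) + ∫ s in Ioo 0 t, r n s := by
    intro n
    have h1 := h.expPoly_eq ht hgood hg n
    have h2 : ∫ s in Ioo 0 t, (-(s ^ n / n.factorial) *
            fieldPair (synth reC3 (mulSymbol (fun ξ => (κ * ‖ξ‖ ^ 2) ^ (n + 1)) g)) (w s)
          + source f N (mulSymbol (fun ξ => expPoly n (s * (κ * ‖ξ‖ ^ 2))) g) s)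
        = (∫ s in Ioo 0 t, source f N (mulSymbol (fun ξ => expPoly n (s * (κ * ‖ξ‖ ^ 2))) g) s)
          - ∫ s in Ioo 0 t, r n s := by
      rw [← integral_sub ((h.locBdd_source_expPoly g n).integrableOn t) ((br n).integrableOn t)]
      refine integral_congr_ae (.of_forall fun s => ?_)
      simp only [hr]
      ring
    rw [h2, fieldPair_synth, fieldPair_synth] at h1
    simp only [SchwartzMap.smulLeftCLM_apply_apply (hasTemperateGrowth_expPoly κ t n)] at h1
    linarith
  have hlim1 : Tendsto (fun n => ∫ ξ, (inner ℂ (fhat (w t) ξ)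
      (expPoly n (t * (κ * ‖ξ‖ ^ 2)) • g ξ) : ℂ).re) atTop
      (𝓝 (∫ ξ, (inner ℂ (fhat (w t) ξ) (Real.exp (t * (κ * ‖ξ‖ ^ 2)) • g ξ) : ℂ).re)) := by
    refine tendsto_integral_of_dominated_convergence
      (fun ξ => Real.exp (t * a) * (‖fhat (w t) ξ‖ * ‖g ξ‖)) (fun n => ?_)
      ((integrable_norm_fhat_mul (w t) g).const_mul _) (fun n => .of_forall fun ξ => ?_)
      (.of_forall fun ξ => ?_)
    · have hm := (memLp_fhat (w t)).1
      have hc : Continuous fun ξ : E3 => expPoly n (t * (κ * ‖ξ‖ ^ 2)) • g ξ := by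
        have := g.continuous
        unfold expPoly
        fun_prop
      exact Complex.continuous_re.comp_aestronglyMeasurable
        (hm.inner hc.aestronglyMeasurable)
    · rcases eq_or_ne (g ξ) 0 with h0 | h0
      · simp [h0]
      · have hy : 0 ≤ t * (κ * ‖ξ‖ ^ 2) := by positivity
        calc ‖(inner ℂ (fhat (w t) ξ) (expPoly n (t * (κ * ‖ξ‖ ^ 2)) • g ξ) : ℂ).re‖
            ≤ ‖fhat (w t) ξ‖ * ‖expPoly n (t * (κ * ‖ξ‖ ^ 2)) • g ξ‖ :=
              (Complex.abs_re_le_norm _).trans (norm_inner_le_norm (𝕜 := ℂ) _ _)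
          _ = expPoly n (t * (κ * ‖ξ‖ ^ 2)) * (‖fhat (w t) ξ‖ * ‖g ξ‖) := by
              rw [norm_smul, Real.norm_of_nonneg (expPoly_nonneg n hy)]
              ring
          _ ≤ Real.exp (t * a) * (‖fhat (w t) ξ‖ * ‖g ξ‖) := by
              gcongr
              refine (expPoly_le_exp n hy).trans (Real.exp_le_exp.2 ?_)
              gcongr
              exact hga ξ h0
    · have hc : Continuous fun c : ℝ => (inner ℂ (fhat (w t) ξ) (c • g ξ) : ℂ).re := by fun_prop
      exact (hc.tendsto _).comp (tendsto_expPoly _)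
  have hlim2 : Tendsto (fun n => ∫ s in Ioo 0 t, r n s) atTop (𝓝 0) := by
    set C := (eLpNorm w ∞ (volume.restrict (Ioo 0 t))).toReal with hC
    have hwC : ∀ᵐ s ∂volume.restrict (Ioo 0 t), ‖w s‖ ≤ C := by
      have h1 := ae_le_eLpNormEssSup (f := w) (μ := volume.restrict (Ioo 0 t))
      filter_upwards [h1] with s hs
      rw [← eLpNorm_exponent_top] at hs
      exact (toReal_enorm (w s)).symm.le.trans
        (ENNReal.toReal_mono (h.locBdd t ht).2.ne hs)
    set D := (2 * Real.pi) ^ 3 * C ^ 2 + ∫ ξ, ‖g ξ‖ ^ 2 with hD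
    have hbound : ∀ n, ‖∫ s in Ioo 0 t, r n s‖ ≤ (t * a) ^ n / n.factorial * (a * D * t) := by
      intro n
      have hc := norm_setIntegral_le_of_norm_le_const_ae (s := Ioo 0 t) (f := r n)
        (C := t ^ n / n.factorial * (a ^ (n + 1) * D)) (μ := volume) (by simp) ?_
      · refine hc.trans_eq ?_
        rw [Real.volume_real_Ioo_of_le ht.le, mul_pow]
        ring
      · filter_upwards [hwC, ae_restrict_mem measurableSet_Ioo] with s hs hst
        simp only [hr]
        rw [norm_mul, Real.norm_of_nonneg (by have := hst.1; positivity)]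
        have h1 := abs_fieldPair_synth_pow_le hκ hga (n + 1) (w s)
        have h2 : ∫ ξ, ‖fhat (w s) ξ‖ * ‖g ξ‖ ≤ D := by
          refine (integral_norm_fhat_mul_le (w s) g).trans ?_
          rw [hD]
          gcongr
        refine mul_le_mul ?_ (h1.trans (by gcongr)) (norm_nonneg _) (by positivity)
        have := hst.1.le
        have := hst.2.le
        gcongr
    refine squeeze_zero_norm hbound ?_
    simpa using (FloorSemiring.tendsto_pow_div_factorial_atTop (t * a)).mul_const (a * D * t)
  simp only [heq]
  simpa using (hlim1.sub_const _).add hlim2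

end FrequencyEquation

/-! ### Decay of the heat propagator on the support of the cutoff -/

/-- The symbol `e^{-tκ|ξ|²} χ(ξ)`. -/
def heatCutoff (χ : E3 → ℝ) (κ t : ℝ) (ξ : E3) : ℝ := Real.exp (-(t * (κ * ‖ξ‖ ^ 2))) * χ ξ

theorem hasTemperateGrowth_heatCutoff {χ : E3 → ℝ} (hχ : ContDiff ℝ ∞ χ)
    (hχc : HasCompactSupport χ) (κ t : ℝ) : (heatCutoff χ κ t).HasTemperateGrowth := by
  have h1 : HasCompactSupport (heatCutoff χ κ t) := hχc.mul_left
  refine h1.hasTemperateGrowth ?_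
  exact ((contDiff_const.mul (contDiff_const.mul (contDiff_norm_sq ℝ))).neg.exp).mul hχ

theorem mul_exp_le {χ : E3 → ℝ} {κ c : ℝ} {ξ : E3} (hχ : 0 ≤ χ ξ)
    (hc : χ ξ ≠ 0 → c ≤ κ * ‖ξ‖ ^ 2) {r : ℝ} (hr : 0 ≤ r) :
    Real.exp (-(r * (κ * ‖ξ‖ ^ 2))) * χ ξ ≤ Real.exp (-(c * r)) * χ ξ := by
  rcases eq_or_ne (χ ξ) 0 with h0 | h0
  · simp [h0]
  · refine mul_le_mul_of_nonneg_right (Real.exp_le_exp.2 ?_) hχ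
    linarith [mul_le_mul_of_nonneg_right (hc h0) hr]

/-- The bound for the action of the force and of the stress in Duhamel's formula. -/
theorem FrequencyEquation.source_le {f : ℝ → L2} {N : ℝ → Stress} {χ : E3 → ℝ}
    (hχ : ContDiff ℝ ∞ χ) (hχc : HasCompactSupport χ) (hχ0 : ∀ ξ, 0 ≤ χ ξ) {κ c : ℝ}
    (hκ : 0 ≤ κ) (hc : ∀ ξ, χ ξ ≠ 0 → c ≤ κ * ‖ξ‖ ^ 2) {s t E : ℝ} (hs : 0 ≤ s) (hst : s ≤ t)
    (hE : 0 ≤ E)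
    (hN : ∀ g, |gradPairFlip (synth reC3 g) (N s)| ≤ E * ∫ ξ, ‖ξ‖ * ‖g ξ‖) (g : 𝓢(E3, C3))
    (n : ℕ) :
    FrequencyEquation.source f N (mulSymbol (fun ξ => expPoly n (s * (κ * ‖ξ‖ ^ 2)))
        (mulSymbol (heatCutoff χ κ t) g)) s
      ≤ Real.exp (-(c * (t - s))) * ((∫ ξ, ‖fhat (f s) ξ‖ * ‖χ ξ • g ξ‖)
        + E * ∫ ξ, ‖ξ‖ * ‖χ ξ • g ξ‖) := by
  set G := mulSymbol (fun ξ => expPoly n (s * (κ * ‖ξ‖ ^ 2)))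
    (mulSymbol (heatCutoff χ κ t) g) with hG
  have hχT := hχc.hasTemperateGrowth hχ
  have hGle : ∀ ξ, ‖G ξ‖ ≤ Real.exp (-(c * (t - s))) * ‖χ ξ • g ξ‖ := by
    intro ξ
    have hy : 0 ≤ s * (κ * ‖ξ‖ ^ 2) := by positivity
    rw [hG, SchwartzMap.smulLeftCLM_apply_apply (hasTemperateGrowth_expPoly κ s n),
      SchwartzMap.smulLeftCLM_apply_apply (hasTemperateGrowth_heatCutoff hχ hχc κ t), norm_smul,
      norm_smul, norm_smul, heatCutoff, Real.norm_of_nonneg (expPoly_nonneg n hy),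
      Real.norm_of_nonneg (hχ0 ξ), Real.norm_of_nonneg (mul_nonneg (Real.exp_pos _).le (hχ0 ξ))]
    have h1 : expPoly n (s * (κ * ‖ξ‖ ^ 2)) * Real.exp (-(t * (κ * ‖ξ‖ ^ 2)))
        ≤ Real.exp (-((t - s) * (κ * ‖ξ‖ ^ 2))) :=
      calc expPoly n (s * (κ * ‖ξ‖ ^ 2)) * Real.exp (-(t * (κ * ‖ξ‖ ^ 2)))
          ≤ Real.exp (s * (κ * ‖ξ‖ ^ 2)) * Real.exp (-(t * (κ * ‖ξ‖ ^ 2))) := by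
            gcongr
            exact expPoly_le_exp n hy
        _ = Real.exp (-((t - s) * (κ * ‖ξ‖ ^ 2))) := by
            rw [← Real.exp_add]
            ring_nf
    have h2 := (mul_le_mul_of_nonneg_right h1 (hχ0 ξ)).trans
      (mul_exp_le (hχ0 ξ) (hc ξ) (sub_nonneg.2 hst))
    have h3 := mul_le_mul_of_nonneg_right h2 (norm_nonneg (g ξ))
    simp only [mul_assoc] at h3 ⊢
    exact h3
  have hχg : ∀ ξ, χ ξ • g ξ = mulSymbol χ g ξ := fun ξ =>
    (SchwartzMap.smulLeftCLM_apply_apply hχT g ξ).symm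
  have i1 : Integrable fun ξ => ‖fhat (f s) ξ‖ * ‖χ ξ • g ξ‖ := by
    simp only [hχg]
    exact integrable_norm_fhat_mul _ _
  have i2 : Integrable fun ξ => ‖ξ‖ * ‖χ ξ • g ξ‖ := by
    simp only [hχg]
    simpa using (mulSymbol χ g).integrable_pow_mul volume 1
  have h1 : fieldPair (synth reC3 G) (f s)
      ≤ Real.exp (-(c * (t - s))) * ∫ ξ, ‖fhat (f s) ξ‖ * ‖χ ξ • g ξ‖ := by
    rw [fieldPair_synth, ← integral_const_mul]
    refine (Real.le_norm_self _).trans (norm_integral_le_of_norm_le (i1.const_mul _)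
      (.of_forall fun ξ => ?_))
    refine (Complex.abs_re_le_norm _).trans ((norm_inner_le_norm (𝕜 := ℂ) _ _).trans ?_)
    refine (mul_le_mul_of_nonneg_left (hGle ξ) (norm_nonneg _)).trans_eq ?_
    ring
  have h2 : ∫ ξ, ‖ξ‖ * ‖G ξ‖ ≤ Real.exp (-(c * (t - s))) * ∫ ξ, ‖ξ‖ * ‖χ ξ • g ξ‖ := by
    rw [← integral_const_mul]
    have i3 : Integrable fun ξ => ‖ξ‖ * ‖G ξ‖ := by
      simpa using G.integrable_pow_mul volume 1
    refine integral_mono i3 (i2.const_mul _) fun ξ => ?_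
    refine (mul_le_mul_of_nonneg_left (hGle ξ) (norm_nonneg _)).trans_eq ?_
    ring
  have h3 := (le_abs_self _).trans ((hN G).trans (mul_le_mul_of_nonneg_left h2 hE))
  rw [FrequencyEquation.source]
  linarith

theorem integral_exp_neg_mul_sub {c : ℝ} (hc : 0 < c) {t : ℝ} (ht : 0 < t) :
    ∫ s in Ioo 0 t, Real.exp (-(c * (t - s))) = (1 - Real.exp (-(c * t))) / c := by
  rw [← integral_Ioc_eq_integral_Ioo, ← intervalIntegral.integral_of_le ht.le]
  have hd : ∀ s ∈ uIcc 0 t, HasDerivAt (fun s => Real.exp (-(c * (t - s))) / c)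
      (Real.exp (-(c * (t - s)))) s := by
    intro s _
    have h1 : HasDerivAt (fun s => -(c * (t - s))) c s := by
      have := (((hasDerivAt_id s).const_sub t).const_mul c).fun_neg
      simpa using this
    have h2 := (h1.exp).div_const c
    rwa [mul_div_cancel_right₀ _ hc.ne'] at h2
  rw [intervalIntegral.integral_eq_sub_of_hasDerivAt hd
    (Continuous.intervalIntegrable (by fun_prop) _ _)]
  simp
  ring

/-- Duhamel's formula for a pair of equations, estimated with the decay rate `c` of the heat
propagators on the support of the cutoff. -/
theorem FrequencyEquation.pair_le {κ₁ κ₂ : ℝ} {u₀ b₀ : L2} {u b f₁ f₂ : ℝ → L2}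
    {N₁ N₂ : ℝ → Stress} (h₁ : FrequencyEquation κ₁ u₀ u f₁ N₁)
    (h₂ : FrequencyEquation κ₂ b₀ b f₂ N₂) (hκ₁ : 0 ≤ κ₁) (hκ₂ : 0 ≤ κ₂) {t : ℝ} (ht : 0 < t)
    (hgood₁ : ∀ φ, IsLeftLebesguePt t fun s => fieldPair φ (u s))
    (hgood₂ : ∀ φ, IsLeftLebesguePt t fun s => fieldPair φ (b s)) {χ : E3 → ℝ}
    (hχ : ContDiff ℝ ∞ χ) (hχc : HasCompactSupport χ) (hχ0 : ∀ ξ, 0 ≤ χ ξ) {a c : ℝ}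
    (hc0 : 0 < c) (hc₁ : ∀ ξ, χ ξ ≠ 0 → c ≤ κ₁ * ‖ξ‖ ^ 2) (hc₂ : ∀ ξ, χ ξ ≠ 0 → c ≤ κ₂ * ‖ξ‖ ^ 2)
    (ha : 0 ≤ a) (ha₁ : ∀ ξ, χ ξ ≠ 0 → κ₁ * ‖ξ‖ ^ 2 ≤ a) (ha₂ : ∀ ξ, χ ξ ≠ 0 → κ₂ * ‖ξ‖ ^ 2 ≤ a)
    {E : ℝ → ℝ} (hE : ∀ s > 0, 0 ≤ E s)
    (hN₁ : ∀ s > 0, ∀ g, |gradPairFlip (synth reC3 g) (N₁ s)| ≤ E s * ∫ ξ, ‖ξ‖ * ‖g ξ‖)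
    (hN₂ : ∀ s > 0, ∀ g, |gradPairFlip (synth reC3 g) (N₂ s)| ≤ E s * ∫ ξ, ‖ξ‖ * ‖g ξ‖)
    {g₁ g₂ : 𝓢(E3, C3)} (hg₁ : IsSolenoidal g₁) (hg₂ : IsSolenoidal g₂) {B₀ B : ℝ}
    (hB₀ : (∫ ξ, ‖fhat u₀ ξ‖ * ‖χ ξ • g₁ ξ‖) + ∫ ξ, ‖fhat b₀ ξ‖ * ‖χ ξ • g₂ ξ‖ ≤ B₀)
    (hB : ∀ᵐ s ∂volume.restrict (Ioo 0 t),
      ((∫ ξ, ‖fhat (f₁ s) ξ‖ * ‖χ ξ • g₁ ξ‖) + ∫ ξ, ‖fhat (f₂ s) ξ‖ * ‖χ ξ • g₂ ξ‖)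
        + E s * ((∫ ξ, ‖ξ‖ * ‖χ ξ • g₁ ξ‖) + ∫ ξ, ‖ξ‖ * ‖χ ξ • g₂ ξ‖) ≤ B) :
    (∫ ξ, (inner ℂ (fhat (u t) ξ) (χ ξ • g₁ ξ) : ℂ).re)
        + ∫ ξ, (inner ℂ (fhat (b t) ξ) (χ ξ • g₂ ξ) : ℂ).re
      ≤ Real.exp (-(c * t)) * B₀ + B * ((1 - Real.exp (-(c * t))) / c) := by
  have hχT := hχc.hasTemperateGrowth hχ
  have hT := hasTemperateGrowth_heatCutoff hχ hχc
  have hsupp : ∀ {κ : ℝ} {g : 𝓢(E3, C3)}, (∀ ξ, χ ξ ≠ 0 → κ * ‖ξ‖ ^ 2 ≤ a) →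
      ∀ ξ, mulSymbol (heatCutoff χ κ t) g ξ ≠ 0 → κ * ‖ξ‖ ^ 2 ≤ a := by
    intro κ g h ξ hξ
    refine h ξ fun h0 => hξ ?_
    rw [SchwartzMap.smulLeftCLM_apply_apply (hT κ t)]
    simp [heatCutoff, h0]
  have hexp : ∀ (κ : ℝ) (g : 𝓢(E3, C3)) (ξ : E3), Real.exp (t * (κ * ‖ξ‖ ^ 2)) •
      mulSymbol (heatCutoff χ κ t) g ξ = χ ξ • g ξ := by
    intro κ g ξ
    rw [SchwartzMap.smulLeftCLM_apply_apply (hT κ t), heatCutoff, smul_smul, ← mul_assoc,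
      ← Real.exp_add, add_neg_cancel, Real.exp_zero, one_mul]
  have l₁ := h₁.tendsto_integral_source ht hgood₁ (hg₁.smulLeft (hT κ₁ t)) hκ₁ ha (hsupp ha₁)
  have l₂ := h₂.tendsto_integral_source ht hgood₂ (hg₂.smulLeft (hT κ₂ t)) hκ₂ ha (hsupp ha₂)
  simp only [hexp] at l₁ l₂
  have hle := le_of_tendsto' (l₁.add l₂) (b := B * ((1 - Real.exp (-(c * t))) / c)) ?_
  · have hinit : ∀ {κ : ℝ} (v : L2) (g : 𝓢(E3, C3)), (∀ ξ, χ ξ ≠ 0 → c ≤ κ * ‖ξ‖ ^ 2) →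
        ∫ ξ, (inner ℂ (fhat v ξ) (mulSymbol (heatCutoff χ κ t) g ξ) : ℂ).re
          ≤ Real.exp (-(c * t)) * ∫ ξ, ‖fhat v ξ‖ * ‖χ ξ • g ξ‖ := by
      intro κ v g hcκ
      have i1 : Integrable fun ξ => ‖fhat v ξ‖ * ‖χ ξ • g ξ‖ := by
        have h := integrable_norm_fhat_mul v (mulSymbol χ g)
        simpa only [SchwartzMap.smulLeftCLM_apply_apply hχT] using h
      rw [← integral_const_mul]
      refine (Real.le_norm_self _).trans (norm_integral_le_of_norm_le (i1.const_mul _)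
        (.of_forall fun ξ => ?_))
      refine (Complex.abs_re_le_norm _).trans ((norm_inner_le_norm (𝕜 := ℂ) _ _).trans ?_)
      rw [SchwartzMap.smulLeftCLM_apply_apply (hT κ t), norm_smul, norm_smul, heatCutoff,
        Real.norm_of_nonneg (hχ0 ξ), Real.norm_of_nonneg (mul_nonneg (Real.exp_pos _).le (hχ0 ξ))]
      have := mul_le_mul_of_nonneg_right (mul_exp_le (hχ0 ξ) (hcκ ξ) ht.le) (norm_nonneg (g ξ))
      refine (mul_le_mul_of_nonneg_left this (norm_nonneg _)).trans_eq ?_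
      ring
    have e1 := hinit u₀ g₁ hc₁
    have e2 := hinit b₀ g₂ hc₂
    have e3 := mul_le_mul_of_nonneg_left hB₀ (Real.exp_pos (-(c * t))).le
    linarith
  · intro n
    rw [← integral_exp_neg_mul_sub hc0 ht, ← integral_const_mul, ← integral_add
      ((h₁.locBdd_source_expPoly _ n).integrableOn t)
      ((h₂.locBdd_source_expPoly _ n).integrableOn t)]
    refine integral_mono_ae (((h₁.locBdd_source_expPoly _ n).integrableOn t).add
      ((h₂.locBdd_source_expPoly _ n).integrableOn t)) ?_ ?_
    · exact ((Continuous.integrableOn_Icc (by fun_prop)).mono_set Ioo_subset_Icc_self)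
    · filter_upwards [hB, ae_restrict_mem measurableSet_Ioo] with s hs hst
      have e1 := source_le (f := f₁) hχ hχc hχ0 hκ₁ hc₁ hst.1.le hst.2.le (hE s hst.1)
        (hN₁ s hst.1) g₁ n
      have e2 := source_le (f := f₂) hχ hχc hχ0 hκ₂ hc₂ hst.1.le hst.2.le (hE s hst.1)
        (hN₂ s hst.1) g₂ n
      have e3 := mul_le_mul_of_nonneg_left hs (Real.exp_pos (-(c * (t - s)))).le
      refine (add_le_add e1 e2).trans ?_
      linarith

/-! ### The frequency cube -/

/-- The cube with centre `k` and side `2δ`. -/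
def cube (k : E3) (δ : ℝ) : Set E3 := {ξ | ∀ i, |ξ i - k i| ≤ δ}

theorem cube_eq_preimage (k : E3) (δ : ℝ) :
    cube k δ = WithLp.ofLp ⁻¹' Icc (fun i => k i - δ) (fun i => k i + δ) := by
  ext ξ
  simp only [cube, mem_ofPred_eq, mem_preimage, mem_Icc, Pi.le_def, abs_le]
  constructor
  · exact fun h => ⟨fun i => by linarith [(h i).1], fun i => by linarith [(h i).2]⟩
  · exact fun h i => ⟨by linarith [h.1 i], by linarith [h.2 i]⟩

theorem measurableSet_cube (k : E3) (δ : ℝ) : MeasurableSet (cube k δ) := by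
  rw [cube_eq_preimage]
  exact (PiLp.volume_preserving_ofLp (Fin 3)).measurable measurableSet_Icc

theorem volume_cube (k : E3) {δ : ℝ} (hδ : 0 < δ) :
    volume (cube k δ) = ENNReal.ofReal ((2 * δ) ^ 3) := by
  rw [cube_eq_preimage, (PiLp.volume_preserving_ofLp (Fin 3)).measure_preimage
    measurableSet_Icc.nullMeasurableSet, Real.volume_Icc_pi]
  have : ∀ i : Fin 3, k i + δ - (k i - δ) = 2 * δ := fun i => by ring
  simp only [this, Finset.prod_const, Finset.card_univ, Fintype.card_fin]
  rw [ENNReal.ofReal_pow (by positivity)]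

theorem norm_sub_le_of_mem_cube {k ξ : E3} {δ : ℝ} (hδ : 0 < δ) (h : ξ ∈ cube k δ) :
    ‖ξ - k‖ ≤ √3 * δ := by
  rw [EuclideanSpace.norm_eq]
  refine Real.sqrt_le_iff.2 ⟨by positivity, ?_⟩
  calc ∑ i, ‖(ξ - k) i‖ ^ 2 ≤ ∑ _i : Fin 3, δ ^ 2 := by
        refine Finset.sum_le_sum fun i _ => ?_
        rw [Real.norm_eq_abs]
        exact pow_le_pow_left₀ (abs_nonneg _) (h i) 2
    _ = (√3 * δ) ^ 2 := by
        rw [mul_pow, Real.sq_sqrt (by norm_num)]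
        simp

theorem norm_bounds_of_mem_cube {k ξ : E3} {δ : ℝ} (hδ : 0 < δ) (hδk : δ < ‖k‖ / (2 * √3))
    (h : ξ ∈ cube k δ) : ‖k‖ / 2 ≤ ‖ξ‖ ∧ ‖ξ‖ ≤ 3 / 2 * ‖k‖ := by
  have h1 := norm_sub_le_of_mem_cube hδ h
  have h3 : (0 : ℝ) < √3 := by positivity
  rw [lt_div_iff₀ (by positivity)] at hδk
  have h4 := norm_sub_norm_le ξ k
  have h5 := norm_sub_norm_le k ξ
  rw [norm_sub_rev] at h5
  constructor <;> nlinarith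

namespace IsCubeCutoff

variable {k : E3} {δ : ℝ} {χ : E3 → ℝ}

theorem mem_cube (hχ : IsCubeCutoff k δ χ) {ξ : E3} (h : χ ξ ≠ 0) : ξ ∈ cube k δ :=
  hχ.support_subset (subset_tsupport _ h)

theorem eq_zero (hχ : IsCubeCutoff k δ χ) {ξ : E3} (h : ξ ∉ cube k δ) : χ ξ = 0 := by
  by_contra h0
  exact h (hχ.mem_cube h0)

theorem nonneg (hχ : IsCubeCutoff k δ χ) (ξ : E3) : 0 ≤ χ ξ := (hχ.mem_Icc ξ).1

theorem le_one (hχ : IsCubeCutoff k δ χ) (ξ : E3) : χ ξ ≤ 1 := (hχ.mem_Icc ξ).2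

theorem hasCompactSupport (hχ : IsCubeCutoff k δ χ) (hδ : 0 < δ) : HasCompactSupport χ :=
  HasCompactSupport.intro (isCompact_closedBall k (√3 * δ)) fun ξ h => by
    by_contra h0
    refine h ?_
    rw [mem_closedBall_iff_norm]
    exact norm_sub_le_of_mem_cube hδ (hχ.mem_cube h0)

theorem ofReal_integral_fhat (hχ : IsCubeCutoff k δ χ) (hδ : 0 < δ) (v : L2) (g : 𝓢(E3, C3)) :
    ENNReal.ofReal (∫ ξ, ‖fhat v ξ‖ * ‖χ ξ • g ξ‖)
      = ∫⁻ ξ in cube k δ, ‖χ ξ • fhat v ξ‖ₑ * ‖g ξ‖ₑ := by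
  have hT := (hχ.hasCompactSupport hδ).hasTemperateGrowth hχ.smooth
  have hint : Integrable fun ξ => ‖fhat v ξ‖ * ‖χ ξ • g ξ‖ := by
    simpa only [SchwartzMap.smulLeftCLM_apply_apply hT] using
      integrable_norm_fhat_mul v (mulSymbol χ g)
  rw [ofReal_integral_eq_lintegral_ofReal hint (.of_forall fun ξ => by positivity),
    ← lintegral_indicator (measurableSet_cube k δ)]
  refine lintegral_congr fun ξ => ?_
  by_cases hξ : ξ ∈ cube k δ
  · rw [indicator_of_mem hξ, ENNReal.ofReal_mul (norm_nonneg _), ofReal_norm, ofReal_norm,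
      enorm_smul, enorm_smul]
    ring
  · rw [indicator_of_notMem hξ, hχ.eq_zero hξ]
    simp

theorem ofReal_integral_norm_le (hχ : IsCubeCutoff k δ χ) (hδ : 0 < δ)
    (hδk : δ < ‖k‖ / (2 * √3)) (g : 𝓢(E3, C3)) :
    ENNReal.ofReal (∫ ξ, ‖ξ‖ * ‖χ ξ • g ξ‖)
      ≤ ENNReal.ofReal (3 / 2 * ‖k‖) * ∫⁻ ξ in cube k δ, ‖g ξ‖ₑ := by
  have hT := (hχ.hasCompactSupport hδ).hasTemperateGrowth hχ.smooth
  have hint : Integrable fun ξ => ‖ξ‖ * ‖χ ξ • g ξ‖ := by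
    simpa [SchwartzMap.smulLeftCLM_apply_apply hT] using
      (mulSymbol χ g).integrable_pow_mul volume 1
  rw [ofReal_integral_eq_lintegral_ofReal hint (.of_forall fun ξ => by positivity),
    ← lintegral_const_mul' _ _ ENNReal.ofReal_ne_top,
    ← lintegral_indicator (measurableSet_cube k δ)]
  refine lintegral_mono fun ξ => ?_
  by_cases hξ : ξ ∈ cube k δ
  · rw [indicator_of_mem hξ, ENNReal.ofReal_mul (norm_nonneg _), ofReal_norm (χ ξ • g ξ)]
    refine mul_le_mul' (ENNReal.ofReal_le_ofReal (norm_bounds_of_mem_cube hδ hδk hξ).2) ?_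
    rw [enorm_smul]
    refine mul_le_of_le_one_left' ?_
    rw [← ofReal_norm, Real.norm_of_nonneg (hχ.nonneg ξ)]
    exact ENNReal.ofReal_le_one.2 (hχ.le_one ξ)
  · rw [indicator_of_notMem hξ, hχ.eq_zero hξ]
    simp

end IsCubeCutoff

/-! ### Hölder's inequality for pairs -/

theorem lintegral_pair_mul_le {α : Type*} [MeasurableSpace α] {μ : Measure α} {p q : ℝ}
    (hpq : p.HolderConjugate q) {a₁ a₂ b₁ b₂ : α → ℝ≥0∞} (ha₁ : AEMeasurable a₁ μ)
    (ha₂ : AEMeasurable a₂ μ) (hb₁ : AEMeasurable b₁ μ) (hb₂ : AEMeasurable b₂ μ) :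
    ∫⁻ x, (a₁ x * b₁ x + a₂ x * b₂ x) ∂μ
      ≤ (∫⁻ x, (a₁ x ^ p + a₂ x ^ p) ∂μ) ^ (1 / p) *
        (∫⁻ x, (b₁ x ^ q + b₂ x ^ q) ∂μ) ^ (1 / q) := by
  have hp := hpq.pos
  have hq := hpq.symm.pos
  have h1 : ∀ x, a₁ x * b₁ x + a₂ x * b₂ x
      ≤ (a₁ x ^ p + a₂ x ^ p) ^ (1 / p) * (b₁ x ^ q + b₂ x ^ q) ^ (1 / q) := by
    intro x
    have := ENNReal.inner_le_Lp_mul_Lq (Finset.univ : Finset (Fin 2)) ![a₁ x, a₂ x]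
      ![b₁ x, b₂ x] hpq
    simpa [Fin.sum_univ_two] using this
  have hrp : ∀ (y : ℝ≥0∞) (r : ℝ), 0 < r → (y ^ (1 / r)) ^ r = y := by
    intro y r hr
    rw [← ENNReal.rpow_mul, one_div_mul_cancel hr.ne', ENNReal.rpow_one]
  have h2 := ENNReal.lintegral_mul_le_Lp_mul_Lq μ hpq
    (f := fun x => (a₁ x ^ p + a₂ x ^ p) ^ (1 / p))
    (g := fun x => (b₁ x ^ q + b₂ x ^ q) ^ (1 / q)) (by fun_prop) (by fun_prop)
  simp only [hrp _ _ hp, hrp _ _ hq] at h2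
  exact (lintegral_mono h1).trans h2

/-! ### The dominating quantity `h_p` -/

theorem monotone_hp (χ : E3 → ℝ) (p : ℝ) (f₁ f₂ : ℝ → L2) : Monotone (hp χ p f₁ f₂) :=
  fun _ _ h => essSup_mono_measure' (Measure.restrict_mono (Icc_subset_Icc le_rfl h) le_rfl)

/-- Since `h_p` is monotone it is continuous off a countable set, so the essential supremum over
`[0, s]` dominates the value at `s` itself for almost every `s`. -/
theorem ae_le_hp (χ : E3 → ℝ) (p : ℝ) (f₁ f₂ : ℝ → L2) :
    ∀ᵐ s ∂volume.restrict (Ioi (0 : ℝ)),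
      (∫⁻ ξ, (‖χ ξ • fhat (f₁ s) ξ‖ₑ ^ p + ‖χ ξ • fhat (f₂ s) ξ‖ₑ ^ p) / ‖ξ‖ₑ ^ p) ^ (1 / p)
        ≤ hp χ p f₁ f₂ s := by
  have h1 : ∀ᵐ s, ∀ r : ℚ, s ∈ Icc (0 : ℝ) r →
      (∫⁻ ξ, (‖χ ξ • fhat (f₁ s) ξ‖ₑ ^ p + ‖χ ξ • fhat (f₂ s) ξ‖ₑ ^ p) / ‖ξ‖ₑ ^ p) ^ (1 / p)
        ≤ hp χ p f₁ f₂ r := by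
    rw [ae_all_iff]
    intro r
    exact (ae_restrict_iff' measurableSet_Icc).1 (ENNReal.ae_le_essSup _)
  have h2 := ((monotone_hp χ p f₁ f₂).countable_not_continuousAt).ae_notMem volume
  rw [ae_restrict_iff' measurableSet_Ioi]
  filter_upwards [h1, h2] with s hs hc h0
  have hc' : ContinuousAt (hp χ p f₁ f₂) s := by simpa using hc
  refine ge_of_tendsto (hc'.tendsto.mono_left (nhdsWithin_le_nhds (s := Ioi s))) ?_
  filter_upwards [self_mem_nhdsWithin] with r hr
  obtain ⟨q, hq1, hq2⟩ := exists_rat_btwn (show s < r from hr)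
  exact (hs q ⟨le_of_lt h0, hq1.le⟩).trans (monotone_hp χ p f₁ f₂ hq2.le)

/-! ### The bound for the pairing with solenoidal symbols -/

theorem abs_gradPairFlip_tensor_sub_le (g : 𝓢(E3, C3)) (u b : L2) :
    |gradPairFlip (synth reC3 g) (tensor u u - tensor b b)|
      ≤ (‖u‖ ^ 2 + ‖b‖ ^ 2) * ∫ ξ, ‖ξ‖ * ‖g ξ‖ := by
  rw [(gradPairFlip (synth reC3 g)).map_sub]
  have h1 := abs_gradPairFlip_synth_tensor_le g u u
  have h2 := abs_gradPairFlip_synth_tensor_le g b b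
  refine (abs_sub _ _).trans ((add_le_add h1 h2).trans_eq ?_)
  ring

theorem abs_gradPairFlip_tensor_sub_swap_le (g : 𝓢(E3, C3)) (u b : L2) :
    |gradPairFlip (synth reC3 g) (tensor u b - tensor b u)|
      ≤ (‖u‖ ^ 2 + ‖b‖ ^ 2) * ∫ ξ, ‖ξ‖ * ‖g ξ‖ := by
  rw [(gradPairFlip (synth reC3 g)).map_sub]
  have h1 := abs_gradPairFlip_synth_tensor_le g u b
  have h2 := abs_gradPairFlip_synth_tensor_le g b u
  have hD : 0 ≤ ∫ ξ, ‖ξ‖ * ‖g ξ‖ := integral_nonneg fun ξ => by positivity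
  refine (abs_sub _ _).trans ((add_le_add h1 h2).trans ?_)
  nlinarith [mul_nonneg (sq_nonneg (‖u‖ - ‖b‖)) hD]

/-- The norm of a pair of symbols in `L^q` of the cube. -/
def pairNorm (k : E3) (δ q : ℝ) (g₁ g₂ : E3 → C3) : ℝ≥0∞ :=
  (∫⁻ ξ in cube k δ, (‖g₁ ξ‖ₑ ^ q + ‖g₂ ξ‖ₑ ^ q)) ^ (1 / q)

/-- The decay rate of the heat propagators on the cube, where `|ξ| ≥ |k|/2`. -/
def rate (ν η : ℝ) (k : E3) : ℝ := min ν η * ‖k‖ ^ 2 / 4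

/-- The bound that Duhamel's formula yields at time `t`: a convex combination of the initial value
and of the barrier. -/
def duhamelBound (ν η : ℝ) (k : E3) (R₁ : ℝ → ℝ) (t : ℝ) (S : ℝ≥0∞) : ℝ≥0∞ :=
  ENNReal.ofReal (Real.exp (-(rate ν η k * t))) * S
    + ENNReal.ofReal ((1 - Real.exp (-(rate ν η k * t))) * (R₁ t / ‖k‖))

section pairing

variable {k : E3} {δ : ℝ} {χ : E3 → ℝ} {p q : ℝ}

theorem aemeasurable_enorm_fhat (hχ : IsCubeCutoff k δ χ) (v : L2) :
    AEMeasurable (fun ξ => ‖χ ξ • fhat v ξ‖ₑ) (volume.restrict (cube k δ)) :=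
  (hχ.smooth.continuous.aestronglyMeasurable.smul (memLp_fhat v).1).enorm.restrict

theorem ofReal_integral_fhat_pair_le (hχ : IsCubeCutoff k δ χ) (hδ : 0 < δ)
    (hpq : p.HolderConjugate q) (v w : L2) (g₁ g₂ : 𝓢(E3, C3)) :
    ENNReal.ofReal ((∫ ξ, ‖fhat v ξ‖ * ‖χ ξ • g₁ ξ‖) + ∫ ξ, ‖fhat w ξ‖ * ‖χ ξ • g₂ ξ‖)
      ≤ ep χ p v w * pairNorm k δ q g₁ g₂ := by
  have hm₁ : AEMeasurable (fun ξ => ‖χ ξ • fhat v ξ‖ₑ * ‖g₁ ξ‖ₑ) (volume.restrict (cube k δ)) :=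
    (aemeasurable_enorm_fhat hχ v).mul g₁.continuous.enorm.aemeasurable
  rw [ENNReal.ofReal_add (integral_nonneg fun ξ => by positivity)
    (integral_nonneg fun ξ => by positivity), hχ.ofReal_integral_fhat hδ,
    hχ.ofReal_integral_fhat hδ, ← lintegral_add_left' hm₁]
  refine (lintegral_pair_mul_le hpq (aemeasurable_enorm_fhat hχ v) (aemeasurable_enorm_fhat hχ w)
    g₁.continuous.enorm.aemeasurable g₂.continuous.enorm.aemeasurable).trans ?_
  refine mul_le_mul_left ?_ _
  exact ENNReal.rpow_le_rpow (setLIntegral_le_lintegral _ _) (one_div_nonneg.2 hpq.nonneg)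

theorem ofReal_integral_force_pair_le (hχ : IsCubeCutoff k δ χ) (hk : k ≠ 0) (hδ : 0 < δ)
    (hδk : δ < ‖k‖ / (2 * √3))
    (hpq : p.HolderConjugate q) (v w : L2) (g₁ g₂ : 𝓢(E3, C3)) :
    ENNReal.ofReal ((∫ ξ, ‖fhat v ξ‖ * ‖χ ξ • g₁ ξ‖) + ∫ ξ, ‖fhat w ξ‖ * ‖χ ξ • g₂ ξ‖)
      ≤ ENNReal.ofReal (3 / 2 * ‖k‖) *
        (∫⁻ ξ, (‖χ ξ • fhat v ξ‖ₑ ^ p + ‖χ ξ • fhat w ξ‖ₑ ^ p) / ‖ξ‖ₑ ^ p) ^ (1 / p)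
        * pairNorm k δ q g₁ g₂ := by
  have hk0 := norm_pos_iff.2 hk
  have hp := hpq.pos
  have hm₁ : AEMeasurable (fun ξ => ‖χ ξ • fhat v ξ‖ₑ * ‖g₁ ξ‖ₑ) (volume.restrict (cube k δ)) :=
    (aemeasurable_enorm_fhat hχ v).mul g₁.continuous.enorm.aemeasurable
  rw [ENNReal.ofReal_add (integral_nonneg fun ξ => by positivity)
    (integral_nonneg fun ξ => by positivity), hχ.ofReal_integral_fhat hδ,
    hχ.ofReal_integral_fhat hδ, ← lintegral_add_left' hm₁]
  have hm : ∀ v : L2, AEMeasurable (fun ξ => ‖χ ξ • fhat v ξ‖ₑ / ‖ξ‖ₑ)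
      (volume.restrict (cube k δ)) := fun v =>
    (aemeasurable_enorm_fhat hχ v).div continuous_enorm.aemeasurable
  have hstep : ∫⁻ ξ in cube k δ, (‖χ ξ • fhat v ξ‖ₑ * ‖g₁ ξ‖ₑ + ‖χ ξ • fhat w ξ‖ₑ * ‖g₂ ξ‖ₑ)
      ≤ ENNReal.ofReal (3 / 2 * ‖k‖) * ∫⁻ ξ in cube k δ,
        (‖χ ξ • fhat v ξ‖ₑ / ‖ξ‖ₑ * ‖g₁ ξ‖ₑ + ‖χ ξ • fhat w ξ‖ₑ / ‖ξ‖ₑ * ‖g₂ ξ‖ₑ) := by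
    rw [← lintegral_const_mul' _ _ ENNReal.ofReal_ne_top]
    refine setLIntegral_mono' (measurableSet_cube k δ) fun ξ hξ => ?_
    have hb := norm_bounds_of_mem_cube hδ hδk hξ
    have hξ0 : ‖ξ‖ₑ ≠ 0 := by
      rw [enorm_ne_zero, ← norm_pos_iff]
      linarith
    have h1 : ∀ x : ℝ≥0∞, x ≤ ENNReal.ofReal (3 / 2 * ‖k‖) * (x / ‖ξ‖ₑ) := by
      intro x
      calc x = ‖ξ‖ₑ * (x / ‖ξ‖ₑ) := (ENNReal.mul_div_cancel hξ0 enorm_ne_top).symm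
        _ ≤ ENNReal.ofReal (3 / 2 * ‖k‖) * (x / ‖ξ‖ₑ) := by
          refine mul_le_mul_left ?_ _
          rw [← ofReal_norm]
          exact ENNReal.ofReal_le_ofReal hb.2
    rw [mul_add, ← mul_assoc, ← mul_assoc]
    exact add_le_add (mul_le_mul_left (h1 _) _) (mul_le_mul_left (h1 _) _)
  refine hstep.trans ?_
  rw [mul_assoc]
  refine mul_le_mul_right ?_ _
  refine (lintegral_pair_mul_le hpq (hm v) (hm w)
    g₁.continuous.enorm.aemeasurable g₂.continuous.enorm.aemeasurable).trans ?_
  refine mul_le_mul_left ?_ _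
  refine ENNReal.rpow_le_rpow ?_ (one_div_nonneg.2 hpq.nonneg)
  refine (setLIntegral_le_lintegral _ _).trans (lintegral_mono fun ξ => ?_)
  rw [ENNReal.div_rpow_of_nonneg _ _ hp.le, ENNReal.div_rpow_of_nonneg _ _ hp.le,
    ENNReal.add_div]

theorem ofReal_integral_norm_pair_le (hχ : IsCubeCutoff k δ χ) (hδ : 0 < δ)
    (hδk : δ < ‖k‖ / (2 * √3)) (hpq : p.HolderConjugate q) (g₁ g₂ : 𝓢(E3, C3)) :
    ENNReal.ofReal ((∫ ξ, ‖ξ‖ * ‖χ ξ • g₁ ξ‖) + ∫ ξ, ‖ξ‖ * ‖χ ξ • g₂ ξ‖)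
      ≤ ENNReal.ofReal (3 / 2 * ‖k‖) * ENNReal.ofReal ((2 : ℝ) ^ (1 / p) * (2 * δ) ^ (3 / p))
        * pairNorm k δ q g₁ g₂ := by
  have hp := hpq.pos
  rw [ENNReal.ofReal_add (integral_nonneg fun ξ => by positivity)
    (integral_nonneg fun ξ => by positivity)]
  refine (add_le_add (hχ.ofReal_integral_norm_le hδ hδk g₁)
    (hχ.ofReal_integral_norm_le hδ hδk g₂)).trans ?_
  rw [← mul_add, mul_assoc, ← lintegral_add_left g₁.continuous.enorm.measurable]
  refine mul_le_mul_right ?_ _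
  have h := lintegral_pair_mul_le (μ := volume.restrict (cube k δ)) hpq (a₁ := fun _ => 1)
    (a₂ := fun _ => 1) aemeasurable_const aemeasurable_const
    g₁.continuous.enorm.aemeasurable g₂.continuous.enorm.aemeasurable
  simp only [one_mul, ENNReal.one_rpow] at h
  refine h.trans_eq ?_
  rw [pairNorm]
  congr 1
  rw [lintegral_const, Measure.restrict_apply_univ, volume_cube k hδ, one_add_one_eq_two,
    ← ENNReal.ofReal_ofNat 2, ← ENNReal.ofReal_mul (by norm_num),
    ENNReal.ofReal_rpow_of_nonneg (by positivity) (by positivity),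
    Real.mul_rpow (by norm_num) (by positivity), ← Real.rpow_natCast,
    ← Real.rpow_mul (by positivity)]
  congr 3
  push_cast
  ring

variable {ν η : ℝ} {u₀ b₀ : L2} {u b f₁ f₂ : ℝ → L2} {R R₁ : ℝ → ℝ}

/-- The pairing of the cut-off Fourier transform of the solution with solenoidal symbols. The
domination hypothesis enters through Hölder's inequality, as on the cube `|ξ| ≤ 3|k|/2` and
`(3|k|/2) · (min(ν, η)/6) R₁ = rate · R₁/|k|`. -/
theorem pairing_le (hν : 0 < ν) (hη : 0 < η)
    (h₁ : FrequencyEquation ν u₀ u f₁ fun t => tensor (u t) (u t) - tensor (b t) (b t))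
    (h₂ : FrequencyEquation η b₀ b f₂ fun t => tensor (u t) (b t) - tensor (b t) (u t))
    (hR : ∀ t > 0, ‖u t‖ ^ 2 + ‖b t‖ ^ 2 ≤ R t ^ 2)
    (hk : k ≠ 0) (hδ : 0 < δ) (hδk : δ < ‖k‖ / (2 * √3)) (hχ : IsCubeCutoff k δ χ)
    (hR₁ : MonotoneOn R₁ (Ici 0)) (hpq : p.HolderConjugate q)
    (hdom : ∀ t : ℝ, 0 ≤ t →
      ENNReal.ofReal ((2 : ℝ) ^ (1 / p) * (2 * δ) ^ (3 / p) * R t ^ 2)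
        + 2 * hp χ p f₁ f₂ t < ENNReal.ofReal (min ν η / 6 * R₁ t))
    (hinit : ep χ p u₀ b₀ ≠ ⊤) {t : ℝ} (ht : 0 < t)
    (hgood₁ : ∀ φ, IsLeftLebesguePt t fun s => fieldPair φ (u s))
    (hgood₂ : ∀ φ, IsLeftLebesguePt t fun s => fieldPair φ (b s))
    {g₁ g₂ : 𝓢(E3, C3)} (hg₁ : IsSolenoidal g₁) (hg₂ : IsSolenoidal g₂) :
    ENNReal.ofReal ((∫ ξ, (inner ℂ (fhat (u t) ξ) (χ ξ • g₁ ξ) : ℂ).re)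
        + ∫ ξ, (inner ℂ (fhat (b t) ξ) (χ ξ • g₂ ξ) : ℂ).re)
      ≤ duhamelBound ν η k R₁ t (ep χ p u₀ b₀) * pairNorm k δ q g₁ g₂ := by
  have hk0 := norm_pos_iff.2 hk
  have hm : 0 < min ν η := lt_min hν hη
  have hc0 : 0 < rate ν η k := by
    unfold rate
    positivity
  have hR₁t : 0 < R₁ t := by
    have h := ENNReal.ofReal_pos.1 ((zero_le).trans_lt (hdom t ht.le))
    exact (pos_iff_pos_of_mul_pos h).1 (by positivity)
  have hexp : Real.exp (-(rate ν η k * t)) < 1 := by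
    rw [Real.exp_lt_one_iff]
    have := mul_pos hc0 ht
    linarith
  -- If the norm of the pair is infinite, so is the right-hand side.
  by_cases hG : pairNorm k δ q g₁ g₂ = ⊤
  · rw [hG, ENNReal.mul_top]
    · exact le_top
    · refine ((ENNReal.ofReal_pos.2 ?_).trans_le le_add_self).ne'
      exact mul_pos (by linarith) (by positivity)
  set G := pairNorm k δ q g₁ g₂ with hGdef
  have hlow : ∀ {κ : ℝ}, min ν η ≤ κ → ∀ ξ, χ ξ ≠ 0 → rate ν η k ≤ κ * ‖ξ‖ ^ 2 := by
    intro κ hκ ξ hξ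
    have hb := norm_bounds_of_mem_cube hδ hδk (hχ.mem_cube hξ)
    calc rate ν η k = min ν η * (‖k‖ / 2) ^ 2 := by
          unfold rate
          ring
      _ ≤ κ * ‖ξ‖ ^ 2 := by
          have := hb.1
          have := hm.le.trans hκ
          gcongr
  have hup : ∀ {κ : ℝ}, 0 ≤ κ → κ ≤ max ν η → ∀ ξ, χ ξ ≠ 0 →
      κ * ‖ξ‖ ^ 2 ≤ max ν η * (3 / 2 * ‖k‖) ^ 2 := by
    intro κ hκ0 hκ ξ hξ
    have hb := norm_bounds_of_mem_cube hδ hδk (hχ.mem_cube hξ)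
    have := hb.2
    gcongr
  have hmax : 0 ≤ max ν η := hν.le.trans (le_max_left _ _)
  have key := h₁.pair_le h₂ hν.le hη.le ht hgood₁ hgood₂ hχ.smooth (hχ.hasCompactSupport hδ)
    hχ.nonneg hc0 (hlow (min_le_left _ _)) (hlow (min_le_right _ _)) (by positivity)
    (hup hν.le (le_max_left _ _)) (hup hη.le (le_max_right _ _))
    (E := fun s => ‖u s‖ ^ 2 + ‖b s‖ ^ 2) (fun s _ => by positivity)
    (fun s _ g => abs_gradPairFlip_tensor_sub_le g (u s) (b s))
    (fun s _ g => abs_gradPairFlip_tensor_sub_swap_le g (u s) (b s)) hg₁ hg₂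
    (B₀ := (ep χ p u₀ b₀ * G).toReal)
    (B := rate ν η k * (R₁ t / ‖k‖) * G.toReal) ?_ ?_
  · refine (ENNReal.ofReal_le_ofReal key).trans_eq ?_
    have e1 : rate ν η k * (R₁ t / ‖k‖) * G.toReal *
        ((1 - Real.exp (-(rate ν η k * t))) / rate ν η k)
        = (1 - Real.exp (-(rate ν η k * t))) * (R₁ t / ‖k‖) * G.toReal := by
      field_simp
    have h1 : 0 ≤ (1 - Real.exp (-(rate ν η k * t))) * (R₁ t / ‖k‖) :=
      mul_nonneg (by linarith) (by positivity)
    rw [e1, ENNReal.ofReal_add (by positivity) (by positivity),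
      ENNReal.ofReal_mul (Real.exp_pos _).le, ENNReal.ofReal_mul h1, ENNReal.ofReal_toReal hG,
      ENNReal.ofReal_toReal (ENNReal.mul_ne_top hinit hG), duhamelBound]
    ring
  · rw [← ENNReal.ofReal_le_iff_le_toReal (ENNReal.mul_ne_top hinit hG)]
    exact ofReal_integral_fhat_pair_le hχ hδ hpq u₀ b₀ g₁ g₂
  · have hhp := ae_restrict_of_ae_restrict_of_subset (fun s (hs : s ∈ Ioo 0 t) => hs.1)
      (ae_le_hp χ p f₁ f₂)
    filter_upwards [hhp, ae_restrict_mem measurableSet_Ioo] with s hs hst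
    set X := (∫⁻ ξ, (‖χ ξ • fhat (f₁ s) ξ‖ₑ ^ p + ‖χ ξ • fhat (f₂ s) ξ‖ₑ ^ p) / ‖ξ‖ₑ ^ p) ^ (1 / p)
      with hX
    set A := (2 : ℝ) ^ (1 / p) * (2 * δ) ^ (3 / p) with hA
    have hA0 : 0 ≤ A := by positivity
    have hJ : 0 ≤ (∫ ξ, ‖ξ‖ * ‖χ ξ • g₁ ξ‖) + ∫ ξ, ‖ξ‖ * ‖χ ξ • g₂ ξ‖ :=
      add_nonneg (integral_nonneg fun ξ => by positivity) (integral_nonneg fun ξ => by positivity)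
    have hI : 0 ≤ (∫ ξ, ‖fhat (f₁ s) ξ‖ * ‖χ ξ • g₁ ξ‖) + ∫ ξ, ‖fhat (f₂ s) ξ‖ * ‖χ ξ • g₂ ξ‖ :=
      add_nonneg (integral_nonneg fun ξ => by positivity) (integral_nonneg fun ξ => by positivity)
    have hAX : X + ENNReal.ofReal (A * R s ^ 2) ≤ ENNReal.ofReal (min ν η / 6 * R₁ t) := by
      have h1 := (hdom s hst.1.le).le
      have h2 : X ≤ 2 * hp χ p f₁ f₂ s := hs.trans (by rw [two_mul]; exact le_self_add)
      have h3 : R₁ s ≤ R₁ t := hR₁ hst.1.le ht.le hst.2.le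
      calc X + ENNReal.ofReal (A * R s ^ 2)
          ≤ ENNReal.ofReal (A * R s ^ 2) + 2 * hp χ p f₁ f₂ s := by
            rw [add_comm]
            gcongr
        _ ≤ ENNReal.ofReal (min ν η / 6 * R₁ s) := h1
        _ ≤ ENNReal.ofReal (min ν η / 6 * R₁ t) := ENNReal.ofReal_le_ofReal (by gcongr)
    have hB0 : 0 ≤ rate ν η k * (R₁ t / ‖k‖) * G.toReal := by positivity
    rw [← ENNReal.ofReal_le_ofReal_iff hB0, ENNReal.ofReal_add hI (mul_nonneg (by positivity) hJ),
      ENNReal.ofReal_mul (by positivity)]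
    calc _ ≤ ENNReal.ofReal (3 / 2 * ‖k‖) * X * G
          + ENNReal.ofReal (R s ^ 2) *
            (ENNReal.ofReal (3 / 2 * ‖k‖) * ENNReal.ofReal A * G) :=
          add_le_add (ofReal_integral_force_pair_le hχ hk hδ hδk hpq _ _ g₁ g₂)
            (mul_le_mul' (ENNReal.ofReal_le_ofReal (hR s hst.1))
              (ofReal_integral_norm_pair_le hχ hδ hδk hpq g₁ g₂))
      _ = ENNReal.ofReal (3 / 2 * ‖k‖) * (X + ENNReal.ofReal (A * R s ^ 2)) * G := by
          rw [ENNReal.ofReal_mul hA0]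
          ring
      _ ≤ ENNReal.ofReal (3 / 2 * ‖k‖) * ENNReal.ofReal (min ν η / 6 * R₁ t) * G := by
          gcongr
      _ = ENNReal.ofReal (rate ν η k * (R₁ t / ‖k‖) * G.toReal) := by
          have h0 : 0 ≤ rate ν η k * (R₁ t / ‖k‖) := by positivity
          rw [ENNReal.ofReal_mul h0, ENNReal.ofReal_toReal hG,
            ← ENNReal.ofReal_mul (by positivity)]
          congr 2
          unfold rate
          field_simp
          ring

end pairing

/-! ### Divergence free fields on the frequency side -/

theorem fourier_postcomp {F F' : Type*} [NormedAddCommGroup F] [NormedSpace ℂ F]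
    [CompleteSpace F] [NormedAddCommGroup F'] [NormedSpace ℂ F'] [CompleteSpace F']
    (A : F →L[ℂ] F') (h : 𝓢(E3, F)) (x : E3) :
    𝓕 (h.postcompCLM A) x = A (𝓕 h x) := by
  have h1 : 𝓕⁻ h (-x) = 𝓕 h (-(-x)) := rfl
  have h2 : 𝓕⁻ (h.postcompCLM A) (-x) = 𝓕 (h.postcompCLM A) (-(-x)) := rfl
  have := fourierInv_postcomp A h (-x)
  rwa [h1, h2, neg_neg] at this

theorem sum_mul_fourier_eq_zero {φ : 𝓢(E3, E3)} (hφ : ∀ x, divergence φ x = 0) (ζ : E3) :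
    ∑ j, (ζ j : ℂ) * 𝓕 (φ.postcompCLM toC3) ζ j = 0 := by
  set Φ : 𝓢(E3, C3) := φ.postcompCLM toC3 with hΦ
  have hsum : ∑ j, (∂_{e j} Φ).postcompCLM (EuclideanSpace.proj j : C3 →L[ℂ] ℂ) = 0 := by
    ext x
    rw [sum_apply]
    have hd : ∀ j, (∂_{e j} Φ).postcompCLM (EuclideanSpace.proj j : C3 →L[ℂ] ℂ) x
        = ((fderiv ℝ φ x (e j) j : ℝ) : ℂ) := by
      intro j
      rw [SchwartzMap.postcompCLM_apply, SchwartzMap.lineDerivOp_apply_eq_fderiv, hΦ,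
        fderiv_postcompCLM]
      rfl
    simp only [hd]
    rw [← Complex.ofReal_sum]
    have := hφ x
    rw [divergence] at this
    rw [this]
    rfl
  have h1 : ∑ j, (𝓕 ((∂_{e j} Φ).postcompCLM
      (EuclideanSpace.proj j : C3 →L[ℂ] ℂ)) : 𝓢(E3, ℂ)) ζ = 0 := by
    rw [← sum_apply, ← FourierTransform.fourier_sum, hsum, FourierTransform.fourier_zero]
    rfl
  have h2 : ∀ j, (𝓕 ((∂_{e j} Φ).postcompCLM
      (EuclideanSpace.proj j : C3 →L[ℂ] ℂ)) : 𝓢(E3, ℂ)) ζ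
      = (2 * Real.pi * Complex.I) * ((ζ j : ℂ) * 𝓕 Φ ζ j) := by
    intro j
    rw [fourier_postcomp, SchwartzMap.fourier_lineDerivOp_eq, smul_apply,
      SchwartzMap.smulLeftCLM_apply_apply (hasTemperateGrowth_inner _), inner_e]
    simp
  simp only [h2] at h1
  rw [← Finset.mul_sum] at h1
  exact (mul_eq_zero.1 h1).resolve_left (by simp [Real.pi_ne_zero])

/-- The Fourier transform of a field in `L²_σ` is orthogonal to the frequency. -/
theorem ae_sum_mul_fhat_eq_zero {v : L2} (hv : v ∈ L2sigma) :
    ∀ᵐ ξ, ∑ j, (ξ j : ℂ) * fhat v ξ j = 0 := by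
  let T : L2 → Lp C3 2 (volume : Measure E3) := fun v => 𝓕 (toC3.compLp v)
  have hT : Continuous T := by
    have h1 : Continuous fun v : L2 => (toC3.compLp v : Lp C3 2 (volume : Measure E3)) :=
      (toC3.compLpL 2 (volume : Measure E3)).continuous
    exact (Lp.fourierTransformₗᵢ E3 C3).continuous.comp h1
  have hmain : ∀ᵐ ζ, ∑ j, (ζ j : ℂ) * T v ζ j = 0 := by
    obtain ⟨x, hx, hlim⟩ := mem_closure_iff_seq_limit.1 hv
    have htest : ∀ n, ∀ᵐ ζ, ∑ j, (ζ j : ℂ) * T (x n) ζ j = 0 := by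
      intro n
      obtain ⟨φ, hφ, hxφ⟩ := hx n
      set ψ := hφ.toSchwartz with hψ
      have h1 : toC3.compLp (x n) = (ψ.postcompCLM toC3).toLp 2 volume := by
        refine Lp.ext ?_
        filter_upwards [toC3.coeFn_compLp (x n), hxφ,
          (ψ.postcompCLM toC3).coeFn_toLp 2 volume] with y h1 h2 h3
        rw [h1, h2, h3]
        rfl
      have h2 : T (x n) = (𝓕 (ψ.postcompCLM toC3)).toLp 2 volume := by
        simp only [T]
        rw [h1, SchwartzMap.toLp_fourier_eq]
      rw [h2]
      filter_upwards [(𝓕 (ψ.postcompCLM toC3)).coeFn_toLp 2 volume] with ζ hζ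
      rw [hζ]
      exact sum_mul_fourier_eq_zero hφ.2.2 ζ
    have hlimT : Tendsto (fun n => T (x n)) atTop (𝓝 (T v)) := (hT.tendsto v).comp hlim
    obtain ⟨ns, -, hns⟩ := (tendstoInMeasure_of_tendsto_Lp hlimT).exists_seq_tendsto_ae
    filter_upwards [hns, ae_all_iff.2 htest] with ζ h1 h2
    have hc : Continuous fun z : C3 => ∑ j, (ζ j : ℂ) * z j := by fun_prop
    have h3 := (hc.tendsto _).comp h1
    refine tendsto_nhds_unique h3 ?_
    refine tendsto_const_nhds.congr fun i => ?_
    exact (h2 (ns i)).symm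
  have h0 : (2 * Real.pi)⁻¹ ≠ 0 := by positivity
  filter_upwards [(Measure.quasiMeasurePreserving_smul volume h0).ae hmain] with ξ hξ
  have h1 : ∑ j, (ξ j : ℂ) * fhat v ξ j
      = (2 * Real.pi : ℂ) * ∑ j, ((((2 * Real.pi)⁻¹ • ξ : E3) j : ℝ) : ℂ) *
        T v ((2 * Real.pi)⁻¹ • ξ) j := by
    rw [Finset.mul_sum]
    refine Finset.sum_congr rfl fun j _ => ?_
    have hpi : (Real.pi : ℂ) ≠ 0 := by exact_mod_cast Real.pi_ne_zero
    have : fhat v ξ = T v ((2 * Real.pi)⁻¹ • ξ) := rfl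
    rw [this, PiLp.smul_apply, smul_eq_mul]
    push_cast
    field_simp
  rw [h1, hξ, mul_zero]

/-! ### Weak continuity and membership in `L²_σ` -/

/-- The test fields as a subspace of `L²`. -/
def testSubmodule : Submodule ℝ L2 where
  carrier := {v | ∃ φ, IsTestField φ ∧ v =ᵐ[volume] φ}
  add_mem' := by
    rintro v w ⟨φ, hφ, hv⟩ ⟨ψ, hψ, hw⟩
    refine ⟨φ + ψ, ⟨hφ.1.add hψ.1, hφ.2.1.add hψ.2.1, fun x => ?_⟩, ?_⟩
    · have h1 := hφ.2.2 x
      have h2 := hψ.2.2 x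
      simp only [divergence] at h1 h2 ⊢
      rw [fderiv_add (hφ.1.differentiable (by simp) x) (hψ.1.differentiable (by simp) x)]
      simp [Finset.sum_add_distrib, h1, h2]
    · exact (Lp.coeFn_add v w).trans (hv.add hw)
  zero_mem' := by
    refine ⟨0, ⟨contDiff_const, HasCompactSupport.zero, fun x => ?_⟩, Lp.coeFn_zero _ _ _⟩
    simp [divergence]
  smul_mem' := by
    rintro c v ⟨φ, hφ, hv⟩
    refine ⟨c • φ, ⟨contDiff_const.smul hφ.1, hφ.2.1.smul_left (f := fun _ => c), fun x => ?_⟩, ?_⟩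
    · have h1 := hφ.2.2 x
      simp only [divergence] at h1 ⊢
      rw [fderiv_const_smul (hφ.1.differentiable (by simp) x)]
      simp [← Finset.mul_sum, h1]
    · exact (Lp.coeFn_smul c v).trans (hv.const_smul c)

theorem mem_L2sigma_iff (v : L2) :
    v ∈ L2sigma ↔ ∀ y ∈ testSubmoduleᗮ, (inner ℝ y v : ℝ) = 0 := by
  have h : v ∈ L2sigma ↔ v ∈ testSubmodule.topologicalClosure := Iff.rfl
  rw [h, ← Submodule.orthogonal_orthogonal_eq_closure, Submodule.mem_orthogonal]

/-- `L²_σ` is the annihilator of the fields orthogonal to it, so a weakly continuous function that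
takes values in it almost everywhere takes values in it everywhere. -/
theorem WeaklyContinuous.mem_L2sigma {w : ℝ → L2} (hw : WeaklyContinuous w)
    (h : ∀ᵐ t ∂volume.restrict (Ioi (0 : ℝ)), w t ∈ L2sigma) {t : ℝ} (ht : 0 < t) :
    w t ∈ L2sigma := by
  rw [mem_L2sigma_iff]
  intro y hy
  have hae : (fun s => (inner ℝ y (w s) : ℝ)) =ᵐ[volume.restrict (Ioi (0 : ℝ))] fun _ => 0 := by
    filter_upwards [h] with s hs
    exact (mem_L2sigma_iff _).1 hs y hy
  exact Measure.eqOn_open_of_ae_eq hae isOpen_Ioi (hw y) continuousOn_const ht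

/-! ### Lebesgue points in time -/

theorem isLeftLebesguePt_of_continuousOn {m : ℝ → ℝ} (hm : ContinuousOn m (Ioi 0)) {t : ℝ}
    (ht : 0 < t) : IsLeftLebesguePt t m := by
  rw [IsLeftLebesguePt, Metric.tendsto_nhdsWithin_nhds]
  intro ε hε
  have hc := hm.continuousAt (Ioi_mem_nhds ht)
  obtain ⟨r, hr, hball⟩ := Metric.continuousAt_iff.1 hc (ε / 2) (by positivity)
  refine ⟨r, hr, fun {h} hh hhr => ?_⟩
  have hh0 : 0 < h := hh
  rw [Real.dist_eq, sub_zero, abs_of_pos hh0] at hhr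
  have hb : ‖∫ s in Icc (t - h) t, |m s - m t|‖ ≤ ε / 2 * volume.real (Icc (t - h) t) := by
    refine norm_setIntegral_le_of_norm_le_const (by simp) fun s hs => ?_
    rw [Real.norm_eq_abs, abs_abs, ← Real.dist_eq]
    refine (hball ?_).le
    rw [Real.dist_eq, abs_sub_comm, abs_of_nonneg (by linarith [hs.2])]
    linarith [hs.1]
  rw [Real.volume_real_Icc_of_le (by linarith), sub_sub_cancel] at hb
  rw [dist_zero_right, norm_mul, norm_inv, Real.norm_of_nonneg hh0.le]
  calc h⁻¹ * ‖∫ s in Icc (t - h) t, |m s - m t|‖ ≤ h⁻¹ * (ε / 2 * h) := by gcongr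
    _ = ε / 2 := by field_simp
    _ < ε := by linarith

/-- Almost every time is a Lebesgue point of all functionals of a locally bounded function. -/
theorem LocBdd.ae_isLeftLebesguePt {w : ℝ → L2} (hw : LocBdd w) :
    ∀ᵐ t ∂volume.restrict (Ioi (0 : ℝ)), ∀ A : L2 →L[ℝ] ℝ,
      IsLeftLebesguePt t fun s => A (w s) := by
  have hloc : LocallyIntegrable (indicator (Ioi 0) w) := by
    intro x
    refine ⟨Iio (x + 1), Iio_mem_nhds (by linarith), ?_⟩
    rw [IntegrableOn, integrable_indicator_iff measurableSet_Ioi, IntegrableOn,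
      Measure.restrict_restrict measurableSet_Ioi]
    exact hw.integrableOn (x + 1)
  have h := IsUnifLocDoublingMeasure.ae_tendsto_average_norm_sub volume hloc 1
  rw [ae_restrict_iff' measurableSet_Ioi]
  filter_upwards [h] with t ht h0 A
  have h0' : 0 < t := h0
  have hlim := ht (l := 𝓝[>] (0 : ℝ)) (fun h => t - h / 2) (fun h => h / 2) ?_ ?_
  · have hsmall : ∀ᶠ h in 𝓝[>] (0 : ℝ), 0 < h ∧ h < t := Ioo_mem_nhdsGT h0'
    have hbound : ∀ᶠ h in 𝓝[>] (0 : ℝ), h⁻¹ * ∫ s in Icc (t - h) t, |A (w s) - A (w t)|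
        ≤ ‖A‖ * ⨍ y in Metric.closedBall (t - h / 2) (h / 2),
          ‖indicator (Ioi 0) w y - indicator (Ioi 0) w t‖ := by
      filter_upwards [hsmall] with h hh
      have hball : Metric.closedBall (t - h / 2) (h / 2) = Icc (t - h) t := by
        rw [Real.closedBall_eq_Icc]
        ring_nf
      have hcongr : ∫ y in Icc (t - h) t, ‖indicator (Ioi 0) w y - indicator (Ioi 0) w t‖
          = ∫ y in Icc (t - h) t, ‖w y - w t‖ := by
        refine setIntegral_congr_fun measurableSet_Icc fun y hy => ?_
        have : y ∈ Ioi (0 : ℝ) := show 0 < y by linarith [hy.1]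
        simp only [indicator_of_mem this, indicator_of_mem h0]
      have hint : Integrable (fun y => ‖w y - w t‖) (volume.restrict (Icc (t - h) t)) := by
        have h1 : IntegrableOn w (Icc (t - h) t) :=
          (hw.integrableOn (t + 1)).mono_set fun y hy =>
            ⟨by linarith [hy.1], by linarith [hy.2]⟩
        exact (h1.sub (integrable_const _)).norm
      rw [hball, setAverage_eq, hcongr, Real.volume_real_Icc_of_le (by linarith [hh.1]),
        sub_sub_cancel, smul_eq_mul, mul_left_comm]
      refine mul_le_mul_of_nonneg_left ?_ (inv_pos.2 hh.1).le
      rw [← integral_const_mul]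
      refine integral_mono_of_nonneg (.of_forall fun s => abs_nonneg _) (hint.const_mul _)
        (.of_forall fun s => ?_)
      simp only
      rw [← A.map_sub]
      exact A.le_opNorm _
    refine squeeze_zero' ?_ hbound (by simpa using hlim.const_mul ‖A‖)
    filter_upwards [hsmall] with h hh
    exact mul_nonneg (inv_pos.2 hh.1).le (integral_nonneg fun s => abs_nonneg _)
  · refine tendsto_nhdsWithin_iff.2 ⟨?_, ?_⟩
    · have : Tendsto (fun h : ℝ => h / 2) (𝓝 0) (𝓝 (0 / 2)) := tendsto_id.div_const 2
      rw [zero_div] at this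
      exact this.mono_left nhdsWithin_le_nhds
    · filter_upwards [self_mem_nhdsWithin] with h hh
      exact half_pos (show 0 < h from hh)
  · filter_upwards [self_mem_nhdsWithin] with h hh
    have : 0 < h := hh
    rw [Metric.mem_closedBall, Real.dist_eq, one_mul, abs_of_nonneg] <;> linarith

/-! ### Approximation by solenoidal symbols -/

/-- Bounded fields on the cube that are orthogonal to the frequency. -/
structure IsTransverse (k : E3) (δ : ℝ) (g : E3 → C3) : Prop where
  stronglyMeasurable : StronglyMeasurable g
  bounded : ∃ M : ℝ, ∀ ξ, ‖g ξ‖ ≤ M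
  eq_zero : ∀ ξ ∉ cube k δ, g ξ = 0
  orthogonal : ∀ᵐ ξ, ∑ j, (ξ j : ℂ) * g ξ j = 0

section transverse

variable {k : E3} {δ : ℝ} {g : E3 → C3}

theorem isFiniteMeasure_cube (hδ : 0 < δ) : IsFiniteMeasure (volume.restrict (cube k δ)) :=
  ⟨by rw [Measure.restrict_apply_univ, volume_cube k hδ]; exact ENNReal.ofReal_lt_top⟩

theorem IsTransverse.memLp_potential (hg : IsTransverse k δ g) (hδ : 0 < δ)
    (hδk : δ < ‖k‖ / (2 * √3)) (hk : k ≠ 0) (i j : Fin 3) :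
    MemLp (fun ξ => ((ξ j / ‖ξ‖ ^ 2 : ℝ) : ℂ) * g ξ i) 2 volume := by
  have hk0 := norm_pos_iff.2 hk
  have := isFiniteMeasure_cube (k := k) hδ
  obtain ⟨M, hM⟩ := hg.bounded
  have hm : StronglyMeasurable fun ξ => ((ξ j / ‖ξ‖ ^ 2 : ℝ) : ℂ) * g ξ i := by
    have h1 : Measurable fun ξ : E3 => ((ξ j / ‖ξ‖ ^ 2 : ℝ) : ℂ) := by fun_prop
    have h2 : StronglyMeasurable fun ξ => g ξ i :=
      (EuclideanSpace.proj i : C3 →L[ℂ] ℂ).continuous.comp_stronglyMeasurable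
        hg.stronglyMeasurable
    exact h1.stronglyMeasurable.mul h2
  have hind : (fun ξ => ((ξ j / ‖ξ‖ ^ 2 : ℝ) : ℂ) * g ξ i)
      = indicator (cube k δ) fun ξ => ((ξ j / ‖ξ‖ ^ 2 : ℝ) : ℂ) * g ξ i := by
    ext ξ
    by_cases h : ξ ∈ cube k δ
    · rw [indicator_of_mem h]
    · rw [indicator_of_notMem h, hg.eq_zero ξ h]
      simp
  rw [hind, memLp_indicator_iff_restrict (measurableSet_cube k δ)]
  refine MemLp.of_bound hm.aestronglyMeasurable (2 / ‖k‖ * M) ?_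
  filter_upwards [ae_restrict_mem (measurableSet_cube k δ)] with ξ hξ
  have hb := (norm_bounds_of_mem_cube hδ hδk hξ).1
  have hξ0 : 0 < ‖ξ‖ := by linarith
  rw [norm_mul, Complex.norm_real, norm_div, norm_pow, norm_norm]
  refine mul_le_mul ?_ ((PiLp.norm_apply_le (g ξ) i).trans (hM ξ)) (norm_nonneg _) (by positivity)
  calc ‖ξ j‖ / ‖ξ‖ ^ 2 ≤ ‖ξ‖ / ‖ξ‖ ^ 2 := by
        gcongr
        exact PiLp.norm_apply_le ξ j
    _ = 1 / ‖ξ‖ := by field_simp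
    _ ≤ 1 / (‖k‖ / 2) := by gcongr
    _ = 2 / ‖k‖ := by field_simp

theorem sum_potential_eq {ξ : E3} (hξ : ξ ≠ 0) {z : C3} (hz : ∑ j, (ξ j : ℂ) * z j = 0) :
    ∑ i, ∑ j, (((ξ j / ‖ξ‖ ^ 2 : ℝ) : ℂ) * z i) • (ξ j • toC3 (e i) - ξ i • toC3 (e j)) = z := by
  have hn : (∑ j, (ξ j : ℂ) * (ξ j : ℂ)) = ((‖ξ‖ ^ 2 : ℝ) : ℂ) := by
    rw [EuclideanSpace.norm_sq_eq]
    push_cast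
    refine Finset.sum_congr rfl fun j _ => ?_
    rw [← Complex.ofReal_pow, Real.norm_eq_abs, sq_abs]
    push_cast
    ring
  have h0 : ((‖ξ‖ ^ 2 : ℝ) : ℂ) ≠ 0 := by
    have := norm_ne_zero_iff.2 hξ
    exact_mod_cast pow_ne_zero 2 this
  have hE : ∀ i l : Fin 3, toC3 (e i) l = if l = i then 1 else 0 := by
    intro i l
    rw [toC3_apply, e]
    by_cases h : l = i
    · subst h
      simp
    · simp [h]
  ext l
  have h1 : ∀ i j : Fin 3, ((((ξ j / ‖ξ‖ ^ 2 : ℝ) : ℂ) * z i) •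
      (ξ j • toC3 (e i) - ξ i • toC3 (e j))) l
      = (if l = i then z i * ((ξ j : ℂ) * (ξ j : ℂ)) / ((‖ξ‖ ^ 2 : ℝ) : ℂ) else 0)
        - (if l = j then (ξ j : ℂ) * ((ξ i : ℂ) * z i) / ((‖ξ‖ ^ 2 : ℝ) : ℂ) else 0) := by
    intro i j
    simp only [PiLp.smul_apply, PiLp.sub_apply, hE, smul_eq_mul, Complex.real_smul]
    push_cast
    split_ifs <;> ring
  simp only [WithLp.ofLp_sum, Finset.sum_apply, h1, Finset.sum_sub_distrib]
  have h2 : ∑ i, ∑ j, (if l = i then z i * ((ξ j : ℂ) * (ξ j : ℂ)) / ((‖ξ‖ ^ 2 : ℝ) : ℂ) else 0)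
      = z l := by
    rw [Finset.sum_eq_single l (fun i _ hi => by simp [Ne.symm hi]) (by simp)]
    simp only [if_true]
    rw [← Finset.sum_div, ← Finset.mul_sum, hn, mul_div_assoc, div_self h0, mul_one]
  have h3 : ∑ i, ∑ j, (if l = j then (ξ j : ℂ) * ((ξ i : ℂ) * z i) / ((‖ξ‖ ^ 2 : ℝ) : ℂ) else 0)
      = 0 := by
    simp only [Finset.sum_ite_eq, Finset.mem_univ, if_true]
    rw [← Finset.sum_div, ← Finset.mul_sum, hz, mul_zero, zero_div]
  rw [h2, h3, sub_zero]

/-- A transverse field `g` equals `∑ (ξⱼ gᵢ / |ξ|²) (ξⱼ eᵢ - ξᵢ eⱼ)`. Approximating the coefficients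
in `L²` by Schwartz functions approximates `g` by solenoidal symbols. -/
theorem IsTransverse.exists_approx (hg : IsTransverse k δ g) (hδ : 0 < δ)
    (hδk : δ < ‖k‖ / (2 * √3)) (hk : k ≠ 0) :
    ∃ s : ℕ → 𝓢(E3, C3), (∀ n, IsSolenoidal (s n)) ∧
      Tendsto (fun n => eLpNorm (fun ξ => s n ξ - g ξ) 2 (volume.restrict (cube k δ))) atTop
        (𝓝 0) := by
  have hk0 := norm_pos_iff.2 hk
  set γ : Fin 3 → Fin 3 → E3 → ℂ := fun i j ξ => ((ξ j / ‖ξ‖ ^ 2 : ℝ) : ℂ) * g ξ i with hγ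
  have hγm : ∀ i j, MemLp (γ i j) 2 volume := hg.memLp_potential hδ hδk hk
  have hdense : ∀ (n : ℕ) i j, ∃ ψ : 𝓢(E3, ℂ),
      eLpNorm (fun ξ => ψ ξ - γ i j ξ) 2 volume ≤ ENNReal.ofReal (1 / (n + 1)) := by
    intro n i j
    obtain ⟨y, hy⟩ := (SchwartzMap.denseRange_toLpCLM (F := ℂ) (p := 2)
      (μ := (volume : Measure E3)) ENNReal.ofNat_ne_top).exists_dist_lt ((hγm i j).toLp _)
      (ε := 1 / ((n : ℝ) + 1)) (by positivity)
    refine ⟨y, ?_⟩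
    rw [dist_comm, SchwartzMap.toLpCLM_apply, Lp.dist_def] at hy
    have h1 : eLpNorm (⇑(y.toLp 2 volume) - ⇑((hγm i j).toLp _)) 2 volume
        = eLpNorm (fun ξ => y ξ - γ i j ξ) 2 volume := by
      refine eLpNorm_congr_ae ?_
      filter_upwards [y.coeFn_toLp 2 volume, (hγm i j).coeFn_toLp] with ξ h1 h2
      simp only [Pi.sub_apply]
      rw [h1, h2]
    rw [h1] at hy
    rw [← ENNReal.ofReal_toReal (a := eLpNorm (fun ξ => y ξ - γ i j ξ) 2 volume)
      ((y.memLp 2 volume).sub (hγm i j)).2.ne]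
    exact ENNReal.ofReal_le_ofReal hy.le
  choose ψ hψ using hdense
  refine ⟨fun n => ∑ i, ∑ j, curlSymbol i j (ψ n i j), fun n => ⟨ψ n, rfl⟩, ?_⟩
  have hbound : ∀ n, eLpNorm (fun ξ => (∑ i, ∑ j, curlSymbol i j (ψ n i j) : 𝓢(E3, C3)) ξ - g ξ) 2
      (volume.restrict (cube k δ))
      ≤ 9 * (ENNReal.ofReal (3 * ‖k‖) * ENNReal.ofReal (1 / (n + 1))) := by
    intro n
    have h1 : ∀ᵐ ξ ∂volume.restrict (cube k δ),
        ‖(∑ i, ∑ j, curlSymbol i j (ψ n i j) : 𝓢(E3, C3)) ξ - g ξ‖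
          ≤ ‖(∑ r : Fin 3 × Fin 3, fun ξ => (3 * ‖k‖) • ‖ψ n r.1 r.2 ξ - γ r.1 r.2 ξ‖) ξ‖ := by
      filter_upwards [ae_restrict_mem (measurableSet_cube k δ),
        ae_restrict_of_ae hg.orthogonal] with ξ hξ hort
      have hb := norm_bounds_of_mem_cube hδ hδk hξ
      have hξ0 : ξ ≠ 0 := norm_pos_iff.1 (by linarith)
      have he : ∀ i : Fin 3, ‖toC3 (e i)‖ = 1 := by
        intro i
        have h := inner_reC3 (e i) (toC3 (e i))
        have h2 : reC3 (toC3 (e i)) = e i := by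
          ext l
          simp [reC3_apply, toC3_apply]
        have h3 : ‖e i‖ = 1 := by simp [e]
        rw [h2, real_inner_self_eq_norm_sq, h3] at h
        have h4 := inner_self_eq_norm_sq (𝕜 := ℂ) (toC3 (e i))
        have h5 : ‖toC3 (e i)‖ ^ 2 = 1 := by
          rw [← h4]
          simpa using h.symm
        exact (pow_eq_one_iff_of_nonneg (norm_nonneg _) two_ne_zero).1 h5
      have hvec : ∀ i j : Fin 3, ‖ξ j • toC3 (e i) - ξ i • toC3 (e j)‖ ≤ 3 * ‖k‖ := by
        intro i j
        have c : ∀ i, ‖ξ i‖ ≤ ‖ξ‖ := PiLp.norm_apply_le ξ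
        refine (norm_sub_le _ _).trans ?_
        rw [norm_smul, norm_smul, he, he]
        linarith [c i, c j]
      rw [Finset.sum_apply, Real.norm_of_nonneg (Finset.sum_nonneg fun r _ => by positivity),
        Fintype.sum_prod_type]
      nth_rewrite 1 [← sum_potential_eq hξ0 hort]
      simp only [sum_apply, curlSymbol_apply, ← Finset.sum_sub_distrib]
      refine (norm_sum_le _ _).trans (Finset.sum_le_sum fun i _ => ?_)
      refine (norm_sum_le _ _).trans (Finset.sum_le_sum fun j _ => ?_)
      rw [← sub_smul, norm_smul, smul_eq_mul, mul_comm]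
      exact mul_le_mul_of_nonneg_right (hvec i j) (norm_nonneg _)
    refine (eLpNorm_mono_ae h1).trans ?_
    refine (eLpNorm_sum_le (fun r _ => ?_) (by norm_num)).trans ?_
    · have h0 : AEStronglyMeasurable (fun ξ => ‖ψ n r.1 r.2 ξ - γ r.1 r.2 ξ‖) volume :=
        ((ψ n r.1 r.2).continuous.aestronglyMeasurable.sub (hγm r.1 r.2).1).norm
      exact (h0.const_smul (3 * ‖k‖)).restrict
    · have h2 : ∀ r : Fin 3 × Fin 3, eLpNorm (fun ξ => (3 * ‖k‖) • ‖ψ n r.1 r.2 ξ - γ r.1 r.2 ξ‖) 2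
          (volume.restrict (cube k δ))
          ≤ ENNReal.ofReal (3 * ‖k‖) * ENNReal.ofReal (1 / (n + 1)) := by
        intro r
        have h3 : eLpNorm (fun ξ => (3 * ‖k‖) • ‖ψ n r.1 r.2 ξ - γ r.1 r.2 ξ‖) 2
          (volume.restrict (cube k δ)) = ENNReal.ofReal (3 * ‖k‖) *
            eLpNorm (fun ξ => ‖ψ n r.1 r.2 ξ - γ r.1 r.2 ξ‖) 2 (volume.restrict (cube k δ)) := by
          have := eLpNorm_const_smul (p := 2) (μ := volume.restrict (cube k δ)) (3 * ‖k‖)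
            (fun ξ => ‖ψ n r.1 r.2 ξ - γ r.1 r.2 ξ‖)
          rw [Real.enorm_of_nonneg (by positivity)] at this
          exact this
        rw [h3, eLpNorm_norm]
        gcongr
        exact (eLpNorm_mono_measure _ Measure.restrict_le_self).trans (hψ n r.1 r.2)
      refine (Finset.sum_le_sum fun r _ => h2 r).trans_eq ?_
      simp
  have hlim : Tendsto (fun n : ℕ => 9 * (ENNReal.ofReal (3 * ‖k‖) *
      ENNReal.ofReal (1 / ((n : ℝ) + 1)))) atTop (𝓝 0) := by
    have h1 := (ENNReal.tendsto_ofReal tendsto_one_div_add_atTop_nhds_zero_nat)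
    rw [ENNReal.ofReal_zero] at h1
    have h2 := ENNReal.Tendsto.const_mul (a := 9 * ENNReal.ofReal (3 * ‖k‖)) h1
      (.inr (ENNReal.mul_ne_top (by simp) ENNReal.ofReal_ne_top))
    simpa [mul_assoc] using h2
  exact tendsto_of_tendsto_of_tendsto_of_le_of_le tendsto_const_nhds hlim (fun n => zero_le) hbound

end transverse

/-! ### Passage from solenoidal symbols to bounded transverse fields -/

theorem pairNorm_eq {k : E3} {δ q : ℝ} (hq : 0 < q) {g₁ g₂ : E3 → C3}
    (hg₁ : AEStronglyMeasurable g₁ (volume.restrict (cube k δ))) :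
    pairNorm k δ q g₁ g₂ = (eLpNorm g₁ (ENNReal.ofReal q) (volume.restrict (cube k δ)) ^ q
      + eLpNorm g₂ (ENNReal.ofReal q) (volume.restrict (cube k δ)) ^ q) ^ (1 / q) := by
  have h : ∀ g : E3 → C3, eLpNorm g (ENNReal.ofReal q) (volume.restrict (cube k δ)) ^ q
      = ∫⁻ ξ in cube k δ, ‖g ξ‖ₑ ^ q := by
    intro g
    rw [eLpNorm_eq_lintegral_rpow_enorm_toReal (by simpa using hq) ENNReal.ofReal_ne_top,
      ENNReal.toReal_ofReal hq.le, ← ENNReal.rpow_mul, one_div_mul_cancel hq.ne', ENNReal.rpow_one]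
  rw [h, h, pairNorm, lintegral_add_left' (hg₁.enorm.pow_const q)]

theorem tendsto_integral_inner {k : E3} {δ : ℝ} {χ : E3 → ℝ} (hχ : IsCubeCutoff k δ χ)
    (hδ : 0 < δ) (v : L2) {g : E3 → C3} (hg : IsTransverse k δ g) {s : ℕ → 𝓢(E3, C3)}
    (hs : Tendsto (fun n => eLpNorm (fun ξ => s n ξ - g ξ) 2 (volume.restrict (cube k δ))) atTop
      (𝓝 0)) :
    Tendsto (fun n => ∫ ξ, (inner ℂ (fhat v ξ) (χ ξ • s n ξ) : ℂ).re) atTop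
      (𝓝 (∫ ξ, (inner ℂ (fhat v ξ) (χ ξ • g ξ) : ℂ).re)) := by
  have hχm := hχ.smooth.continuous.aestronglyMeasurable (μ := (volume : Measure E3))
  have hχ1 : ∀ ξ, ‖χ ξ‖ₑ ≤ 1 := fun ξ => by
    rw [← ofReal_norm, Real.norm_of_nonneg (hχ.nonneg ξ)]
    exact ENNReal.ofReal_le_one.2 (hχ.le_one ξ)
  have hfin := isFiniteMeasure_cube (k := k) hδ
  obtain ⟨M, hM⟩ := hg.bounded
  have hgL : MemLp g 2 volume := by
    have hind : g = indicator (cube k δ) g := by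
      ext1 ξ
      by_cases h : ξ ∈ cube k δ
      · rw [indicator_of_mem h]
      · rw [indicator_of_notMem h, hg.eq_zero ξ h]
    rw [hind, memLp_indicator_iff_restrict (measurableSet_cube k δ)]
    exact MemLp.of_bound hg.stronglyMeasurable.aestronglyMeasurable M (.of_forall hM)
  have hint : ∀ {h : E3 → C3}, MemLp h 2 volume →
      Integrable fun ξ => (inner ℂ (fhat v ξ) (χ ξ • h ξ) : ℂ).re := by
    intro h hh
    have h1 : Integrable fun ξ => ‖fhat v ξ‖ * ‖h ξ‖ :=
      MemLp.integrable_mul (p := 2) (q := 2) (memLp_fhat v).norm hh.norm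
    refine h1.mono' (Complex.continuous_re.comp_aestronglyMeasurable
      ((memLp_fhat v).1.inner (hχm.smul hh.1))) (.of_forall fun ξ => ?_)
    refine (Complex.abs_re_le_norm _).trans ((norm_inner_le_norm (𝕜 := ℂ) _ _).trans ?_)
    rw [norm_smul, Real.norm_of_nonneg (hχ.nonneg ξ)]
    gcongr
    exact mul_le_of_le_one_left (norm_nonneg _) (hχ.le_one ξ)
  refine tendsto_integral_of_L1 _ (hint hgL).1
    (.of_forall fun n => hint ((s n).memLp 2 volume)) ?_
  have hbound : ∀ n, ∫⁻ ξ, ‖(inner ℂ (fhat v ξ) (χ ξ • s n ξ) : ℂ).re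
      - (inner ℂ (fhat v ξ) (χ ξ • g ξ) : ℂ).re‖ₑ
      ≤ eLpNorm (fhat v) 2 volume *
        eLpNorm (fun ξ => s n ξ - g ξ) 2 (volume.restrict (cube k δ)) := by
    intro n
    have h2 : (2 : ℝ≥0∞).toReal = 2 := by simp
    calc _ ≤ ∫⁻ ξ in cube k δ, ‖fhat v ξ‖ₑ * ‖s n ξ - g ξ‖ₑ := by
          rw [← lintegral_indicator (measurableSet_cube k δ)]
          refine lintegral_mono fun ξ => ?_
          by_cases hξ : ξ ∈ cube k δ
          · rw [indicator_of_mem hξ, ← Complex.sub_re, ← inner_sub_right, ← smul_sub]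
            have h1 : ‖(inner ℂ (fhat v ξ) (χ ξ • (s n ξ - g ξ)) : ℂ).re‖ₑ
                ≤ ‖fhat v ξ‖ₑ * ‖χ ξ • (s n ξ - g ξ)‖ₑ := by
              rw [← ofReal_norm, ← ofReal_norm, ← ofReal_norm, ← ENNReal.ofReal_mul (norm_nonneg _)]
              exact ENNReal.ofReal_le_ofReal
                ((Complex.abs_re_le_norm _).trans (norm_inner_le_norm (𝕜 := ℂ) _ _))
            refine h1.trans (mul_le_mul_right ?_ _)
            rw [enorm_smul]
            exact mul_le_of_le_one_left' (hχ1 ξ)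
          · rw [indicator_of_notMem hξ, hχ.eq_zero hξ]
            simp
      _ ≤ eLpNorm (fhat v) 2 (volume.restrict (cube k δ)) *
          eLpNorm (fun ξ => s n ξ - g ξ) 2 (volume.restrict (cube k δ)) := by
          rw [eLpNorm_eq_lintegral_rpow_enorm_toReal (by simp) (by simp),
            eLpNorm_eq_lintegral_rpow_enorm_toReal (by simp) (by simp), h2]
          exact ENNReal.lintegral_mul_le_Lp_mul_Lq _ Real.HolderConjugate.two_two
            (memLp_fhat v).1.enorm.restrict
            ((s n).continuous.aestronglyMeasurable.sub hgL.1).enorm.restrict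
      _ ≤ _ := mul_le_mul_left (eLpNorm_mono_measure _ Measure.restrict_le_self) _
  have hlim := ENNReal.Tendsto.const_mul (a := eLpNorm (fhat v) 2 volume) hs
    (.inr (memLp_fhat v).2.ne)
  rw [mul_zero] at hlim
  exact tendsto_of_tendsto_of_tendsto_of_le_of_le tendsto_const_nhds hlim (fun n => zero_le) hbound

/-- A bound for the pairing with solenoidal symbols extends to bounded transverse fields. -/
theorem pairing_le_of_isTransverse {k : E3} {δ q : ℝ} {χ : E3 → ℝ} (hχ : IsCubeCutoff k δ χ)
    (hk : k ≠ 0) (hδ : 0 < δ) (hδk : δ < ‖k‖ / (2 * √3)) (hq1 : 1 ≤ q) (hq2 : q ≤ 2) {v w : L2}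
    {C : ℝ≥0∞} (hC : C ≠ ⊤)
    (h : ∀ g₁ g₂ : 𝓢(E3, C3), IsSolenoidal g₁ → IsSolenoidal g₂ →
      ENNReal.ofReal ((∫ ξ, (inner ℂ (fhat v ξ) (χ ξ • g₁ ξ) : ℂ).re)
        + ∫ ξ, (inner ℂ (fhat w ξ) (χ ξ • g₂ ξ) : ℂ).re) ≤ C * pairNorm k δ q g₁ g₂)
    {g₁ g₂ : E3 → C3} (hg₁ : IsTransverse k δ g₁) (hg₂ : IsTransverse k δ g₂) :
    ENNReal.ofReal ((∫ ξ, (inner ℂ (fhat v ξ) (χ ξ • g₁ ξ) : ℂ).re)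
        + ∫ ξ, (inner ℂ (fhat w ξ) (χ ξ • g₂ ξ) : ℂ).re) ≤ C * pairNorm k δ q g₁ g₂ := by
  obtain ⟨s₁, hs₁, hlim₁⟩ := hg₁.exists_approx hδ hδk hk
  obtain ⟨s₂, hs₂, hlim₂⟩ := hg₂.exists_approx hδ hδk hk
  have hfin := isFiniteMeasure_cube (k := k) hδ
  have hq : 0 < q := by linarith
  set μ := volume.restrict (cube k δ) with hμ
  set r := ENNReal.ofReal q with hr
  have hr1 : 1 ≤ r := by
    rw [hr, ← ENNReal.ofReal_one]
    exact ENNReal.ofReal_le_ofReal hq1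
  have hr2 : r ≤ 2 := by
    rw [hr, ← ENNReal.ofReal_ofNat 2]
    exact ENNReal.ofReal_le_ofReal hq2
  -- On a set of finite measure, convergence in `L²` implies convergence in `L^q`.
  set D : ℝ≥0∞ := μ univ ^ (1 / r.toReal - 1 / (2 : ℝ≥0∞).toReal) with hD
  have hDtop : D ≠ ⊤ := by
    refine ENNReal.rpow_ne_top_of_nonneg ?_ (measure_ne_top μ _)
    rw [hr, ENNReal.toReal_ofReal hq.le, ENNReal.toReal_ofNat, sub_nonneg]
    exact one_div_le_one_div_of_le hq hq2
  have hstep : ∀ {g : E3 → C3} {s : ℕ → 𝓢(E3, C3)}, IsTransverse k δ g → ∀ n,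
      eLpNorm (s n) r μ
        ≤ eLpNorm g r μ + eLpNorm (fun ξ => s n ξ - g ξ) 2 μ * D := by
    intro g s hg n
    have hgm := hg.stronglyMeasurable.aestronglyMeasurable (μ := μ)
    have hsm := (s n).continuous.aestronglyMeasurable (μ := μ)
    have h1 : (s n : E3 → C3) = g + fun ξ => s n ξ - g ξ := by
      ext1 ξ
      simp
    calc eLpNorm (s n) r μ = eLpNorm (g + fun ξ => s n ξ - g ξ) r μ := by rw [← h1]
      _ ≤ eLpNorm g r μ + eLpNorm (fun ξ => s n ξ - g ξ) r μ :=
          eLpNorm_add_le hgm (hsm.sub hgm) hr1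
      _ ≤ _ := by
          gcongr
          exact eLpNorm_le_eLpNorm_mul_rpow_measure_univ hr2 (hsm.sub hgm)
  have hzero : ∀ {g : E3 → C3} {s : ℕ → 𝓢(E3, C3)},
      Tendsto (fun n => eLpNorm (fun ξ => s n ξ - g ξ) 2 μ) atTop (𝓝 0) →
      Tendsto (fun n => eLpNorm g r μ + eLpNorm (fun ξ => s n ξ - g ξ) 2 μ * D) atTop
        (𝓝 (eLpNorm g r μ)) := by
    intro g s hlim
    have h1 := ENNReal.Tendsto.mul_const (b := D) hlim (.inr hDtop)
    have h2 := (tendsto_const_nhds (x := eLpNorm g r μ)).add h1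
    simpa using h2
  have hright : Tendsto (fun n => C *
      ((eLpNorm g₁ r μ + eLpNorm (fun ξ => s₁ n ξ - g₁ ξ) 2 μ * D) ^ q
      + (eLpNorm g₂ r μ + eLpNorm (fun ξ => s₂ n ξ - g₂ ξ) 2 μ * D) ^ q) ^ (1 / q)) atTop
      (𝓝 (C * pairNorm k δ q g₁ g₂)) := by
    rw [pairNorm_eq hq hg₁.stronglyMeasurable.aestronglyMeasurable]
    refine ENNReal.Tendsto.const_mul ?_ (.inr hC)
    have c : ∀ y : ℝ, Continuous fun x : ℝ≥0∞ => x ^ y := fun y => ENNReal.continuous_rpow_const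
    exact ((c (1 / q)).tendsto _).comp
      ((((c q).tendsto _).comp (hzero hlim₁)).add (((c q).tendsto _).comp (hzero hlim₂)))
  have hleft := ENNReal.tendsto_ofReal ((tendsto_integral_inner hχ hδ v hg₁ hlim₁).add
    (tendsto_integral_inner hχ hδ w hg₂ hlim₂))
  refine le_of_tendsto_of_tendsto' hleft hright fun n => ?_
  refine (h _ _ (hs₁ n) (hs₂ n)).trans (mul_le_mul_right ?_ _)
  rw [pairNorm_eq hq (s₁ n).continuous.aestronglyMeasurable]
  have e₁ := hstep (s := s₁) hg₁ n
  have e₂ := hstep (s := s₂) hg₂ n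
  gcongr

/-! ### Duality -/

theorem stronglyMeasurable_fhat (v : L2) : StronglyMeasurable (fhat v) :=
  (Lp.stronglyMeasurable _).comp_measurable (measurable_const_smul _)

/-- Testing with `|F|^{p-2} F`, truncated where `F` is large, recovers the norm `e_p`. -/
theorem ep_le_of_pairing_le {k : E3} {δ p q : ℝ} {χ : E3 → ℝ} (hχ : IsCubeCutoff k δ χ)
    (hδ : 0 < δ) (hp : 2 ≤ p) (hpq : p.HolderConjugate q) {v w : L2} (hv : v ∈ L2sigma)
    (hw : w ∈ L2sigma) {C : ℝ≥0∞}
    (h : ∀ g₁ g₂ : E3 → C3, IsTransverse k δ g₁ → IsTransverse k δ g₂ →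
      ENNReal.ofReal ((∫ ξ, (inner ℂ (fhat v ξ) (χ ξ • g₁ ξ) : ℂ).re)
        + ∫ ξ, (inner ℂ (fhat w ξ) (χ ξ • g₂ ξ) : ℂ).re) ≤ C * pairNorm k δ q g₁ g₂) :
    ep χ p v w ≤ C := by
  have hp0 : 0 < p := by linarith
  have hq0 : 0 < q := hpq.symm.pos
  have hfin := isFiniteMeasure_cube (k := k) hδ
  have hFm : ∀ v : L2, StronglyMeasurable fun ξ => χ ξ • fhat v ξ := fun v =>
    hχ.smooth.continuous.stronglyMeasurable.smul (stronglyMeasurable_fhat v)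
  -- Truncating keeps the test fields bounded and the integrals `I n` finite.
  set S : ℕ → Set E3 := fun n =>
    cube k δ ∩ ({ξ | ‖χ ξ • fhat v ξ‖ ≤ n} ∩ {ξ | ‖χ ξ • fhat w ξ‖ ≤ n}) with hS
  have hSm : ∀ n, MeasurableSet (S n) := fun n =>
    (measurableSet_cube k δ).inter
      ((measurableSet_le (hFm v).norm.measurable measurable_const).inter
        (measurableSet_le (hFm w).norm.measurable measurable_const))
  set I : ℕ → ℝ≥0∞ := fun n =>
    ∫⁻ ξ in S n, (‖χ ξ • fhat v ξ‖ₑ ^ p + ‖χ ξ • fhat w ξ‖ₑ ^ p) with hI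
  let g : ℕ → L2 → E3 → C3 := fun n v =>
    indicator (S n) fun ξ => ‖χ ξ • fhat v ξ‖ ^ (p - 2) • χ ξ • fhat v ξ
  have hgnorm : ∀ n v ξ, ‖g n v ξ‖ = indicator (S n) (fun ξ => ‖χ ξ • fhat v ξ‖ ^ (p - 1)) ξ := by
    intro n v ξ
    by_cases hξ : ξ ∈ S n
    · simp only [g, indicator_of_mem hξ]
      rw [norm_smul, Real.norm_of_nonneg (Real.rpow_nonneg (norm_nonneg _) _)]
      rcases eq_or_ne (χ ξ • fhat v ξ) 0 with h0 | h0
      · rw [h0, norm_zero, mul_zero, Real.zero_rpow (by linarith)]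
      · rw [← Real.rpow_add_one (norm_ne_zero_iff.2 h0)]
        ring_nf
    · simp only [g, indicator_of_notMem hξ, norm_zero]
  have htrans : ∀ n {x : L2}, x ∈ L2sigma → (∀ ξ ∈ S n, ‖χ ξ • fhat x ξ‖ ≤ n) →
      IsTransverse k δ (g n x) := by
    intro n x hx hbd
    refine ⟨?_, ⟨(n : ℝ) ^ (p - 1), fun ξ => ?_⟩, fun ξ hξ => ?_, ?_⟩
    · have h1 : Measurable fun ξ => ‖χ ξ • fhat x ξ‖ ^ (p - 2) :=
        (hFm x).norm.measurable.pow_const _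
      exact (h1.stronglyMeasurable.smul (hFm x)).indicator (hSm n)
    · rw [hgnorm]
      by_cases hξ : ξ ∈ S n
      · rw [indicator_of_mem hξ]
        exact Real.rpow_le_rpow (norm_nonneg _) (hbd ξ hξ) (by linarith)
      · rw [indicator_of_notMem hξ]
        positivity
    · exact indicator_of_notMem (fun hm => hξ hm.1) _
    · filter_upwards [ae_sum_mul_fhat_eq_zero hx] with ξ hξ
      by_cases hm : ξ ∈ S n
      · simp only [g, indicator_of_mem hm]
        have h1 : ∀ j, (ξ j : ℂ) * (‖χ ξ • fhat x ξ‖ ^ (p - 2) • χ ξ • fhat x ξ) j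
            = ((‖χ ξ • fhat x ξ‖ ^ (p - 2) : ℝ) : ℂ) * (χ ξ : ℂ) *
              ((ξ j : ℂ) * fhat x ξ j) := by
          intro j
          simp only [PiLp.smul_apply, Complex.real_smul]
          ring
        simp only [h1]
        rw [← Finset.mul_sum, hξ, mul_zero]
      · simp only [g, indicator_of_notMem hm]
        simp
  have hinner : ∀ n {x : L2}, (∀ ξ ∈ S n, ‖χ ξ • fhat x ξ‖ ≤ n) →
      0 ≤ (∫ ξ, (inner ℂ (fhat x ξ) (χ ξ • g n x ξ) : ℂ).re) ∧
      ENNReal.ofReal (∫ ξ, (inner ℂ (fhat x ξ) (χ ξ • g n x ξ) : ℂ).re)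
        = ∫⁻ ξ in S n, ‖χ ξ • fhat x ξ‖ₑ ^ p := by
    intro n x hbd
    have h1 : ∀ ξ, (inner ℂ (fhat x ξ) (χ ξ • g n x ξ) : ℂ).re
        = indicator (S n) (fun ξ => ‖χ ξ • fhat x ξ‖ ^ p) ξ := by
      intro ξ
      by_cases hm : ξ ∈ S n
      · simp only [g, indicator_of_mem hm]
        have h2 : (inner ℂ (fhat x ξ) (χ ξ • ‖χ ξ • fhat x ξ‖ ^ (p - 2) • χ ξ • fhat x ξ) : ℂ)
            = ‖χ ξ • fhat x ξ‖ ^ (p - 2) • inner ℂ (χ ξ • fhat x ξ) (χ ξ • fhat x ξ) := by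
          set c := ‖χ ξ • fhat x ξ‖ ^ (p - 2)
          rw [inner_smul_right_eq_smul, inner_smul_right_eq_smul, inner_smul_left_eq_star_smul,
            smul_comm]
          simp
        rw [h2, inner_self_eq_norm_sq_to_K, Complex.smul_re, smul_eq_mul]
        have h3 : (((‖χ ξ • fhat x ξ‖ : ℝ) : ℂ) ^ 2).re = ‖χ ξ • fhat x ξ‖ ^ 2 := by
          rw [← Complex.ofReal_pow, Complex.ofReal_re]
        rcases eq_or_ne (χ ξ • fhat x ξ) 0 with h0 | h0
        · rw [h0, norm_zero, Real.zero_rpow hp0.ne']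
          simp
        · have := Real.rpow_add_natCast (norm_ne_zero_iff.2 h0) (p - 2) 2
          rw [Nat.cast_ofNat, sub_add_cancel] at this
          rw [this]
          congr 1
      · simp only [g, indicator_of_notMem hm, smul_zero, inner_zero_right, Complex.zero_re]
    simp only [h1]
    have hnn : ∀ ξ, 0 ≤ indicator (S n) (fun ξ => ‖χ ξ • fhat x ξ‖ ^ p) ξ := fun ξ =>
      indicator_nonneg (fun ξ _ => Real.rpow_nonneg (norm_nonneg _) _) ξ
    refine ⟨integral_nonneg hnn, ?_⟩
    have hm : Measurable fun ξ => ‖χ ξ • fhat x ξ‖ ^ p := (hFm x).norm.measurable.pow_const _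
    rw [integral_indicator (hSm n), ofReal_integral_eq_lintegral_ofReal]
    · refine lintegral_congr fun ξ => ?_
      rw [← ENNReal.ofReal_rpow_of_nonneg (norm_nonneg _) hp0.le, ofReal_norm]
    · refine Measure.integrableOn_of_bounded (M := (n : ℝ) ^ p) ?_ hm.aestronglyMeasurable ?_
      · refine ((measure_mono inter_subset_left).trans_lt ?_).ne
        rw [volume_cube k hδ]
        exact ENNReal.ofReal_lt_top
      · filter_upwards [ae_restrict_mem (hSm n)] with ξ hξ
        rw [Real.norm_of_nonneg (Real.rpow_nonneg (norm_nonneg _) _)]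
        exact Real.rpow_le_rpow (norm_nonneg _) (hbd ξ hξ) hp0.le
    · exact .of_forall fun ξ => Real.rpow_nonneg (norm_nonneg _) _
  have hpair : ∀ n, pairNorm k δ q (g n v) (g n w) = I n ^ (1 / q) := by
    intro n
    rw [pairNorm, hI]
    congr 1
    have h1 : ∀ x ξ, ‖g n x ξ‖ₑ ^ q = indicator (S n) (fun ξ => ‖χ ξ • fhat x ξ‖ₑ ^ p) ξ := by
      intro x ξ
      rw [← ofReal_norm, hgnorm]
      by_cases hm : ξ ∈ S n
      · rw [indicator_of_mem hm, indicator_of_mem hm,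
          ← ENNReal.ofReal_rpow_of_nonneg (norm_nonneg _) (by linarith), ← ENNReal.rpow_mul,
          ofReal_norm]
        congr 1
        exact hpq.sub_one_mul_conj
      · rw [indicator_of_notMem hm, indicator_of_notMem hm, ENNReal.ofReal_zero,
          ENNReal.zero_rpow_of_pos hq0]
    simp only [h1]
    have h2 : ∀ ξ, indicator (S n) (fun ξ => ‖χ ξ • fhat v ξ‖ₑ ^ p) ξ
        + indicator (S n) (fun ξ => ‖χ ξ • fhat w ξ‖ₑ ^ p) ξ
        = indicator (S n) (fun ξ => ‖χ ξ • fhat v ξ‖ₑ ^ p + ‖χ ξ • fhat w ξ‖ₑ ^ p) ξ := fun ξ => by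
      by_cases hm : ξ ∈ S n
      · simp only [indicator_of_mem hm]
      · simp only [indicator_of_notMem hm, add_zero]
    simp only [h2]
    rw [lintegral_indicator (hSm n), Measure.restrict_restrict (hSm n),
      inter_eq_left.2 inter_subset_left]
  have hIle : ∀ n, I n ≤ C * I n ^ (1 / q) := by
    intro n
    have hbv : ∀ ξ ∈ S n, ‖χ ξ • fhat v ξ‖ ≤ n := fun ξ hξ => hξ.2.1
    have hbw : ∀ ξ ∈ S n, ‖χ ξ • fhat w ξ‖ ≤ n := fun ξ hξ => hξ.2.2
    have h1 := h _ _ (htrans n hv hbv) (htrans n hw hbw)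
    rw [hpair, ENNReal.ofReal_add (hinner n hbv).1 (hinner n hbw).1, (hinner n hbv).2,
      (hinner n hbw).2, ← lintegral_add_left ((hFm v).enorm.pow_const p)] at h1
    exact h1
  have hIfin : ∀ n, I n ≠ ⊤ := by
    intro n
    have h1 : I n ≤ ∫⁻ _ξ in S n, ((n : ℝ≥0∞) ^ p + (n : ℝ≥0∞) ^ p) := by
      refine setLIntegral_mono' (hSm n) fun ξ hξ => ?_
      have hb : ∀ y : C3, ‖y‖ ≤ n → ‖y‖ₑ ≤ (n : ℝ≥0∞) := fun y hy => by
        rw [← ofReal_norm, ← ENNReal.ofReal_natCast]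
        exact ENNReal.ofReal_le_ofReal hy
      gcongr
      · exact hb _ hξ.2.1
      · exact hb _ hξ.2.2
    refine (h1.trans_lt ?_).ne
    rw [lintegral_const, Measure.restrict_apply_univ]
    refine ENNReal.mul_lt_top (by simp [ENNReal.rpow_lt_top_of_nonneg hp0.le]) ?_
    refine (measure_mono inter_subset_left).trans_lt ?_
    rw [volume_cube k hδ]
    exact ENNReal.ofReal_lt_top
  -- Division by `I n ^ (1 / q)`, which is finite, and positive unless `I n = 0`.
  have hIC : ∀ n, I n ≤ C ^ p := by
    intro n
    rcases eq_or_ne (I n) 0 with h0 | h0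
    · rw [h0]
      exact zero_le
    · have h1 : I n = I n ^ (1 / p) * I n ^ (1 / q) := by
        rw [← ENNReal.rpow_add _ _ h0 (hIfin n), one_div, one_div, hpq.inv_add_inv_eq_one,
          ENNReal.rpow_one]
      have hne : I n ^ (1 / q) ≠ 0 := by
        rw [Ne, ENNReal.rpow_eq_zero_iff]
        rintro (⟨h2, -⟩ | ⟨h2, -⟩)
        · exact h0 h2
        · exact hIfin n h2
      have hne' : I n ^ (1 / q) ≠ ⊤ :=
        ENNReal.rpow_ne_top_of_nonneg (one_div_nonneg.2 hq0.le) (hIfin n)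
      have h3 := hIle n
      nth_rewrite 1 [h1] at h3
      have h4 := (ENNReal.mul_le_mul_iff_left hne hne').1 h3
      calc I n = (I n ^ (1 / p)) ^ p := by
            rw [← ENNReal.rpow_mul, one_div_mul_cancel hp0.ne', ENNReal.rpow_one]
        _ ≤ C ^ p := ENNReal.rpow_le_rpow h4 hp0.le
  have hunion : ⋃ n, S n = cube k δ := by
    refine Subset.antisymm (iUnion_subset fun n => inter_subset_left) fun ξ hξ => ?_
    obtain ⟨n, hn⟩ := exists_nat_ge (max ‖χ ξ • fhat v ξ‖ ‖χ ξ • fhat w ξ‖)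
    exact mem_iUnion.2 ⟨n, hξ, (le_max_left _ _).trans hn, (le_max_right _ _).trans hn⟩
  have hmono : Monotone S := by
    intro m n hmn ξ hξ
    have hc : (m : ℝ) ≤ n := by exact_mod_cast hmn
    exact ⟨hξ.1, show ‖χ ξ • fhat v ξ‖ ≤ n from le_trans hξ.2.1 hc,
      show ‖χ ξ • fhat w ξ‖ ≤ n from le_trans hξ.2.2 hc⟩
  have hall : ∫⁻ ξ, (‖χ ξ • fhat v ξ‖ₑ ^ p + ‖χ ξ • fhat w ξ‖ₑ ^ p) ≤ C ^ p := by
    have h1 : ∫⁻ ξ, (‖χ ξ • fhat v ξ‖ₑ ^ p + ‖χ ξ • fhat w ξ‖ₑ ^ p)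
        = ∫⁻ ξ in cube k δ, (‖χ ξ • fhat v ξ‖ₑ ^ p + ‖χ ξ • fhat w ξ‖ₑ ^ p) := by
      rw [← lintegral_indicator (measurableSet_cube k δ)]
      refine lintegral_congr fun ξ => ?_
      by_cases hm : ξ ∈ cube k δ
      · rw [indicator_of_mem hm]
      · rw [indicator_of_notMem hm, hχ.eq_zero hm]
        simp [hp0]
    rw [h1, ← hunion, setLIntegral_iUnion_of_directed _ hmono.directed_le]
    exact iSup_le hIC
  rw [ep]
  calc _ ≤ (C ^ p) ^ (1 / p) := ENNReal.rpow_le_rpow hall (one_div_nonneg.2 hp0.le)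
    _ = C := by rw [← ENNReal.rpow_mul, mul_one_div_cancel hp0.ne', ENNReal.rpow_one]

/-! ### The bound uniform in the exponent -/

section barrier

variable {ν η : ℝ} {k : E3} {R₁ : ℝ → ℝ} {t : ℝ}

theorem duhamelBound_mono {S S' : ℝ≥0∞} (h : S ≤ S') :
    duhamelBound ν η k R₁ t S ≤ duhamelBound ν η k R₁ t S' := by
  unfold duhamelBound
  gcongr

theorem duhamelBound_ne_top {S : ℝ≥0∞} (h : S ≠ ⊤) : duhamelBound ν η k R₁ t S ≠ ⊤ :=
  ENNReal.add_ne_top.2 ⟨ENNReal.mul_ne_top ENNReal.ofReal_ne_top h, ENNReal.ofReal_ne_top⟩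

/-- The weight of the initial value in the convex combination is positive, so a strict gap at time
`0` persists. -/
theorem duhamelBound_lt (hν : 0 < ν) (hη : 0 < η) (ht : 0 ≤ t) {S : ℝ≥0∞}
    (hS : S < ENNReal.ofReal (R₁ t / ‖k‖)) :
    duhamelBound ν η k R₁ t S < ENNReal.ofReal (R₁ t / ‖k‖) := by
  have hm : 0 < min ν η := lt_min hν hη
  have hpos : 0 < R₁ t / ‖k‖ := ENNReal.ofReal_pos.1 (zero_le.trans_lt hS)
  have hx : 0 < Real.exp (-(rate ν η k * t)) := Real.exp_pos _
  have hx1 : Real.exp (-(rate ν η k * t)) ≤ 1 := by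
    rw [Real.exp_le_one_iff, neg_nonpos]
    unfold rate
    positivity
  unfold duhamelBound
  set x := Real.exp (-(rate ν η k * t))
  calc ENNReal.ofReal x * S + ENNReal.ofReal ((1 - x) * (R₁ t / ‖k‖))
      < ENNReal.ofReal x * ENNReal.ofReal (R₁ t / ‖k‖)
        + ENNReal.ofReal ((1 - x) * (R₁ t / ‖k‖)) :=
        ENNReal.add_lt_add_right ENNReal.ofReal_ne_top
          (ENNReal.mul_lt_mul_right (ENNReal.ofReal_pos.2 hx).ne' ENNReal.ofReal_ne_top hS)
    _ = ENNReal.ofReal (R₁ t / ‖k‖) := by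
        rw [← ENNReal.ofReal_mul hx.le, ← ENNReal.ofReal_add (by positivity)
          (mul_nonneg (sub_nonneg.2 hx1) hpos.le)]
        congr 1
        ring

end barrier

theorem LocBdd.ae_isLeftLebesguePt_fieldPair {w : ℝ → L2} (hw : LocBdd w) :
    ∀ᵐ t ∂volume.restrict (Ioi (0 : ℝ)), ∀ φ, IsLeftLebesguePt t fun s => fieldPair φ (w s) := by
  filter_upwards [hw.ae_isLeftLebesguePt] with t ht φ
  exact ht (fieldPair φ)

theorem WeaklyContinuous.isLeftLebesguePt_fieldPair {w : ℝ → L2} (hw : WeaklyContinuous w) {t : ℝ}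
    (ht : 0 < t) (φ : 𝓢(E3, E3)) : IsLeftLebesguePt t fun s => fieldPair φ (w s) := by
  refine isLeftLebesguePt_of_continuousOn ?_ ht
  exact (hw (φ.toLp 2)).congr fun s _ => fieldPair_def φ (w s)

/-- The barrier holds at every time which is a left Lebesgue point of the pairings of the solution
with Schwartz fields. -/
theorem iSup_ep_lt {ν η : ℝ} (hν : 0 < ν) (hη : 0 < η) {f₁ f₂ : ℝ → L2} {u₀ b₀ : L2}
    {u b : ℝ → L2}
    (h₁ : FrequencyEquation ν u₀ u f₁ fun t => tensor (u t) (u t) - tensor (b t) (b t))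
    (h₂ : FrequencyEquation η b₀ b f₂ fun t => tensor (u t) (b t) - tensor (b t) (u t))
    {R : ℝ → ℝ} (hR : ∀ t > 0, ‖u t‖ ^ 2 + ‖b t‖ ^ 2 ≤ R t ^ 2)
    {k : E3} (hk : k ≠ 0) {δ : ℝ} (hδ : 0 < δ) (hδk : δ < ‖k‖ / (2 * √3))
    {χ : E3 → ℝ} (hχ : IsCubeCutoff k δ χ) {R₁ : ℝ → ℝ} (hR₁ : MonotoneOn R₁ (Ici 0))
    (hdom : ∀ p : ℝ, 2 ≤ p → ∀ t : ℝ, 0 ≤ t →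
      ENNReal.ofReal ((2 : ℝ) ^ (1 / p) * (2 * δ) ^ (3 / p) * R t ^ 2)
        + 2 * hp χ p f₁ f₂ t < ENNReal.ofReal (min ν η / 6 * R₁ t))
    (hinit : (⨆ p ∈ Ici (2 : ℝ), ep χ p u₀ b₀) < ENNReal.ofReal (R₁ 0 / ‖k‖)) {t : ℝ} (ht : 0 < t)
    (hu : u t ∈ L2sigma) (hb : b t ∈ L2sigma)
    (hgood₁ : ∀ φ, IsLeftLebesguePt t fun s => fieldPair φ (u s))
    (hgood₂ : ∀ φ, IsLeftLebesguePt t fun s => fieldPair φ (b s)) :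
    (⨆ p ∈ Ici (2 : ℝ), ep χ p (u t) (b t)) < ENNReal.ofReal (R₁ t / ‖k‖) := by
  set S := ⨆ p ∈ Ici (2 : ℝ), ep χ p u₀ b₀ with hS
  have hStop : S ≠ ⊤ := hinit.ne_top
  have hSt : S < ENNReal.ofReal (R₁ t / ‖k‖) := hinit.trans_le <| ENNReal.ofReal_le_ofReal <|
    div_le_div_of_nonneg_right (hR₁ self_mem_Ici ht.le ht.le) (norm_nonneg k)
  refine lt_of_le_of_lt (iSup₂_le fun p hp => ?_) (duhamelBound_lt hν hη ht.le hSt)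
  have hp2 : 2 ≤ p := hp
  have hpq := Real.HolderConjugate.conjExponent (show 1 < p by linarith)
  have hq1 : 1 ≤ p.conjExponent := hpq.symm.lt.le
  have hq2 : p.conjExponent ≤ 2 := by
    rw [Real.conjExponent, div_le_iff₀ (by linarith)]
    linarith
  have hle : ep χ p u₀ b₀ ≤ S := le_iSup₂ (f := fun p (_ : p ∈ Ici (2 : ℝ)) => ep χ p u₀ b₀) p hp
  have hpfin : ep χ p u₀ b₀ ≠ ⊤ := ne_top_of_le_ne_top hStop hle
  refine le_trans ?_ (duhamelBound_mono hle)
  refine ep_le_of_pairing_le hχ hδ hp2 hpq hu hb fun g₁ g₂ hg₁ hg₂ => ?_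
  refine pairing_le_of_isTransverse hχ hk hδ hδk hq1 hq2 (duhamelBound_ne_top hpfin)
    (fun s₁ s₂ hs₁ hs₂ => ?_) hg₁ hg₂
  exact pairing_le hν hη h₁ h₂ hR hk hδ hδk hχ hR₁ hpq (hdom p hp2) hpfin ht hgood₁ hgood₂ hs₁ hs₂

end

end MHD

theorem mainTheorem1
    (ν η : ℝ) (hν : 0 < ν) (hη : 0 < η)
    (f₁ f₂ : ℝ → MHD.L2) (hf₁ : MHD.IsForce f₁) (hf₂ : MHD.IsForce f₂)
    (u₀ b₀ : MHD.L2) (u b : ℝ → MHD.L2)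
    (hub : MHD.IsWeakSolution ν η f₁ f₂ u₀ b₀ u b)
    (R : ℝ → ℝ) (hR : ∀ t > 0, ‖u t‖ ^ 2 + ‖b t‖ ^ 2 ≤ R t ^ 2)
    (k : MHD.E3) (hk : k ≠ 0) (δ : ℝ) (hδ : 0 < δ) (hδk : δ < ‖k‖ / (2 * Real.sqrt 3))
    (χ : MHD.E3 → ℝ) (hχ : MHD.IsCubeCutoff k δ χ)
    (R₁ : ℝ → ℝ) (hR₁ : MonotoneOn R₁ (Set.Ici 0))
    (hdom : ∀ p : ℝ, 2 ≤ p → ∀ t : ℝ, 0 ≤ t →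
      ENNReal.ofReal ((2 : ℝ) ^ (1 / p) * (2 * δ) ^ (3 / p) * R t ^ 2)
        + 2 * MHD.hp χ p f₁ f₂ t < ENNReal.ofReal (min ν η / 6 * R₁ t))
    (hinit : (⨆ p ∈ Set.Ici (2 : ℝ), MHD.ep χ p u₀ b₀) < ENNReal.ofReal (R₁ 0 / ‖k‖)) :
    (∀ᵐ t ∂(volume.restrict (Set.Ioi (0 : ℝ))),
      (⨆ p ∈ Set.Ici (2 : ℝ), MHD.ep χ p (u t) (b t)) < ENNReal.ofReal (R₁ t / ‖k‖)) ∧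
    (MHD.WeaklyContinuous u → MHD.WeaklyContinuous b → ∀ t > 0,
      (⨆ p ∈ Set.Ici (2 : ℝ), MHD.ep χ p (u t) (b t)) < ENNReal.ofReal (R₁ t / ‖k‖)) := by
  obtain ⟨-, -, Gu, Gb, hu, hb, hw₁, hw₂, -⟩ := hub
  have h₁ := hw₁.frequencyEquation hf₁ hu hu hu hb hb
  have h₂ := hw₂.frequencyEquation hf₂ hb hu hb hb hu
  refine ⟨?_, fun hcu hcb t ht => ?_⟩
  · filter_upwards [MHD.LocBdd.ae_isLeftLebesguePt_fieldPair h₁.locBdd,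
      MHD.LocBdd.ae_isLeftLebesguePt_fieldPair h₂.locBdd, hu.mem_L2sigma, hb.mem_L2sigma,
      ae_restrict_mem measurableSet_Ioi] with t hgu hgb htu htb ht
    exact MHD.iSup_ep_lt hν hη h₁ h₂ hR hk hδ hδk hχ hR₁ hdom hinit ht htu htb hgu hgb
  · exact MHD.iSup_ep_lt hν hη h₁ h₂ hR hk hδ hδk hχ hR₁ hdom hinit ht
      (hcu.mem_L2sigma hu.mem_L2sigma ht) (hcb.mem_L2sigma hb.mem_L2sigma ht)
      (MHD.WeaklyContinuous.isLeftLebesguePt_fieldPair hcu ht)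
      (MHD.WeaklyContinuous.isLeftLebesguePt_fieldPair hcb ht)
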